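/- For all real numbers $m>0$, $A_0>0$, $\nu>1$ and $d$ there is a constant $\Gamma=\Gamma(m,A_0,\nu,d)$ with the following property. Let $(M,g)$ be a connected smooth Riemannian manifold (without boundary, of any dimension), let $\sigma\ge 0$ be a smooth function on $M$, let $R_0>0$, and let $\rho:M\to(0,\infty)$ be a Lipschitz function that is proper (as a map into $\mathbb R$). Write $D(r)=\{x\in M:\rho(x)<r\}$, $\Sigma(r)=\{x\in M:\rho(x)=r\}$ and $\mathrm V(r)=\mathrm{Vol}(D(r))$. Assume the following. (L) $\tfrac12\le|\nabla\rho|\le1$ almost everywhere on $\{\rho\ge R_0\}$, and $\Delta\rho\le\frac m\rho$ there in the weak sense, that is, $-\int_M\langle\nabla\rho,\nabla\phi\rangle\le\int_M\frac m\rho\,\phi$ for every Lipschitz function $\phi\ge0$ with compact support contained in $\{\rho>R_0\}$. (M) (Mean value property with constants $A_0,\nu$.) For all $0<\theta\le1$ and $R\ge4R_0$, the inequality $$\sup_{\Sigma(R)}u\le\frac{A_0}{\theta^{2\nu}}\,\frac1{\mathrm V((1+\theta)R)}\int_{D((1+\theta)R)\setminus D(R_0)}u$$ holds for every function $u$ that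 is of class $C^2$ in a neighbourhood of $D(2R)\setminus D(R_0)$ and satisfies $u>0$ and $\Delta u\ge\sigma u$ on $D(2R)\setminus D(R_0)$ (with no requirement if the integral is $+\infty$). Then the vector space $$L^d(M)=\{v\in C^2(M):\ \Delta v=\sigma v\ \text{ and }\ |v|\le c\,\rho^d\ \text{ on } M \text{ for some constant } c\}$$ satisfies $\dim L^d(M)\le\Gamma$. -/

import Mathlib

open scoped Manifold ContDiff Bundle

noncomputable section

namespace RiemGeom

open MeasureTheory Bundle

section Calculus

variable {n : ℕ} {M : Type*} [TopologicalSpace M] [ChartedSpace (EuclideanSpace ℝ (Fin n)) M]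

/-- The `i`-th coordinate vector of `ℝⁿ`. -/
def basisVec (n : ℕ) (i : Fin n) : EuclideanSpace ℝ (Fin n) := EuclideanSpace.single i 1

/-- The partial derivative `∂ᵢ f` of a function on `ℝⁿ`. -/
def pderiv (i : Fin n) (f : EuclideanSpace ℝ (Fin n) → ℝ) (z : EuclideanSpace ℝ (Fin n)) : ℝ :=
  fderiv ℝ f z (basisVec n i)

/-- The function `u` read in the preferred chart around `p`, as a function on `ℝⁿ`. -/
def readInChart (p : M) (u : M → ℝ) : EuclideanSpace ℝ (Fin n) → ℝ :=
  u ∘ (extChartAt (𝓡 n) p).symm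

variable [RiemannianBundle (fun x : M => TangentSpace (𝓡 n) x)]

/-- The coordinate vector field `∂ᵢ` of the preferred chart around `p`, at the point with
coordinates `z`. -/
def coordField (p : M) (i : Fin n) (z : EuclideanSpace ℝ (Fin n)) :
    TangentSpace (𝓡 n) ((extChartAt (𝓡 n) p).symm z) :=
  mfderiv 𝓘(ℝ, EuclideanSpace ℝ (Fin n)) (𝓡 n) (extChartAt (𝓡 n) p).symm z (basisVec n i)

/-- The matrix `g_{ij} = ⟨∂ᵢ, ∂ⱼ⟩` of the metric in the preferred chart around `p`. -/
def metricMatrix (p : M) (z : EuclideanSpace ℝ (Fin n)) : Matrix (Fin n) (Fin n) ℝ :=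
  Matrix.of fun i j => inner ℝ (coordField p i z) (coordField p j z)

/-- The Christoffel symbols
`Γᵏᵢⱼ = ½ ∑ₗ gᵏˡ (∂ᵢ gⱼₗ + ∂ⱼ gᵢₗ - ∂ₗ gᵢⱼ)` in the preferred chart around `p`. -/
def christoffel (p : M) (i j k : Fin n) (z : EuclideanSpace ℝ (Fin n)) : ℝ :=
  (1 / 2) * ∑ l, (metricMatrix p z)⁻¹ k l *
    (pderiv i (fun y => metricMatrix p y j l) z + pderiv j (fun y => metricMatrix p y i l) z
      - pderiv l (fun y => metricMatrix p y i j) z)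

/-- The components `∂ᵢ ∂ⱼ u - ∑ₖ Γᵏᵢⱼ ∂ₖ u` of the covariant Hessian of `u` at the point `p`,
in the preferred chart around `p`. -/
def hessian (u : M → ℝ) (p : M) (i j : Fin n) : ℝ :=
  pderiv i (pderiv j (readInChart (n := n) p u)) (extChartAt (𝓡 n) p p)
    - ∑ k, christoffel p i j k (extChartAt (𝓡 n) p p)
        * pderiv k (readInChart (n := n) p u) (extChartAt (𝓡 n) p p)

variable (n) in
/-- The Laplace–Beltrami operator `Δu = ∑ᵢⱼ gⁱʲ (∂ᵢ ∂ⱼ u - ∑ₖ Γᵏᵢⱼ ∂ₖ u)`, that is, the trace of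
the Hessian. For functions of class `C²` its value does not depend on the chart. -/
def laplacian (u : M → ℝ) (p : M) : ℝ :=
  ∑ i, ∑ j, (metricMatrix p (extChartAt (𝓡 n) p p))⁻¹ i j * hessian u p i j

variable (n) in
/-- The differential of `u` at `p`, as a linear form on the tangent space. -/
def differential (u : M → ℝ) (p : M) : TangentSpace (𝓡 n) p →L[ℝ] ℝ :=
  mfderiv (𝓡 n) 𝓘(ℝ, ℝ) u p

instance (p : M) : FiniteDimensional ℝ (TangentSpace (𝓡 n) p) :=
  inferInstanceAs (FiniteDimensional ℝ (EuclideanSpace ℝ (Fin n)))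

instance (p : M) : CompleteSpace (TangentSpace (𝓡 n) p) :=
  FiniteDimensional.complete ℝ (TangentSpace (𝓡 n) p)

variable (n) in
/-- The Riemannian gradient of `u`; it is `0` where `u` is not differentiable. -/
def grad (u : M → ℝ) (p : M) : TangentSpace (𝓡 n) p :=
  (InnerProductSpace.toDual ℝ (TangentSpace (𝓡 n) p)).symm (differential n u p)

end Calculus

section Linearity

variable {n : ℕ} {M : Type*} [TopologicalSpace M] [ChartedSpace (EuclideanSpace ℝ (Fin n)) M]

theorem contDiffAt_readInChart {u : M → ℝ} {p : M} (hu : ContMDiffAt (𝓡 n) 𝓘(ℝ, ℝ) 2 u p) :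
    ContDiffAt ℝ 2 (readInChart (n := n) p u) (extChartAt (𝓡 n) p p) := by
  have h := (contMDiffAt_iff.1 hu).2
  simpa [readInChart, contDiffWithinAt_univ, chartAt_self_eq, Function.comp_def] using h

theorem differentiableAt_pderiv {f : EuclideanSpace ℝ (Fin n) → ℝ}
    {z : EuclideanSpace ℝ (Fin n)} (hf : ContDiffAt ℝ 2 f z) (j : Fin n) :
    DifferentiableAt ℝ (pderiv j f) z := by
  have h : ContDiffAt ℝ 1 (fderiv ℝ f) z := hf.fderiv_right (by norm_num)
  have h' : DifferentiableAt ℝ (fderiv ℝ f) z := h.differentiableAt (by norm_num)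
  exact h'.clm_apply (differentiableAt_const _)

theorem pderiv_add {f g : EuclideanSpace ℝ (Fin n) → ℝ} {z : EuclideanSpace ℝ (Fin n)}
    (hf : DifferentiableAt ℝ f z) (hg : DifferentiableAt ℝ g z) (i : Fin n) :
    pderiv i (f + g) z = pderiv i f z + pderiv i g z := by
  simp [pderiv, fderiv_add hf hg]

theorem pderiv_const_smul (c : ℝ) (f : EuclideanSpace ℝ (Fin n) → ℝ)
    (z : EuclideanSpace ℝ (Fin n)) (i : Fin n) :
    pderiv i (c • f) z = c * pderiv i f z := by
  simp [pderiv, fderiv_const_smul_field]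

theorem pderiv_pderiv_add {f g : EuclideanSpace ℝ (Fin n) → ℝ} {z : EuclideanSpace ℝ (Fin n)}
    (hf : ContDiffAt ℝ 2 f z) (hg : ContDiffAt ℝ 2 g z) (i j : Fin n) :
    pderiv i (pderiv j (f + g)) z = pderiv i (pderiv j f) z + pderiv i (pderiv j g) z := by
  have h : pderiv j (f + g) =ᶠ[nhds z] pderiv j f + pderiv j g := by
    filter_upwards [hf.eventually (by simp), hg.eventually (by simp)] with y hy hy'
    exact pderiv_add (hy.differentiableAt (by norm_num)) (hy'.differentiableAt (by norm_num)) j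
  rw [← pderiv_add (differentiableAt_pderiv hf j) (differentiableAt_pderiv hg j)]
  simp only [pderiv] at h ⊢
  rw [h.fderiv_eq]

variable [RiemannianBundle (fun x : M => TangentSpace (𝓡 n) x)]

theorem laplacian_add {u v : M → ℝ} {p : M} (hu : ContMDiffAt (𝓡 n) 𝓘(ℝ, ℝ) 2 u p)
    (hv : ContMDiffAt (𝓡 n) 𝓘(ℝ, ℝ) 2 v p) :
    laplacian n (u + v) p = laplacian n u p + laplacian n v p := by
  have hu' := contDiffAt_readInChart hu
  have hv' := contDiffAt_readInChart hv
  have key : ∀ i j, hessian (n := n) (u + v) p i j = hessian u p i j + hessian v p i j := by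
    intro i j
    have e : readInChart (n := n) p (u + v) = readInChart p u + readInChart p v := rfl
    simp only [hessian, e, pderiv_pderiv_add hu' hv',
      pderiv_add (hu'.differentiableAt (by norm_num)) (hv'.differentiableAt (by norm_num)),
      mul_add, Finset.sum_add_distrib]
    ring
  simp only [laplacian, key, mul_add, Finset.sum_add_distrib]

theorem laplacian_const_smul (c : ℝ) (u : M → ℝ) (p : M) :
    laplacian n (c • u) p = c * laplacian n u p := by
  have key : ∀ i j, hessian (n := n) (c • u) p i j = c * hessian u p i j := by
    intro i j
    have e : readInChart (n := n) p (c • u) = c • readInChart p u := rfl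
    have e' : pderiv j (c • readInChart (n := n) p u) = c • pderiv j (readInChart p u) := by
      funext z
      exact pderiv_const_smul c _ z j
    simp only [hessian, e, e', pderiv_const_smul, mul_sub, Finset.mul_sum]
    congr 1
    exact Finset.sum_congr rfl fun k _ => by ring
  simp only [laplacian, key, Finset.mul_sum]
  exact Finset.sum_congr rfl fun i _ => Finset.sum_congr rfl fun j _ => by ring

end Linearity

/-- The Riemannian volume of an `n`-dimensional Riemannian manifold, as the `n`-dimensional
Hausdorff measure of the Riemannian distance, normalized to be Lebesgue measure on `ℝⁿ`. -/
def vol (n : ℕ) (M : Type*) [MetricSpace M] [MeasurableSpace M] [BorelSpace M] : Measure M :=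
  μHE[n]

section Setting

variable {M : Type*}

/-- The sublevel set `D(r) = {ρ < r}`. -/
def subLevel (ρ : M → ℝ) (r : ℝ) : Set M := {x | ρ x < r}

/-- The level set `Σ(r) = {ρ = r}`. -/
def level (ρ : M → ℝ) (r : ℝ) : Set M := {x | ρ x = r}

variable (n : ℕ) [MetricSpace M] [ChartedSpace (EuclideanSpace ℝ (Fin n)) M]
  [RiemannianBundle (fun x : M => TangentSpace (𝓡 n) x)]

/-- The space `L^d(M)` of the solutions `v` of `Δv = σ v` on `M` with `|v| ≤ c ρ^d` on `M` for
some constant `c` (depending on `v`). -/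
def polyGrowthSolutions (σ ρ : M → ℝ) (d : ℝ) : Submodule ℝ (M → ℝ) where
  carrier := {v | ContMDiff (𝓡 n) 𝓘(ℝ, ℝ) 2 v ∧ (∀ x, laplacian n v x = σ x * v x) ∧
    ∃ c : ℝ, ∀ x, |v x| ≤ c * ρ x ^ d}
  zero_mem' := by
    refine ⟨contMDiff_const, fun x => ?_, 0, fun x => by simp⟩
    have h := laplacian_const_smul (n := n) 0 (0 : M → ℝ) x
    simpa using h
  add_mem' := by
    rintro u v ⟨hu, hu', c, hc⟩ ⟨hv, hv', c', hc'⟩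
    refine ⟨hu.add hv, fun x => ?_, c + c', fun x => ?_⟩
    · rw [laplacian_add (hu x) (hv x), hu', hv', Pi.add_apply, mul_add]
    · calc |(u + v) x| ≤ |u x| + |v x| := abs_add_le _ _
        _ ≤ c * ρ x ^ d + c' * ρ x ^ d := add_le_add (hc x) (hc' x)
        _ = (c + c') * ρ x ^ d := by ring
  smul_mem' := by
    rintro a u ⟨hu, hu', c, hc⟩
    refine ⟨(contMDiff_const (I' := 𝓘(ℝ, ℝ)) (c := a)).smul hu, fun x => ?_, |a| * c, fun x => ?_⟩
    · rw [laplacian_const_smul, hu', Pi.smul_apply, smul_eq_mul]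
      ring
    · rw [Pi.smul_apply, smul_eq_mul, abs_mul, mul_assoc]
      exact mul_le_mul_of_nonneg_left (hc x) (abs_nonneg a)

variable [MeasurableSpace M] [BorelSpace M]

/-- `ρ` is a proper positive Lipschitz function such that `1/2 ≤ |∇ρ| ≤ 1` and `Δρ ≤ m / ρ` in the
weak sense for `ρ ≥ R₀`: the first holds almost everywhere, and the second against nonnegative
Lipschitz test functions with compact support in `{ρ > R₀}`. -/
structure IsGoodExhaustion (m R₀ : ℝ) (ρ : M → ℝ) : Prop where
  pos : ∀ x, 0 < ρ x
  proper : IsProperMap ρ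
  lipschitz : ∃ K, LipschitzWith K ρ
  norm_grad : ∀ᵐ x ∂(vol n M), R₀ ≤ ρ x → 1 / 2 ≤ ‖grad n ρ x‖ ∧ ‖grad n ρ x‖ ≤ 1
  laplacian_le : ∀ φ : M → ℝ, (∃ K, LipschitzWith K φ) → HasCompactSupport φ →
    tsupport φ ⊆ {x | R₀ < ρ x} → (∀ x, 0 ≤ φ x) →
    -∫ x, inner ℝ (grad n ρ x) (grad n φ x) ∂(vol n M) ≤ ∫ x, m / ρ x * φ x ∂(vol n M)

/-- The mean value property with constants `A₀` and `ν`. For `0 < θ ≤ 1`, `R ≥ 4 R₀` and every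
positive `u` of class `C²` in a neighbourhood of `D(2R) \ D(R₀)` with `Δu ≥ σ u` on
`D(2R) \ D(R₀)`, the values of `u` on `Σ(R)` are at most
`A₀ / θ^(2ν) · 1 / V((1+θ)R) · ∫ u` over `D((1+θ)R) \ D(R₀)`. Where that integral is `+∞`,
there is nothing to require. -/
def HasMeanValueProperty (σ ρ : M → ℝ) (R₀ A₀ ν : ℝ) : Prop :=
  ∀ θ R : ℝ, 0 < θ → θ ≤ 1 → 4 * R₀ ≤ R → ∀ u : M → ℝ,
    (∀ x ∈ subLevel ρ (2 * R) \ subLevel ρ R₀, ContMDiffAt (𝓡 n) 𝓘(ℝ, ℝ) 2 u x ∧ 0 < u x ∧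
      σ x * u x ≤ laplacian n u x) →
    IntegrableOn u (subLevel ρ ((1 + θ) * R) \ subLevel ρ R₀) (vol n M) →
    ∀ x ∈ level ρ R, u x ≤ A₀ / θ ^ (2 * ν) * (1 / (vol n M).real (subLevel ρ ((1 + θ) * R))) *
      ∫ y in subLevel ρ ((1 + θ) * R) \ subLevel ρ R₀, u y ∂(vol n M)

end Setting

end RiemGeom

end

/-!
The dimension is bounded because polynomial growth together with volume doubling limits the growth
of the `L²(D(R))` norms of solutions from above, while the mean value inequality forces the
determinant of the Gram matrix of many independent solutions to grow fast.

*Doubling.* Testing `Δρ ≤ m / ρ` against a function of `ρ` that vanishes to second order at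
`R / 2` and decays like a high power towards `3R` gives `V(2R) ≤ K V(R)` with `K` depending on `m`
only (`measureReal_subLevel_two_mul_le`).

*Mean value inequality.* For a solution `v` the function `v²` is a nonnegative subsolution. On a
noncompact manifold there is a function `h` that is a positive strict subsolution on a given
compact set
(`exists_pos_strict_subsolution`), so that the mean value property (used with `θ = 1` only) and the
maximum principle apply to `v² + ε h`. This yields `V(2R) v² ≤ A₀ ∫_{D(2R)} v²` on all of `D(R)`
(`sq_le_integral_sq`).

Let `v₁, …, vₖ` be linearly independent solutions and `G_R` their Gram matrix on `D(R)`. Applied to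
combinations of the `vᵢ`, the mean value inequality gives `tr (G_{2R}⁻¹ G_R) ≤ A₀`
(`trace_inv_gramMatrix_mul_le`), whence `det G_R ≤ (A₀ / k)ᵏ det G_{2R}` by the inequality between
arithmetic and geometric means. Iterating over `R = 2ʲ R₁`, `det G_R` grows at least like
`(k / A₀)^(k j)`. Since `|vᵢ| ≤ c ρ^d` and the volume is doubling, it grows at most like
`(4^(max d 0) K)^(k j)`. Therefore `k ≤ A₀ 4^(max d 0) K`
(`natCast_le_of_gramMatrix_growth`, `natCast_le_of_linearIndependent`).

On a compact manifold the solutions are constant by the strong maximum principle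
(`eq_of_compactSpace`), and the dimension is at most one.

The Laplacian is defined at each point by the chart chosen there. To compute it on a whole
coordinate ball, as the construction of `h` requires, its invariance under changes of coordinates is
needed (`coordLaplacian_comp`, `laplacian_eq_coordLaplacian`).
-/

noncomputable section

namespace RiemGeom

open MeasureTheory Bundle
open scoped Matrix Topology

/-! ### The Laplacian under a change of coordinates -/

section CoordinateChange
variable {n : ℕ}
local notation "𝔼" => EuclideanSpace ℝ (Fin n)

/-- The Laplacian `∑ᵢⱼ gⁱʲ (∂ᵢ ∂ⱼ f - ∑ₖ Γᵏᵢⱼ ∂ₖ f)` of the metric with coefficient matrix `G` on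
`ℝⁿ`, where the `Γᵏᵢⱼ` are the Christoffel symbols of `G`. -/
def coordLaplacian (G : 𝔼 → Matrix (Fin n) (Fin n) ℝ) (f : 𝔼 → ℝ) (z : 𝔼) : ℝ :=
  ∑ i, ∑ j, (G z)⁻¹ i j * (pderiv i (pderiv j f) z -
    ∑ k, ((1 / 2) * ∑ l, (G z)⁻¹ k l *
      (pderiv i (fun y => G y j l) z + pderiv j (fun y => G y i l) z
        - pderiv l (fun y => G y i j) z)) * pderiv k f z)

/-- The Jacobian matrix `∂ᵢ τᵃ`. -/
def jacobian (τ : 𝔼 → 𝔼) (z : 𝔼) : Matrix (Fin n) (Fin n) ℝ :=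
  Matrix.of fun a i => pderiv i (fun y => τ y a) z

theorem pderiv_mul {f g : 𝔼 → ℝ} {z : 𝔼} (hf : DifferentiableAt ℝ f z)
    (hg : DifferentiableAt ℝ g z) (i : Fin n) :
    pderiv i (fun y => f y * g y) z = pderiv i f z * g z + f z * pderiv i g z := by
  have := fderiv_mul hf hg
  simp only [pderiv]
  rw [show (fun y => f y * g y) = f * g from rfl, this]
  simp
  ring

theorem pderiv_sum {ι : Type*} (s : Finset ι) {f : ι → 𝔼 → ℝ} {z : 𝔼}
    (hf : ∀ a ∈ s, DifferentiableAt ℝ (f a) z) (i : Fin n) :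
    pderiv i (fun y => ∑ a ∈ s, f a y) z = ∑ a ∈ s, pderiv i (f a) z := by
  simp only [pderiv]
  rw [fderiv_fun_sum hf]
  simp

theorem pderiv_congr {f g : 𝔼 → ℝ} {z : 𝔼} (h : f =ᶠ[𝓝 z] g) (i : Fin n) :
    pderiv i f z = pderiv i g z := by
  simp only [pderiv, h.fderiv_eq]

theorem pderiv_coord {τ : 𝔼 → 𝔼} {z : 𝔼} (hτ : DifferentiableAt ℝ τ z) (a i : Fin n) :
    pderiv i (fun y => τ y a) z = (fderiv ℝ τ z (basisVec n i)) a := by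
  have := ((EuclideanSpace.proj (𝕜 := ℝ) a).hasFDerivAt).comp z hτ.hasFDerivAt
  have h2 := this.fderiv
  simp only [pderiv]
  change (fderiv ℝ ((EuclideanSpace.proj a : 𝔼 →L[ℝ] ℝ) ∘ τ) z) _ = _
  rw [h2]
  rfl

theorem clm_apply_eq_sum (ℓ : 𝔼 →L[ℝ] ℝ) (v : 𝔼) : ℓ v = ∑ a, v a * ℓ (basisVec n a) := by
  conv_lhs => rw [← (EuclideanSpace.basisFun (Fin n) ℝ).sum_repr v]
  simp [basisVec]

theorem pderiv_comp {f : 𝔼 → ℝ} {τ : 𝔼 → 𝔼} {z : 𝔼} (hf : DifferentiableAt ℝ f (τ z))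
    (hτ : DifferentiableAt ℝ τ z) (i : Fin n) :
    pderiv i (f ∘ τ) z = ∑ a, jacobian τ z a i * pderiv a f (τ z) := by
  simp only [pderiv, fderiv_comp z hf hτ, ContinuousLinearMap.comp_apply]
  rw [clm_apply_eq_sum]
  simp only [jacobian, Matrix.of_apply, pderiv_coord hτ]

theorem pderiv_pderiv_eq_fderiv {f : 𝔼 → ℝ} {z : 𝔼} (hf : ContDiffAt ℝ 2 f z) (i j : Fin n) :
    pderiv i (pderiv j f) z = fderiv ℝ (fderiv ℝ f) z (basisVec n i) (basisVec n j) := by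
  have h : ContDiffAt ℝ 1 (fderiv ℝ f) z := hf.fderiv_right (by norm_num)
  have h' : DifferentiableAt ℝ (fderiv ℝ f) z := h.differentiableAt (by norm_num)
  have e : pderiv j f = fun y => fderiv ℝ f y (basisVec n j) := rfl
  rw [e]
  simp only [pderiv]
  rw [fderiv_clm_apply h' (differentiableAt_const _)]
  simp

theorem pderiv_pderiv_comm {f : 𝔼 → ℝ} {z : 𝔼} (hf : ContDiffAt ℝ 2 f z) (i j : Fin n) :
    pderiv i (pderiv j f) z = pderiv j (pderiv i f) z := by
  have hs : IsSymmSndFDerivAt ℝ f z := hf.isSymmSndFDerivAt (by simp)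
  rw [pderiv_pderiv_eq_fderiv hf, pderiv_pderiv_eq_fderiv hf, hs.eq]

theorem pderiv_pderiv_comp {f : 𝔼 → ℝ} {τ : 𝔼 → 𝔼} {z : 𝔼} (hf : ContDiffAt ℝ 2 f (τ z))
    (hτ : ContDiffAt ℝ 2 τ z) (i j : Fin n) :
    pderiv i (pderiv j (f ∘ τ)) z =
      ∑ a, pderiv i (pderiv j (fun y => τ y a)) z * pderiv a f (τ z) +
      ∑ a, ∑ b, jacobian τ z a i * jacobian τ z b j * pderiv a (pderiv b f) (τ z) := by
  have hτd : DifferentiableAt ℝ τ z := hτ.differentiableAt (by norm_num)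
  have e : pderiv j (f ∘ τ) =ᶠ[𝓝 z]
      fun y => ∑ a, jacobian τ y a j * (pderiv a f ∘ τ) y := by
    filter_upwards [hτ.eventually (by simp),
      hτ.continuousAt.eventually (hf.eventually (by simp))] with y hy hy'
    exact pderiv_comp (hy'.differentiableAt (by norm_num)) (hy.differentiableAt (by norm_num)) j
  have hT : ∀ a, DifferentiableAt ℝ (fun y => jacobian τ y a j) z := fun a =>
    differentiableAt_pderiv (f := fun y => τ y a)
      ((EuclideanSpace.proj (𝕜 := ℝ) a).contDiff.contDiffAt.comp z hτ) j
  have hP : ∀ a, DifferentiableAt ℝ (pderiv a f ∘ τ) z := fun a =>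
    (differentiableAt_pderiv hf a).comp z hτd
  rw [pderiv_congr e, pderiv_sum (f := fun a y => jacobian τ y a j * (pderiv a f ∘ τ) y) _
    fun a _ => (hT a).mul (hP a)]
  have e2 : ∀ a, pderiv i (fun y => jacobian τ y a j * (pderiv a f ∘ τ) y) z =
      pderiv i (pderiv j (fun y => τ y a)) z * pderiv a f (τ z) +
      ∑ b, jacobian τ z b i * jacobian τ z a j * pderiv b (pderiv a f) (τ z) := by
    intro a
    rw [pderiv_mul (hT a) (hP a), pderiv_comp (differentiableAt_pderiv hf a) hτd, Finset.mul_sum]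
    congr 1
    exact Finset.sum_congr rfl fun b _ => by ring
  rw [Finset.sum_congr rfl fun a _ => e2 a, Finset.sum_add_distrib]
  congr 1
  exact Finset.sum_comm

/-- The trilinear form with coefficients `P`. -/
def trilin (P : Fin n → Fin n → Fin n → ℝ) (a b c : Fin n → ℝ) : ℝ :=
  ∑ x, ∑ y, ∑ w, a x * b y * c w * P x y w

theorem trilin_swap (P : Fin n → Fin n → Fin n → ℝ) (a b c : Fin n → ℝ) :
    trilin P b a c = trilin (fun x y w => P y x w) a b c := by
  simp only [trilin]
  rw [Finset.sum_comm]
  simp only [mul_comm (b _) (a _)]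

theorem trilin_rotate (P : Fin n → Fin n → Fin n → ℝ) (a b c : Fin n → ℝ) :
    trilin P c a b = trilin (fun x y w => P w x y) a b c := by
  simp only [trilin]
  rw [Finset.sum_comm]
  refine Finset.sum_congr rfl fun x _ => ?_
  rw [Finset.sum_comm]
  refine Finset.sum_congr rfl fun y _ => Finset.sum_congr rfl fun w _ => ?_
  ring

/-- The partial derivatives of the coefficients of a pulled-back metric: one term from the
derivatives of the metric, two from those of the Jacobian matrix. -/
theorem pderiv_pullback {G : 𝔼 → Matrix (Fin n) (Fin n) ℝ} {τ : 𝔼 → 𝔼} {z : 𝔼}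
    (hG : ∀ a b, DifferentiableAt ℝ (fun y => G y a b) (τ z)) (hτ : ContDiffAt ℝ 2 τ z)
    (l i j : Fin n) :
    pderiv l (fun y => ((jacobian τ y)ᵀ * G (τ y) * jacobian τ y) i j) z =
      trilin (fun c a b => pderiv c (fun y => G y a b) (τ z)) (fun c => jacobian τ z c l)
        (fun a => jacobian τ z a i) (fun b => jacobian τ z b j) +
      ∑ a, ∑ b, pderiv l (pderiv i (fun y => τ y a)) z * jacobian τ z b j * G (τ z) a b +
      ∑ a, ∑ b, jacobian τ z a i * pderiv l (pderiv j (fun y => τ y b)) z * G (τ z) a b := by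
  have hτd : DifferentiableAt ℝ τ z := hτ.differentiableAt (by norm_num)
  have hT : ∀ a j, DifferentiableAt ℝ (fun y => jacobian τ y a j) z := fun a j =>
    differentiableAt_pderiv (f := fun y => τ y a)
      ((EuclideanSpace.proj (𝕜 := ℝ) a).contDiff.contDiffAt.comp z hτ) j
  have hP : ∀ a b, DifferentiableAt ℝ (fun y => G (τ y) a b) z := fun a b =>
    (hG a b).comp z hτd
  have e : ∀ y, ((jacobian τ y)ᵀ * G (τ y) * jacobian τ y) i j =
      ∑ a, ∑ b, jacobian τ y a i * jacobian τ y b j * G (τ y) a b := by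
    intro y
    simp only [Matrix.mul_apply, Matrix.transpose_apply, Finset.sum_mul]
    rw [Finset.sum_comm]
    exact Finset.sum_congr rfl fun a _ => Finset.sum_congr rfl fun b _ => by ring
  simp only [e]
  rw [pderiv_sum (f := fun a y => ∑ b, jacobian τ y a i * jacobian τ y b j * G (τ y) a b) _
    fun a _ => DifferentiableAt.fun_sum fun b _ =>
    ((hT a i).mul (hT b j)).mul (hP a b)]
  have e2 : ∀ a b, pderiv l (fun y => jacobian τ y a i * jacobian τ y b j * G (τ y) a b) z =
      ∑ c, jacobian τ z c l * jacobian τ z a i * jacobian τ z b j *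
        pderiv c (fun y => G y a b) (τ z) +
      pderiv l (pderiv i (fun y => τ y a)) z * jacobian τ z b j * G (τ z) a b +
      jacobian τ z a i * pderiv l (pderiv j (fun y => τ y b)) z * G (τ z) a b := by
    intro a b
    rw [pderiv_mul (f := fun y => jacobian τ y a i * jacobian τ y b j)
      ((hT a i).mul (hT b j)) (hP a b), pderiv_mul (hT a i) (hT b j)]
    have := pderiv_comp (hG a b) hτd l
    rw [show (fun y => G y a b) ∘ τ = fun y => G (τ y) a b from rfl] at this
    rw [this, Finset.mul_sum]
    have e3 : ∀ c, jacobian τ z a i * jacobian τ z b j *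
        (jacobian τ z c l * pderiv c (fun y => G y a b) (τ z)) =
        jacobian τ z c l * jacobian τ z a i * jacobian τ z b j *
        pderiv c (fun y => G y a b) (τ z) := fun c => by ring
    simp only [e3]
    have e4 : ∀ a i, pderiv l (fun y => jacobian τ y a i) z =
      pderiv l (pderiv i (fun y => τ y a)) z := fun a i => rfl
    rw [e4, e4]
    ring
  have e5 : ∀ a, pderiv l (fun y => ∑ b, jacobian τ y a i * jacobian τ y b j * G (τ y) a b) z =
      ∑ b, pderiv l (fun y => jacobian τ y a i * jacobian τ y b j * G (τ y) a b) z := fun a =>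
    pderiv_sum _ (fun b _ => ((hT a i).mul (hT b j)).mul (hP a b)) l
  simp only [e5, e2, Finset.sum_add_distrib]
  congr 2
  simp only [trilin]
  rw [Finset.sum_comm (s := Finset.univ) (t := Finset.univ)
    (f := fun c a => ∑ b, jacobian τ z c l * _ * _ * _)]
  exact Finset.sum_congr rfl fun a _ => Finset.sum_comm

theorem sum_contract (s t d : Fin n → ℝ) (Q : Fin n → Fin n → Fin n → ℝ) :
    (1 / 2 : ℝ) * ∑ c, (∑ x, ∑ y, s x * t y * Q c x y) * d c =
      ∑ a, ∑ b, s a * t b * ∑ k, ((1 / 2) * Q k a b) * d k := by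
  simp only [Finset.mul_sum, Finset.sum_mul]
  rw [Finset.sum_comm]
  refine Finset.sum_congr rfl fun a _ => ?_
  rw [Finset.sum_comm]
  refine Finset.sum_congr rfl fun b _ => Finset.sum_congr rfl fun k _ => ?_
  ring

/-- The trace of a bilinear form with respect to a metric does not depend on the basis. -/
theorem sum_inv_pullback {A B T : Matrix (Fin n) (Fin n) ℝ} (hA : A = Tᵀ * B * T)
    (hT : IsUnit T.det) (H : Fin n → Fin n → ℝ) :
    ∑ i, ∑ j, A⁻¹ i j * (∑ a, ∑ b, T a i * T b j * H a b) = ∑ a, ∑ b, B⁻¹ a b * H a b := by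
  have e : B⁻¹ = T * A⁻¹ * Tᵀ := by
    have hT' : IsUnit Tᵀ.det := by simpa using hT
    rw [hA, Matrix.mul_inv_rev, Matrix.mul_inv_rev, ← Matrix.mul_assoc,
      Matrix.mul_nonsing_inv _ hT, Matrix.one_mul, Matrix.mul_assoc, Matrix.nonsing_inv_mul _ hT',
      Matrix.mul_one]
  rw [e]
  simp only [Matrix.mul_apply, Matrix.transpose_apply, Finset.mul_sum, Finset.sum_mul]
  rw [Finset.sum_congr rfl fun i _ => Finset.sum_comm, Finset.sum_comm]
  refine Finset.sum_congr rfl fun a _ => ?_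
  rw [Finset.sum_congr rfl fun i _ => Finset.sum_comm, Finset.sum_comm]
  refine Finset.sum_congr rfl fun b _ => ?_
  rw [Finset.sum_comm]
  refine Finset.sum_congr rfl fun i _ => Finset.sum_congr rfl fun j _ => ?_
  ring

/-- The law by which the covariant Hessian changes under a coordinate change: with `T` the Jacobian
matrix of `τ`, the Hessian of `f ∘ τ` for the pulled-back metric is `Tᵀ (Hess f) T`. -/
theorem hessian_pullback {G₁ G₂ : 𝔼 → Matrix (Fin n) (Fin n) ℝ} {τ : 𝔼 → 𝔼} {f : 𝔼 → ℝ} {z : 𝔼}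
    (hG : ∀ a b, DifferentiableAt ℝ (fun y => G₂ y a b) (τ z))
    (hsymm : ∀ y a b, G₂ y a b = G₂ y b a)
    (hτ : ContDiffAt ℝ 2 τ z)
    (hG₁ : ∀ᶠ y in 𝓝 z, G₁ y = (jacobian τ y)ᵀ * G₂ (τ y) * jacobian τ y)
    (hT : IsUnit (jacobian τ z).det) (hB : IsUnit (G₂ (τ z)).det)
    (hf : ContDiffAt ℝ 2 f (τ z)) (i j : Fin n) :
    pderiv i (pderiv j (f ∘ τ)) z -
      ∑ k, ((1 / 2) * ∑ l, (G₁ z)⁻¹ k l *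
        (pderiv i (fun y => G₁ y j l) z + pderiv j (fun y => G₁ y i l) z
          - pderiv l (fun y => G₁ y i j) z)) * pderiv k (f ∘ τ) z =
    ∑ a, ∑ b, jacobian τ z a i * jacobian τ z b j * (pderiv a (pderiv b f) (τ z) -
      ∑ k, ((1 / 2) * ∑ l, (G₂ (τ z))⁻¹ k l *
        (pderiv a (fun y => G₂ y b l) (τ z) + pderiv b (fun y => G₂ y a l) (τ z)
          - pderiv l (fun y => G₂ y a b) (τ z))) * pderiv k f (τ z)) := by
  have hτd : DifferentiableAt ℝ τ z := hτ.differentiableAt (by norm_num)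
  have hfd : DifferentiableAt ℝ f (τ z) := hf.differentiableAt (by norm_num)
  set T := jacobian τ z with hTdef
  set B := G₂ (τ z) with hBdef
  have hA : G₁ z = Tᵀ * B * T := hG₁.self_of_nhds
  have hτc : ∀ a, ContDiffAt ℝ 2 (fun y => τ y a) z := fun a =>
    (EuclideanSpace.proj (𝕜 := ℝ) a).contDiff.contDiffAt.comp z hτ
  let h : Fin n → Fin n → Fin n → ℝ := fun a i j => pderiv i (pderiv j (fun y => τ y a)) z
  have hh : ∀ a i j, h a i j = h a j i := fun a i j => pderiv_pderiv_comm (hτc a) i j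
  let P : Fin n → Fin n → Fin n → ℝ := fun c a b => pderiv c (fun y => G₂ y a b) (τ z)
  have hP : ∀ c a b, P c a b = P c b a := by
    intro c a b
    have : (fun y => G₂ y a b) = fun y => G₂ y b a := funext fun y => hsymm y a b
    simp only [P, this]
  let Φ : Fin n → Fin n → Fin n → ℝ := fun x y w => P x y w + P y x w - P w x y
  have hd : ∀ l i j, pderiv l (fun y => G₁ y i j) z =
      trilin P (fun c => T c l) (fun a => T a i) (fun b => T b j) +
      ∑ a, ∑ b, h a l i * T b j * B a b + ∑ a, ∑ b, h a l j * T b i * B a b := by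
    intro l i j
    have e : (fun y => G₁ y i j) =ᶠ[𝓝 z]
        fun y => ((jacobian τ y)ᵀ * G₂ (τ y) * jacobian τ y) i j := by
      filter_upwards [hG₁] with y hy
      rw [hy]
    rw [pderiv_congr e, pderiv_pullback hG hτ]
    congr 1
    rw [Finset.sum_comm]
    refine Finset.sum_congr rfl fun a _ => Finset.sum_congr rfl fun b _ => ?_
    rw [hsymm]
    simp only [h, hBdef, hTdef]
    ring
  -- The Christoffel symbols of the first kind.
  have hF : ∀ l, pderiv i (fun y => G₁ y j l) z + pderiv j (fun y => G₁ y i l) z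
      - pderiv l (fun y => G₁ y i j) z =
      trilin Φ (fun a => T a i) (fun a => T a j) (fun a => T a l) +
        2 * ∑ a, ∑ b, h a i j * T b l * B a b := by
    intro l
    rw [hd, hd, hd, trilin_swap P (fun a => T a i), trilin_rotate P (fun a => T a i)]
    have e : trilin Φ (fun a => T a i) (fun a => T a j) (fun a => T a l) =
        trilin P (fun a => T a i) (fun a => T a j) (fun a => T a l) +
        trilin (fun x y w => P y x w) (fun a => T a i) (fun a => T a j) (fun a => T a l) -
        trilin (fun x y w => P w x y) (fun a => T a i) (fun a => T a j) (fun a => T a l) := by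
      simp only [trilin, Φ, mul_add, mul_sub, Finset.sum_add_distrib, Finset.sum_sub_distrib]
    rw [e]
    simp only [hh _ j i, hh _ l i, hh _ l j]
    ring
  let Y : Fin n → ℝ := fun w => ∑ x, ∑ y, T x i * T y j * Φ x y w + 2 * ∑ a, h a i j * B a w
  have hF' : ∀ l, pderiv i (fun y => G₁ y j l) z + pderiv j (fun y => G₁ y i l) z
      - pderiv l (fun y => G₁ y i j) z = (Tᵀ *ᵥ Y) l := by
    intro l
    rw [hF]
    simp only [Matrix.mulVec, dotProduct, Matrix.transpose_apply, Y, mul_add,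
      Finset.sum_add_distrib, trilin]
    congr 1
    · simp only [Finset.mul_sum]
      rw [Finset.sum_congr rfl fun x _ => Finset.sum_comm, Finset.sum_comm]
      refine Finset.sum_congr rfl fun w _ => Finset.sum_congr rfl fun x _ =>
        Finset.sum_congr rfl fun y _ => ?_
      ring
    · simp only [Finset.mul_sum]
      rw [Finset.sum_comm]
      refine Finset.sum_congr rfl fun w _ => Finset.sum_congr rfl fun x _ => ?_
      ring
  have hinv : (G₁ z)⁻¹ *ᵥ (Tᵀ *ᵥ Y) = T⁻¹ *ᵥ (B⁻¹ *ᵥ Y) := by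
    rw [hA, Matrix.mul_inv_rev, Matrix.mul_inv_rev, Matrix.mulVec_mulVec, Matrix.mulVec_mulVec,
      Matrix.mul_assoc, Matrix.mul_assoc, Matrix.nonsing_inv_mul _ (by simpa using hT),
      Matrix.mul_one]
  have hgrad : ∀ k, pderiv k (f ∘ τ) z = (Tᵀ *ᵥ fun a => pderiv a f (τ z)) k := fun k => by
    rw [pderiv_comp hfd hτd]
    rfl
  have hcontr : ∑ k, ((1 / 2) * ∑ l, (G₁ z)⁻¹ k l *
        (pderiv i (fun y => G₁ y j l) z + pderiv j (fun y => G₁ y i l) z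
          - pderiv l (fun y => G₁ y i j) z)) * pderiv k (f ∘ τ) z =
      (1 / 2) * ∑ c, (B⁻¹ *ᵥ Y) c * pderiv c f (τ z) := by
    simp only [hF', hgrad]
    have e : ∀ k, ∑ l, (G₁ z)⁻¹ k l * (Tᵀ *ᵥ Y) l = (T⁻¹ *ᵥ (B⁻¹ *ᵥ Y)) k := fun k => by
      rw [← hinv]
      rfl
    simp only [e, mul_assoc, ← Finset.mul_sum]
    congr 1
    change (T⁻¹ *ᵥ (B⁻¹ *ᵥ Y)) ⬝ᵥ (Tᵀ *ᵥ fun a => pderiv a f (τ z)) = (B⁻¹ *ᵥ Y) ⬝ᵥ _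
    rw [Matrix.dotProduct_mulVec, Matrix.vecMul_transpose, Matrix.mulVec_mulVec,
      Matrix.mul_nonsing_inv _ hT, Matrix.one_mulVec]
  have hBY : ∀ c, (B⁻¹ *ᵥ Y) c =
      ∑ x, ∑ y, T x i * T y j * (∑ w, B⁻¹ c w * Φ x y w) + 2 * h c i j := by
    intro c
    have e1 : ∑ w, B⁻¹ c w * ∑ a, h a i j * B a w = h c i j := by
      have : (B⁻¹ *ᵥ (B *ᵥ fun a => h a i j)) c = h c i j := by
        rw [Matrix.mulVec_mulVec, Matrix.nonsing_inv_mul _ hB, Matrix.one_mulVec]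
      rw [← this]
      simp only [Matrix.mulVec, dotProduct]
      refine Finset.sum_congr rfl fun w _ => ?_
      congr 1
      refine Finset.sum_congr rfl fun a _ => ?_
      rw [hBdef, hsymm, mul_comm]
    simp only [Matrix.mulVec, dotProduct, Y, mul_add, Finset.sum_add_distrib]
    congr 1
    · simp only [Finset.mul_sum]
      rw [Finset.sum_comm, Finset.sum_congr rfl fun x _ => Finset.sum_comm]
      refine Finset.sum_congr rfl fun w _ => Finset.sum_congr rfl fun x _ =>
        Finset.sum_congr rfl fun y _ => ?_
      ring
    · rw [← e1, Finset.mul_sum]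
      refine Finset.sum_congr rfl fun w _ => ?_
      ring
  rw [hcontr, pderiv_pderiv_comp hf hτ]
  simp only [hBY, mul_sub, Finset.sum_sub_distrib, add_mul, Finset.sum_add_distrib, mul_add]
  have e1 : (1 / 2 : ℝ) * ∑ c, 2 * h c i j * pderiv c f (τ z) =
      ∑ a, pderiv i (pderiv j (fun y => τ y a)) z * pderiv a f (τ z) := by
    rw [Finset.mul_sum]
    refine Finset.sum_congr rfl fun c _ => ?_
    simp only [h]
    ring
  have e2 : (1 / 2 : ℝ) * ∑ c, (∑ x, ∑ y, T x i * T y j * (∑ w, B⁻¹ c w * Φ x y w)) *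
        pderiv c f (τ z) =
      ∑ a, ∑ b, T a i * T b j * ∑ k, ((1 / 2) * ∑ l, B⁻¹ k l *
        (pderiv a (fun y => G₂ y b l) (τ z) + pderiv b (fun y => G₂ y a l) (τ z)
          - pderiv l (fun y => G₂ y a b) (τ z))) * pderiv k f (τ z) := by
    have e3 : ∀ k a b, ∑ l, B⁻¹ k l *
        (pderiv a (fun y => G₂ y b l) (τ z) + pderiv b (fun y => G₂ y a l) (τ z)
          - pderiv l (fun y => G₂ y a b) (τ z)) = ∑ w, B⁻¹ k w * Φ a b w := fun _ _ _ => rfl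
    simp only [e3]
    exact sum_contract (fun a => T a i) (fun b => T b j) _ fun k a b => ∑ w, B⁻¹ k w * Φ a b w
  rw [e1]
  simp only [mul_sub, mul_add, Finset.sum_sub_distrib, Finset.sum_add_distrib] at e2
  linarith [e2]

/-- The Laplacian commutes with pulling back the metric and the function by a change of
coordinates. -/
theorem coordLaplacian_comp {G₁ G₂ : 𝔼 → Matrix (Fin n) (Fin n) ℝ} {τ : 𝔼 → 𝔼} {f : 𝔼 → ℝ}
    {z : 𝔼} (hG : ∀ a b, DifferentiableAt ℝ (fun y => G₂ y a b) (τ z))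
    (hsymm : ∀ y a b, G₂ y a b = G₂ y b a)
    (hτ : ContDiffAt ℝ 2 τ z)
    (hG₁ : ∀ᶠ y in 𝓝 z, G₁ y = (jacobian τ y)ᵀ * G₂ (τ y) * jacobian τ y)
    (hT : IsUnit (jacobian τ z).det) (hB : IsUnit (G₂ (τ z)).det)
    (hf : ContDiffAt ℝ 2 f (τ z)) :
    coordLaplacian G₁ (f ∘ τ) z = coordLaplacian G₂ f (τ z) := by
  simp only [coordLaplacian]
  rw [Finset.sum_congr rfl fun i _ => Finset.sum_congr rfl fun j _ => by
    rw [hessian_pullback hG hsymm hτ hG₁ hT hB hf i j]]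
  have hA : G₁ z = (jacobian τ z)ᵀ * G₂ (τ z) * jacobian τ z := hG₁.self_of_nhds
  exact sum_inv_pullback hA hT _

end CoordinateChange

/-! ### The metric in charts; the Laplacian in an arbitrary chart -/

section MetricInCharts
variable {n : ℕ} {M : Type*} [TopologicalSpace M] [ChartedSpace (EuclideanSpace ℝ (Fin n)) M]
local notation "𝔼" => EuclideanSpace ℝ (Fin n)

section Smooth
variable [IsManifold (𝓡 n) ∞ M]

theorem contMDiffAt_chart_symm (p : M) {z : 𝔼} (hz : z ∈ (extChartAt (𝓡 n) p).target) :
    ContMDiffAt 𝓘(ℝ, 𝔼) (𝓡 n) ∞ (extChartAt (𝓡 n) p).symm z :=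
  (contMDiffOn_extChartAt_symm p).contMDiffAt ((isOpen_extChartAt_target p).mem_nhds hz)

theorem contMDiffAt_chart {p x : M} (hx : x ∈ (extChartAt (𝓡 n) p).source) :
    ContMDiffAt (𝓡 n) 𝓘(ℝ, 𝔼) ∞ (extChartAt (𝓡 n) p) x :=
  contMDiffAt_extChartAt' (by simpa using hx)

/-- The change of coordinates from the chart around `q` to the chart around `p`. -/
def transition (q p : M) : 𝔼 → 𝔼 := extChartAt (𝓡 n) p ∘ (extChartAt (𝓡 n) q).symm

theorem contDiffAt_transition {q p : M} {z : 𝔼} (hz : z ∈ (extChartAt (𝓡 n) q).target)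
    (hz' : (extChartAt (𝓡 n) q).symm z ∈ (extChartAt (𝓡 n) p).source) :
    ContDiffAt ℝ ∞ (transition (n := n) q p) z :=
  ((contMDiffAt_chart hz').comp z (contMDiffAt_chart_symm q hz)).contDiffAt

theorem eventually_mem_source {q p : M} {z : 𝔼} (hz : z ∈ (extChartAt (𝓡 n) q).target)
    (hz' : (extChartAt (𝓡 n) q).symm z ∈ (extChartAt (𝓡 n) p).source) :
    ∀ᶠ y in 𝓝 z, y ∈ (extChartAt (𝓡 n) q).target ∧
      (extChartAt (𝓡 n) q).symm y ∈ (extChartAt (𝓡 n) p).source :=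
  ((isOpen_extChartAt_target q).mem_nhds hz |> Filter.eventually_mem_set.2).and
    ((contMDiffAt_chart_symm q hz).continuousAt.eventually
      ((isOpen_extChartAt_source p).mem_nhds hz' |> Filter.eventually_mem_set.2))

/-- The coordinate vectors of the chart around `q`, expressed in the chart around `p`. -/
theorem mfderiv_symm_transition {q p : M} {z : 𝔼} (hz : z ∈ (extChartAt (𝓡 n) q).target)
    (hz' : (extChartAt (𝓡 n) q).symm z ∈ (extChartAt (𝓡 n) p).source) (v : 𝔼) :
    (mfderiv 𝓘(ℝ, 𝔼) (𝓡 n) (extChartAt (𝓡 n) q).symm z v : 𝔼) =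
      (mfderiv 𝓘(ℝ, 𝔼) (𝓡 n) (extChartAt (𝓡 n) p).symm (transition q p z)
        (fderiv ℝ (transition (n := n) q p) z v) : 𝔼) := by
  have h1 : MDifferentiableAt 𝓘(ℝ, 𝔼) 𝓘(ℝ, 𝔼) (transition (n := n) q p) z :=
    ((contDiffAt_transition hz hz').differentiableAt (by simp)).mdifferentiableAt
  have h2 : MDifferentiableAt 𝓘(ℝ, 𝔼) (𝓡 n) (extChartAt (𝓡 n) p).symm (transition q p z) :=
    (contMDiffAt_chart_symm p ((extChartAt (𝓡 n) p).map_source hz')).mdifferentiableAt (by simp)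
  have e : (extChartAt (𝓡 n) q).symm =ᶠ[𝓝 z] (extChartAt (𝓡 n) p).symm ∘ transition q p := by
    filter_upwards [eventually_mem_source hz hz'] with y hy
    exact ((extChartAt (𝓡 n) p).left_inv hy.2).symm
  rw [e.mfderiv_eq, mfderiv_comp z h2 h1, mfderiv_eq_fderiv]
  rfl

theorem mfderiv_chart_symm_injective {p : M} {z : 𝔼} (hz : z ∈ (extChartAt (𝓡 n) p).target) :
    Function.Injective
      (mfderiv 𝓘(ℝ, 𝔼) (𝓡 n) (extChartAt (𝓡 n) p).symm z : 𝔼 → 𝔼) := by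
  have h := isInvertible_mfderivWithin_extChartAt_symm (I := 𝓡 n) hz
  rw [ModelWithCorners.range_eq_univ, mfderivWithin_univ] at h
  exact h.injective

theorem contDiffAt_readInChart_of_mem {u : M → ℝ} {p x : M} {k : ℕ∞}
    (hx : x ∈ (extChartAt (𝓡 n) p).source)
    (hu : ContMDiffAt (𝓡 n) 𝓘(ℝ, ℝ) k u x) :
    ContDiffAt ℝ k (readInChart (n := n) p u) (extChartAt (𝓡 n) p x) := by
  have h := contMDiffAt_chart_symm (n := n) p ((extChartAt (𝓡 n) p).map_source hx)
  have e := (extChartAt (𝓡 n) p).left_inv hx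
  rw [← e] at hu
  exact (hu.comp _ (h.of_le (by exact_mod_cast le_top))).contDiffAt

end Smooth

variable [RiemannianBundle (fun x : M => TangentSpace (𝓡 n) x)]

/-- The metric at `x`, with tangent vectors regarded as elements of the model space `ℝⁿ`. -/
def metricForm (x : M) (v w : 𝔼) : ℝ :=
  inner ℝ (show TangentSpace (𝓡 n) x from v) (show TangentSpace (𝓡 n) x from w)

theorem laplacian_self (u : M → ℝ) (x : M) : laplacian n u x =
    coordLaplacian (metricMatrix x) (readInChart x u) (extChartAt (𝓡 n) x x) := rfl

theorem metricMatrix_symm (p : M) (z : 𝔼) (i j : Fin n) :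
    metricMatrix p z i j = metricMatrix p z j i :=
  real_inner_comm (coordField p j z) (coordField p i z)

theorem metricMatrix_quadratic (p : M) (z : 𝔼) (v w : 𝔼) :
    metricForm ((extChartAt (𝓡 n) p).symm z)
      (mfderiv 𝓘(ℝ, 𝔼) (𝓡 n) (extChartAt (𝓡 n) p).symm z v)
      (mfderiv 𝓘(ℝ, 𝔼) (𝓡 n) (extChartAt (𝓡 n) p).symm z w) =
    ∑ i, ∑ j, v i * w j * metricMatrix p z i j := by
  have e : ∀ v : 𝔼, mfderiv 𝓘(ℝ, 𝔼) (𝓡 n) (extChartAt (𝓡 n) p).symm z v =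
      ∑ i, v i • coordField p i z := by
    intro v
    have hv : v = ∑ i, v i • basisVec n i := by
      conv_lhs => rw [← (EuclideanSpace.basisFun (Fin n) ℝ).sum_repr v]
      simp [basisVec]
    conv_lhs => rw [hv]
    have := map_sum (mfderiv 𝓘(ℝ, 𝔼) (𝓡 n) (extChartAt (𝓡 n) p).symm z)
      (fun i => v i • basisVec n i) Finset.univ
    refine this.trans (Finset.sum_congr rfl fun i _ => ?_)
    exact map_smul (mfderiv 𝓘(ℝ, 𝔼) (𝓡 n) (extChartAt (𝓡 n) p).symm z) (v i) (basisVec n i)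
  simp only [metricForm]
  rw [e v, e w]
  have := sum_inner (𝕜 := ℝ) Finset.univ (fun i => v i • coordField p i z)
    (∑ i, w i • coordField p i z)
  refine this.trans (Finset.sum_congr rfl fun i _ => ?_)
  rw [inner_sum]
  refine Finset.sum_congr rfl fun j _ => ?_
  rw [real_inner_smul_left, real_inner_smul_right, mul_assoc]
  rfl

variable [IsManifold (𝓡 n) ∞ M]

theorem metricMatrix_posDef (p : M) {z : 𝔼} (hz : z ∈ (extChartAt (𝓡 n) p).target) :
    (metricMatrix p z).PosDef := by
  refine Matrix.PosDef.of_dotProduct_mulVec_pos ?_ ?_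
  · ext i j
    simp [metricMatrix_symm p z i j]
  · intro v hv
    have hq := metricMatrix_quadratic p z (WithLp.toLp 2 v) (WithLp.toLp 2 v)
    have e : star v ⬝ᵥ metricMatrix p z *ᵥ v = ∑ i, ∑ j, v i * v j * metricMatrix p z i j := by
      simp only [dotProduct, Matrix.mulVec, Finset.mul_sum, Pi.star_apply, star_trivial]
      exact Finset.sum_congr rfl fun i _ => Finset.sum_congr rfl fun j _ => by ring
    rw [e]
    refine lt_of_lt_of_eq ?_ hq
    refine real_inner_self_pos.2 fun h0 => hv ?_
    have := mfderiv_chart_symm_injective (n := n) hz (a₁ := WithLp.toLp 2 v) (a₂ := 0)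
      (h0.trans (map_zero (mfderiv 𝓘(ℝ, 𝔼) (𝓡 n) (extChartAt (𝓡 n) p).symm z)).symm)
    exact congrArg WithLp.ofLp this

theorem isUnit_det_metricMatrix (p : M) {z : 𝔼} (hz : z ∈ (extChartAt (𝓡 n) p).target) :
    IsUnit (metricMatrix p z).det :=
  (metricMatrix_posDef p hz).det_pos.ne'.isUnit

theorem metricMatrix_transition {q p : M} {z : 𝔼} (hz : z ∈ (extChartAt (𝓡 n) q).target)
    (hz' : (extChartAt (𝓡 n) q).symm z ∈ (extChartAt (𝓡 n) p).source) :
    metricMatrix q z = (jacobian (transition q p) z)ᵀ * metricMatrix p (transition q p z) *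
      jacobian (transition q p) z := by
  ext i j
  have hτ : DifferentiableAt ℝ (transition (n := n) q p) z :=
    (contDiffAt_transition hz hz').differentiableAt (by simp)
  have e0 : (extChartAt (𝓡 n) p).symm (transition q p z) = (extChartAt (𝓡 n) q).symm z :=
    (extChartAt (𝓡 n) p).left_inv hz'
  have e1 : metricMatrix q z i j = metricForm ((extChartAt (𝓡 n) q).symm z)
      (mfderiv 𝓘(ℝ, 𝔼) (𝓡 n) (extChartAt (𝓡 n) q).symm z (basisVec n i))
      (mfderiv 𝓘(ℝ, 𝔼) (𝓡 n) (extChartAt (𝓡 n) q).symm z (basisVec n j)) := rfl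
  rw [e1, mfderiv_symm_transition hz hz', mfderiv_symm_transition hz hz', ← e0,
    metricMatrix_quadratic]
  simp only [← pderiv_coord hτ, Matrix.mul_apply, Matrix.transpose_apply, Finset.sum_mul]
  rw [Finset.sum_comm]
  refine Finset.sum_congr rfl fun b _ => Finset.sum_congr rfl fun a _ => ?_
  simp only [jacobian, Matrix.of_apply]
  ring

theorem isUnit_det_jacobian_transition {q p : M} {z : 𝔼}
    (hz : z ∈ (extChartAt (𝓡 n) q).target)
    (hz' : (extChartAt (𝓡 n) q).symm z ∈ (extChartAt (𝓡 n) p).source) :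
    IsUnit (jacobian (transition (n := n) q p) z).det := by
  have h := isUnit_det_metricMatrix q hz
  rw [metricMatrix_transition hz hz', Matrix.det_mul] at h
  exact isUnit_of_mul_isUnit_right h

variable [IsContMDiffRiemannianBundle (𝓡 n) ∞ (EuclideanSpace ℝ (Fin n))
  (fun x : M => TangentSpace (𝓡 n) x)]

/-- The coordinate fields are the local frame of the tangent bundle that is induced by its
trivialization at `p`, and the metric is smooth in such frames. -/
theorem contDiffAt_metricMatrix (p : M) {z : 𝔼} (hz : z ∈ (extChartAt (𝓡 n) p).target)
    (i j : Fin n) : ContDiffAt ℝ ∞ (fun y => metricMatrix p y i j) z := by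
  set e := trivializationAt 𝔼 (fun x : M => TangentSpace (𝓡 n) x) p with he
  let b := (EuclideanSpace.basisFun (Fin n) ℝ).toBasis
  have hx : (extChartAt (𝓡 n) p).symm z ∈ e.baseSet := by
    have := (extChartAt (𝓡 n) p).map_target hz
    simpa [he] using this
  have hV : ∀ i, ContMDiffAt (𝓡 n) ((𝓡 n).prod 𝓘(ℝ, 𝔼)) ∞
      (fun x => (e.localFrame b i x : TotalSpace 𝔼 (fun x : M => TangentSpace (𝓡 n) x)))
      ((extChartAt (𝓡 n) p).symm z) := fun i => contMDiffAt_localFrame_of_mem (n := ∞) e b i hx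
  have h1 := (hV i).inner_bundle (hV j)
  have h2 := (h1.comp z (contMDiffAt_chart_symm p hz)).contDiffAt
  refine h2.congr_of_eventuallyEq ?_
  filter_upwards [(isOpen_extChartAt_target p).mem_nhds hz] with y hy
  have hy' : (extChartAt (𝓡 n) p).symm y ∈ e.baseSet := by
    have := (extChartAt (𝓡 n) p).map_target hy
    simpa [he] using this
  have hc : ∀ i, coordField p i y = e.localFrame b i ((extChartAt (𝓡 n) p).symm y) := by
    intro i
    rw [e.localFrame_apply_of_mem_baseSet b hy']
    have hs : (extChartAt (𝓡 n) p).symm y ∈ (chartAt 𝔼 p).source := by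
      simpa using (extChartAt (𝓡 n) p).map_target hy
    have h := TangentBundle.symmL_trivializationAt (I := 𝓡 n) hs
    rw [ModelWithCorners.range_eq_univ, mfderivWithin_univ,
      (extChartAt (𝓡 n) p).right_inv hy] at h
    have h2 := congrArg (fun L : 𝔼 →L[ℝ] 𝔼 => L (basisVec n i)) h
    refine h2.symm.trans ?_
    rw [Trivialization.basisAt, Module.Basis.map_apply]
    simp only [b, OrthonormalBasis.coe_toBasis, EuclideanSpace.basisFun_apply]
    exact Trivialization.symmL_apply e hy' _
  simp only [metricMatrix, Matrix.of_apply, Function.comp_apply, hc]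

theorem coordLaplacian_congr {G : 𝔼 → Matrix (Fin n) (Fin n) ℝ} {f g : 𝔼 → ℝ} {z : 𝔼}
    (h : f =ᶠ[𝓝 z] g) : coordLaplacian G f z = coordLaplacian G g z := by
  have h1 : ∀ j, pderiv j f =ᶠ[𝓝 z] pderiv j g := fun j => by
    filter_upwards [h.eventually_nhds] with y hy
    exact pderiv_congr hy j
  simp only [coordLaplacian, pderiv_congr h, fun i j => pderiv_congr (h1 j) i]

/-- The Laplacian of a function of class `C²` may be computed in any chart. -/
theorem laplacian_eq_coordLaplacian {u : M → ℝ} {p x : M}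
    (hx : x ∈ (extChartAt (𝓡 n) p).source) (hu : ContMDiffAt (𝓡 n) 𝓘(ℝ, ℝ) 2 u x) :
    laplacian n u x =
      coordLaplacian (metricMatrix p) (readInChart p u) (extChartAt (𝓡 n) p x) := by
  have hz := mem_extChartAt_target (I := 𝓡 n) x
  have hz' : (extChartAt (𝓡 n) x).symm (extChartAt (𝓡 n) x x) ∈ (extChartAt (𝓡 n) p).source := by
    rwa [extChartAt_to_inv]
  have hτz : transition (n := n) x p (extChartAt (𝓡 n) x x) = extChartAt (𝓡 n) p x := by
    simp only [transition, Function.comp_apply, extChartAt_to_inv]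
  have e : readInChart (n := n) x u =ᶠ[𝓝 (extChartAt (𝓡 n) x x)]
      readInChart p u ∘ transition x p := by
    filter_upwards [eventually_mem_source hz hz'] with y hy
    simp only [readInChart, transition, Function.comp_apply, (extChartAt (𝓡 n) p).left_inv hy.2]
  have hp := (extChartAt (𝓡 n) p).map_source hx
  rw [laplacian_self, coordLaplacian_congr e, ← hτz]
  refine coordLaplacian_comp ?_ (metricMatrix_symm p) ?_ ?_ ?_ ?_ ?_
  · intro a b
    rw [hτz]
    exact (contDiffAt_metricMatrix p hp a b).differentiableAt (by simp)
  · exact (contDiffAt_transition hz hz').of_le (by norm_cast)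
  · filter_upwards [eventually_mem_source hz hz'] with y hy
    exact metricMatrix_transition hy.1 hy.2
  · exact isUnit_det_jacobian_transition hz hz'
  · rw [hτz]
    exact isUnit_det_metricMatrix p hp
  · rw [hτz]
    exact contDiffAt_readInChart_of_mem (k := 2) hx hu

end MetricInCharts

section CoordinateCalculus
variable {n : ℕ}
local notation "𝔼" => EuclideanSpace ℝ (Fin n)

theorem contDiffAt_pderiv {f : 𝔼 → ℝ} {z : 𝔼} {k : ℕ} (hf : ContDiffAt ℝ (k + 1 : ℕ) f z)
    (i : Fin n) : ContDiffAt ℝ k (pderiv i f) z := by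
  have h : ContDiffAt ℝ k (fderiv ℝ f) z := hf.fderiv_right (by norm_cast)
  exact h.clm_apply contDiffAt_const

theorem continuousAt_inv_entry {G : 𝔼 → Matrix (Fin n) (Fin n) ℝ} {z : 𝔼}
    (hG : ∀ i j, ContinuousAt (fun y => G y i j) z) (hdet : IsUnit (G z).det) (i j : Fin n) :
    ContinuousAt (fun y => (G y)⁻¹ i j) z := by
  have hc : ContinuousAt G z :=
    continuousAt_pi.2 fun i => continuousAt_pi.2 fun j => hG i j
  have e : (fun y => (G y)⁻¹ i j) = fun y => (G y).det⁻¹ * (G y).adjugate i j := by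
    funext y
    rw [Matrix.inv_def, Ring.inverse_eq_inv', Matrix.smul_apply, smul_eq_mul]
  rw [e]
  refine ContinuousAt.mul (ContinuousAt.inv₀ ?_ hdet.ne_zero) ?_
  · exact (Continuous.matrix_det continuous_id).continuousAt.comp hc
  · have := (Continuous.matrix_adjugate (continuous_id (X := Matrix (Fin n) (Fin n) ℝ)))
    exact ((continuous_apply_apply i j).comp this).continuousAt.comp hc

theorem continuousAt_coordLaplacian {G : 𝔼 → Matrix (Fin n) (Fin n) ℝ} {f : 𝔼 → ℝ} {z : 𝔼}
    (hG : ∀ i j, ContDiffAt ℝ 1 (fun y => G y i j) z) (hdet : IsUnit (G z).det)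
    (hf : ContDiffAt ℝ 2 f z) : ContinuousAt (coordLaplacian G f) z := by
  have h1 : ∀ j, ContDiffAt ℝ 1 (pderiv j f) z := fun j => contDiffAt_pderiv (k := 1) hf j
  have h2 : ∀ i j, ContinuousAt (pderiv i (pderiv j f)) z := fun i j =>
    (contDiffAt_pderiv (k := 0) (h1 j) i).continuousAt
  have h3 : ∀ i a b, ContinuousAt (pderiv i (fun y => G y a b)) z := fun i a b =>
    (contDiffAt_pderiv (k := 0) (hG a b) i).continuousAt
  have h4 := continuousAt_inv_entry (fun i j => (hG i j).continuousAt) hdet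
  have h5 : ∀ j, ContinuousAt (pderiv j f) z := fun j => (h1 j).continuousAt
  unfold coordLaplacian
  refine tendsto_finsetSum _ fun i _ => tendsto_finsetSum _ fun j _ => ?_
  refine (h4 i j).mul ((h2 i j).sub (tendsto_finsetSum _ fun k _ => ?_))
  refine ContinuousAt.mul (continuousAt_const.mul (tendsto_finsetSum _ fun l _ => ?_)) (h5 k)
  exact (h4 k l).mul (((h3 _ _ _).add (h3 _ _ _)).sub (h3 _ _ _))

/-- The squared length `∑ᵢⱼ gⁱʲ ∂ᵢ f ∂ⱼ f` of the gradient of `f` for the metric `G`. -/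
def coordGradSq (G : 𝔼 → Matrix (Fin n) (Fin n) ℝ) (f : 𝔼 → ℝ) (z : 𝔼) : ℝ :=
  ∑ i, ∑ j, (G z)⁻¹ i j * (pderiv i f z * pderiv j f z)

theorem pderiv_scalar_comp {F : ℝ → ℝ} {f : 𝔼 → ℝ} {z : 𝔼} (hF : DifferentiableAt ℝ F (f z))
    (hf : DifferentiableAt ℝ f z) (i : Fin n) :
    pderiv i (F ∘ f) z = deriv F (f z) * pderiv i f z := by
  simp only [pderiv]
  rw [fderiv_comp z hF hf]
  simp [mul_comm]

/-- The chain rule `Δ(F ∘ f) = F'(f) Δf + F''(f) |∇f|²`. -/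
theorem coordLaplacian_scalar_comp {G : 𝔼 → Matrix (Fin n) (Fin n) ℝ} {F : ℝ → ℝ} {f : 𝔼 → ℝ}
    {z : 𝔼} (hF : ContDiffAt ℝ 2 F (f z)) (hf : ContDiffAt ℝ 2 f z) :
    coordLaplacian G (F ∘ f) z =
      deriv F (f z) * coordLaplacian G f z + deriv (deriv F) (f z) * coordGradSq G f z := by
  have hfd : DifferentiableAt ℝ f z := hf.differentiableAt (by norm_num)
  have hFd : DifferentiableAt ℝ F (f z) := hF.differentiableAt (by norm_num)
  have hF' : DifferentiableAt ℝ (deriv F) (f z) := by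
    have h : ContDiffAt ℝ 1 (fderiv ℝ F) (f z) := hF.fderiv_right (by norm_num)
    have : deriv F = fun t => fderiv ℝ F t 1 := rfl
    rw [this]
    exact (h.differentiableAt (by norm_num)).clm_apply (differentiableAt_const _)
  have e : ∀ j, pderiv j (F ∘ f) =ᶠ[𝓝 z] fun y => (deriv F ∘ f) y * pderiv j f y := by
    intro j
    filter_upwards [hf.eventually (by simp),
      hf.continuousAt.eventually (hF.eventually (by simp))] with y hy hy'
    exact pderiv_scalar_comp (hy'.differentiableAt (by norm_num))
      (hy.differentiableAt (by norm_num)) j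
  have e2 : ∀ i j, pderiv i (pderiv j (F ∘ f)) z = deriv F (f z) * pderiv i (pderiv j f) z +
      deriv (deriv F) (f z) * (pderiv i f z * pderiv j f z) := by
    intro i j
    rw [pderiv_congr (e j), pderiv_mul (hF'.comp z hfd) (differentiableAt_pderiv hf j),
      pderiv_scalar_comp hF' hfd]
    simp only [Function.comp_apply]
    ring
  have e3 : ∀ c : Fin n → ℝ, ∑ k, c k * (deriv F (f z) * pderiv k f z) =
      deriv F (f z) * ∑ k, c k * pderiv k f z := fun c => by
    rw [Finset.mul_sum]
    exact Finset.sum_congr rfl fun k _ => by ring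
  have e4 : ∀ a b c d e g : ℝ, a * (b * c + d * e - b * g) = b * (a * (c - g)) + d * (a * e) :=
    fun a b c d e g => by ring
  simp only [coordLaplacian, coordGradSq, e2, pderiv_scalar_comp hFd hfd, e3, e4,
    Finset.sum_add_distrib, ← Finset.mul_sum]

theorem coordGradSq_pos {G : 𝔼 → Matrix (Fin n) (Fin n) ℝ} {f : 𝔼 → ℝ} {z : 𝔼}
    (hG : (G z).PosDef) (hf : ∃ i, pderiv i f z ≠ 0) : 0 < coordGradSq G f z := by
  obtain ⟨i, hi⟩ := hf
  have h := hG.inv.dotProduct_mulVec_pos (x := fun i => pderiv i f z)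
    (fun h => hi (congrFun h i))
  refine lt_of_lt_of_eq h ?_
  simp only [coordGradSq, dotProduct, Matrix.mulVec, Finset.mul_sum, Pi.star_apply, star_trivial]
  exact Finset.sum_congr rfl fun i _ => Finset.sum_congr rfl fun j _ => by ring

theorem coordGradSq_nonneg {G : 𝔼 → Matrix (Fin n) (Fin n) ℝ} {f : 𝔼 → ℝ} {z : 𝔼}
    (hG : (G z).PosDef) : 0 ≤ coordGradSq G f z := by
  by_cases h : ∃ i, pderiv i f z ≠ 0
  · exact (coordGradSq_pos hG h).le
  · push Not at h
    simp [coordGradSq, h]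

open scoped MatrixOrder in
theorem exists_eq_conjTranspose_mul_self {A : Matrix (Fin n) (Fin n) ℝ} (hA : A.PosSemidef) :
    ∃ Q : Matrix (Fin n) (Fin n) ℝ, A = Qᴴ * Q := by
  refine ⟨CFC.sqrt A, ?_⟩
  have hs : (CFC.sqrt A).PosSemidef := Matrix.nonneg_iff_posSemidef.1 (CFC.sqrt_nonneg A)
  rw [hs.isHermitian.eq, CFC.sqrt_mul_sqrt_self A hA.nonneg]

/-- At a local maximum the second derivative in any direction is nonpositive. -/
theorem sum_pderiv_pderiv_nonpos {f : 𝔼 → ℝ} {z : 𝔼} (hf : ContDiffAt ℝ 2 f z)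
    (hmax : IsLocalMax f z) (v : 𝔼) : ∑ i, ∑ j, v i * v j * pderiv i (pderiv j f) z ≤ 0 := by
  have h1 : ContDiffAt ℝ 1 (fderiv ℝ f) z := hf.fderiv_right (by norm_num)
  have h' : DifferentiableAt ℝ (fderiv ℝ f) z := h1.differentiableAt (by norm_num)
  have hv : ∑ i, ∑ j, v i * v j * pderiv i (pderiv j f) z = fderiv ℝ (fderiv ℝ f) z v v := by
    have e1 : fderiv ℝ (fderiv ℝ f) z v v =
        ∑ i, v i * fderiv ℝ (fderiv ℝ f) z (basisVec n i) v :=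
      clm_apply_eq_sum ((fderiv ℝ (fderiv ℝ f) z).flip v) v
    rw [e1]
    refine Finset.sum_congr rfl fun i _ => ?_
    rw [clm_apply_eq_sum (fderiv ℝ (fderiv ℝ f) z (basisVec n i)) v, Finset.mul_sum]
    refine Finset.sum_congr rfl fun j _ => ?_
    rw [pderiv_pderiv_eq_fderiv hf]
    ring
  rw [hv]
  by_contra! hpos
  -- Restricted to the line in direction `v`, `f` would have a local minimum as well by the second
  -- derivative test, and hence be locally constant.
  let g : ℝ → ℝ := fun t => f (z + t • v)
  have hline : ∀ t, HasDerivAt (fun t : ℝ => z + t • v) v t := fun t => by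
    simpa using ((hasDerivAt_id t).smul_const v).const_add z
  have hz : z = z + (0 : ℝ) • v := by simp
  have hcont : ContinuousAt (fun t : ℝ => z + t • v) 0 := (hline 0).continuousAt
  have hg1 : deriv g =ᶠ[𝓝 0] fun t => fderiv ℝ f (z + t • v) v := by
    have hev : ∀ᶠ y in 𝓝 (z + (0 : ℝ) • v), ContDiffAt ℝ 2 f y := by
      rw [← hz]
      exact hf.eventually (by simp)
    filter_upwards [hcont.eventually hev] with t ht
    exact ((ht.differentiableAt (by norm_num)).hasFDerivAt.comp_hasDerivAt t (hline t)).deriv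
  have hg2 : deriv (deriv g) 0 = fderiv ℝ (fderiv ℝ f) z v v := by
    rw [hg1.deriv_eq]
    have h2 : HasFDerivAt (fderiv ℝ f) (fderiv ℝ (fderiv ℝ f) z) (z + (0 : ℝ) • v) := by
      rw [← hz]
      exact h'.hasFDerivAt
    have h3 := h2.comp_hasDerivAt (0 : ℝ) (hline 0)
    exact ((ContinuousLinearMap.apply ℝ ℝ v).hasFDerivAt.comp_hasDerivAt (0 : ℝ) h3).deriv
  have hgmax : IsLocalMax g 0 := by
    have : ∀ᶠ y in 𝓝 (z + (0 : ℝ) • v), f y ≤ f z := by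
      rw [← hz]
      exact hmax
    filter_upwards [hcont.eventually this] with t ht
    simpa [g] using ht
  have hgmin : IsLocalMin g 0 := by
    refine isLocalMin_of_deriv_deriv_pos (by rw [hg2]; exact hpos) hgmax.deriv_eq_zero ?_
    have : ContinuousAt f (z + (0 : ℝ) • v) := by
      rw [← hz]
      exact hf.continuousAt
    exact ContinuousAt.comp (f := fun t : ℝ => z + t • v) this hcont
  have hconst : g =ᶠ[𝓝 0] fun _ => g 0 := by
    filter_upwards [hgmax, hgmin] with t h1 h2
    exact le_antisymm h1 h2
  have hd : deriv g =ᶠ[𝓝 0] fun _ => 0 := by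
    filter_upwards [hconst.eventually_nhds] with t ht
    rw [Filter.EventuallyEq.deriv_eq ht, deriv_const]
  rw [← hg2, hd.deriv_eq, deriv_const] at hpos
  exact lt_irrefl _ hpos

/-- In terms of a square root `Q` of the inverse metric, the Laplacian at a critical point is the
sum of the second derivatives in the directions of the rows of `Q`. -/
theorem coordLaplacian_nonpos {G : 𝔼 → Matrix (Fin n) (Fin n) ℝ} {f : 𝔼 → ℝ} {z : 𝔼}
    (hG : (G z).PosDef) (hf : ContDiffAt ℝ 2 f z) (hmax : IsLocalMax f z) :
    coordLaplacian G f z ≤ 0 := by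
  have h0 : ∀ k, pderiv k f z = 0 := fun k => by
    simp [pderiv, hmax.fderiv_eq_zero]
  obtain ⟨Q, hQ⟩ : ∃ Q : Matrix (Fin n) (Fin n) ℝ, (G z)⁻¹ = Qᴴ * Q :=
    exists_eq_conjTranspose_mul_self hG.inv.posSemidef
  simp only [coordLaplacian, h0, mul_zero, Finset.sum_const_zero, sub_zero, hQ]
  have e : ∑ i, ∑ j, (Qᴴ * Q) i j * pderiv i (pderiv j f) z =
      ∑ k, ∑ i, ∑ j, Q k i * Q k j * pderiv i (pderiv j f) z := by
    simp only [Matrix.mul_apply, Matrix.conjTranspose_apply, star_trivial, Finset.sum_mul]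
    rw [Finset.sum_congr rfl fun i _ => Finset.sum_comm, Finset.sum_comm]
  rw [e]
  exact Finset.sum_nonpos fun k _ => sum_pderiv_pderiv_nonpos hf hmax (WithLp.toLp 2 (Q k))

end CoordinateCalculus

/-! ### The maximum principle and strict subsolutions -/

section TruncatedPower

theorem hasDerivAt_posPart_pow (k : ℕ) (t : ℝ) :
    HasDerivAt (fun t : ℝ => max t 0 ^ (k + 2)) ((k + 2) * max t 0 ^ (k + 1)) t := by
  rcases lt_trichotomy t 0 with h | rfl | h
  · have e : (fun t : ℝ => max t 0 ^ (k + 2)) =ᶠ[𝓝 t] fun _ => 0 := by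
      filter_upwards [eventually_lt_nhds h] with s hs
      simp [max_eq_right hs.le]
    simpa [max_eq_right h.le] using (hasDerivAt_const t (0 : ℝ)).congr_of_eventuallyEq e
  · have h1 : HasDerivAt (fun t : ℝ => t ^ (k + 2)) 0 0 := by
      simpa using hasDerivAt_pow (k + 2) (0 : ℝ)
    have h2 : (fun t : ℝ => max t 0 ^ (k + 2)) =O[𝓝 0] fun t : ℝ => t ^ (k + 2) := by
      refine Asymptotics.isBigO_of_le _ fun t => ?_
      rw [norm_pow, norm_pow]
      refine pow_le_pow_left₀ (norm_nonneg _) ?_ _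
      simp only [Real.norm_eq_abs]
      exact abs_max_le_max_abs_abs.trans (by simp)
    simp only [max_self, ne_eq, Nat.add_eq_zero_iff, one_ne_zero, and_false, not_false_eq_true,
      zero_pow, mul_zero]
    rw [hasDerivAt_iff_isLittleO] at h1 ⊢
    simpa using (h2.trans_isLittleO (by simpa using h1))
  · have e : (fun t : ℝ => max t 0 ^ (k + 2)) =ᶠ[𝓝 t] fun t => t ^ (k + 2) := by
      filter_upwards [eventually_gt_nhds h] with s hs
      simp [max_eq_left hs.le]
    have h1 := (hasDerivAt_pow (k + 2) t).congr_of_eventuallyEq e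
    simpa [max_eq_left h.le] using h1

/-- The profile `s ↦ (a - s)₊ᴺ` with `N = k + 3`, which is of class `C²`. -/
def capProfile (a : ℝ) (k : ℕ) (s : ℝ) : ℝ := max (a - s) 0 ^ (k + 3)

theorem deriv_capProfile (a : ℝ) (k : ℕ) :
    deriv (capProfile a k) = fun s => -((k + 3) * max (a - s) 0 ^ (k + 2)) := by
  funext s
  have h := (hasDerivAt_posPart_pow (k + 1) (a - s)).comp s ((hasDerivAt_id s).const_sub a)
  refine (HasDerivAt.deriv (f := capProfile a k) h).trans ?_
  push_cast
  ring

theorem hasDerivAt_deriv_capProfile (a : ℝ) (k : ℕ) (s : ℝ) :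
    HasDerivAt (deriv (capProfile a k)) ((k + 3) * ((k + 2) * max (a - s) 0 ^ (k + 1))) s := by
  rw [deriv_capProfile]
  have h := (hasDerivAt_posPart_pow k (a - s)).comp s ((hasDerivAt_id s).const_sub a)
  have h' := (h.const_mul ((k : ℝ) + 3)).neg
  have e : -(((k : ℝ) + 3) * ((k + 2) * max (a - s) 0 ^ (k + 1) * -1)) =
      (k + 3) * ((k + 2) * max (a - s) 0 ^ (k + 1)) := by ring
  rw [← e]
  exact h'

theorem contDiff_capProfile (a : ℝ) (k : ℕ) : ContDiff ℝ 2 (capProfile a k) := by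
  have h0 : Differentiable ℝ (capProfile a k) := fun s =>
    ((hasDerivAt_posPart_pow (k + 1) (a - s)).comp s
      ((hasDerivAt_id s).const_sub a)).differentiableAt
  have h1 : ContDiff ℝ 1 (deriv (capProfile a k)) := by
    rw [contDiff_one_iff_deriv]
    refine ⟨fun s => (hasDerivAt_deriv_capProfile a k s).differentiableAt, ?_⟩
    have : deriv (deriv (capProfile a k)) =
        fun s => ((k : ℝ) + 3) * ((k + 2) * max (a - s) 0 ^ (k + 1)) :=
      funext fun s => (hasDerivAt_deriv_capProfile a k s).deriv
    rw [this]
    fun_prop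
  have := (contDiff_succ_iff_deriv (n := 1) (𝕜 := ℝ) (f := capProfile a k)).2
    ⟨h0, by simp, h1⟩
  exact this

end TruncatedPower

section MaximumPrinciple
variable {n : ℕ} {M : Type*} [TopologicalSpace M] [ChartedSpace (EuclideanSpace ℝ (Fin n)) M]
  [RiemannianBundle (fun x : M => TangentSpace (𝓡 n) x)]
local notation "𝔼" => EuclideanSpace ℝ (Fin n)

theorem laplacian_zero (x : M) : laplacian n (0 : M → ℝ) x = 0 := by
  simpa using laplacian_const_smul (n := n) 0 (0 : M → ℝ) x

theorem laplacian_congr {u v : M → ℝ} {x : M} (h : u =ᶠ[𝓝 x] v) :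
    laplacian n u x = laplacian n v x := by
  rw [laplacian_self, laplacian_self]
  refine coordLaplacian_congr ?_
  have hc : ContinuousAt (extChartAt (𝓡 n) x).symm (extChartAt (𝓡 n) x x) :=
    continuousAt_extChartAt_symm x
  rw [← extChartAt_to_inv (I := 𝓡 n) x] at h
  exact hc.eventually h

variable [IsManifold (𝓡 n) ∞ M]

theorem laplacian_nonpos_of_isLocalMax {u : M → ℝ} {x : M}
    (hu : ContMDiffAt (𝓡 n) 𝓘(ℝ, ℝ) 2 u x) (hmax : IsLocalMax u x) : laplacian n u x ≤ 0 := by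
  rw [laplacian_self]
  refine coordLaplacian_nonpos (metricMatrix_posDef x (mem_extChartAt_target x))
    (contDiffAt_readInChart hu) ?_
  have hc : ContinuousAt (extChartAt (𝓡 n) x).symm (extChartAt (𝓡 n) x x) :=
    continuousAt_extChartAt_symm x
  have h : ∀ᶠ y in 𝓝 ((extChartAt (𝓡 n) x).symm (extChartAt (𝓡 n) x x)), u y ≤ u x := by
    rw [extChartAt_to_inv]
    exact hmax
  filter_upwards [hc.eventually h] with z hz
  simpa only [readInChart, Function.comp_apply, extChartAt_to_inv] using hz

/-- `Δ(v²) = 2 v Δv + 2 |∇v|²`. -/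
theorem two_mul_laplacian_le_laplacian_sq {v : M → ℝ} {x : M}
    (hv : ContMDiffAt (𝓡 n) 𝓘(ℝ, ℝ) 2 v x) :
    2 * v x * laplacian n v x ≤ laplacian n (fun y => v y ^ 2) x := by
  have h := coordLaplacian_scalar_comp (G := metricMatrix x) (F := fun t : ℝ => t ^ 2)
    (by fun_prop) (contDiffAt_readInChart hv)
  have e : readInChart (n := n) x (fun y => v y ^ 2) =
      (fun t : ℝ => t ^ 2) ∘ readInChart x v := rfl
  have hd : deriv (fun t : ℝ => t ^ 2) = fun t => 2 * t := by
    funext t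
    simp
  have hd2 : ∀ t : ℝ, deriv (fun t : ℝ => 2 * t) t = 2 := fun t => by
    simp
  have hx : readInChart (n := n) x v (extChartAt (𝓡 n) x x) = v x := by
    simp only [readInChart, Function.comp_apply, extChartAt_to_inv]
  rw [laplacian_self, laplacian_self, e, h, hd, hd2, hx]
  have := coordGradSq_nonneg (f := readInChart (n := n) x v)
    (metricMatrix_posDef x (mem_extChartAt_target x))
  linarith

variable [IsContMDiffRiemannianBundle (𝓡 n) ∞ (EuclideanSpace ℝ (Fin n))
  (fun x : M => TangentSpace (𝓡 n) x)]

/-- Near `x` the Laplacian may be computed in the one chart around `x`, in which its coefficients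
are continuous. -/
theorem continuousAt_laplacian {u : M → ℝ} {x : M} (hu : ContMDiffAt (𝓡 n) 𝓘(ℝ, ℝ) 2 u x) :
    ContinuousAt (laplacian n u) x := by
  have hx := mem_extChartAt_source (I := 𝓡 n) x
  have hz := mem_extChartAt_target (I := 𝓡 n) x
  have h : ContinuousAt (coordLaplacian (metricMatrix x) (readInChart x u) ∘
      extChartAt (𝓡 n) x) x :=
    (continuousAt_coordLaplacian
      (fun i j => (contDiffAt_metricMatrix x hz i j).of_le (by norm_cast))
      (isUnit_det_metricMatrix x hz) (contDiffAt_readInChart hu)).comp (continuousAt_extChartAt x)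
  refine h.congr ?_
  filter_upwards [(isOpen_extChartAt_source (I := 𝓡 n) x).mem_nhds hx,
    (contMDiffAt_iff_contMDiffAt_nhds (by simp)).1 hu] with y hy hy'
  exact (laplacian_eq_coordLaplacian hy hy').symm

/-- A nonnegative `C²` bump supported in a coordinate ball, which away from a smaller concentric
ball is a subsolution of `Δw = σ w`, strict where the bump is positive. It is a high power of
`r² - |z - c|²`: the second-order term of `Δ(F ∘ q) = F' Δq + F'' |∇q|²` dominates where
`∇q ≠ 0`. -/
theorem exists_barrier [T2Space M] {σ : M → ℝ} (hσ : Continuous σ) (p : M) {c : 𝔼} {r δ : ℝ}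
    (hr₀ : 0 ≤ r) (hδ : 0 < δ) (hr : Metric.closedBall c r ⊆ (extChartAt (𝓡 n) p).target) :
    ∃ w : M → ℝ, ContMDiff (𝓡 n) 𝓘(ℝ, ℝ) 2 w ∧ (∀ x, 0 ≤ w x) ∧
      (∀ x ∈ (extChartAt (𝓡 n) p).source, extChartAt (𝓡 n) p x ∈ Metric.ball c r → 0 < w x) ∧
      (∀ x, ¬ (x ∈ (extChartAt (𝓡 n) p).source ∧ extChartAt (𝓡 n) p x ∈ Metric.ball c δ) →
        σ x * w x ≤ laplacian n w x) ∧
      (∀ x ∈ (extChartAt (𝓡 n) p).source, extChartAt (𝓡 n) p x ∈ Metric.ball c r →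
        extChartAt (𝓡 n) p x ∉ Metric.ball c δ → σ x * w x < laplacian n w x) := by
  classical
  set φ := extChartAt (𝓡 n) p with hφ
  let q : 𝔼 → ℝ := fun z => ‖z - c‖ ^ 2
  have hq : ContDiff ℝ 2 q := (contDiff_id.sub contDiff_const).norm_sq ℝ
  have hGinv : ∀ z ∈ φ.target, ∀ i j, ContinuousAt (fun y => (metricMatrix p y)⁻¹ i j) z :=
    fun z hz => continuousAt_inv_entry
      (fun i j => (contDiffAt_metricMatrix p hz i j).continuousAt) (isUnit_det_metricMatrix p hz)
  have hgradpos : ∀ z ∈ φ.target, z ≠ c → 0 < coordGradSq (metricMatrix p) q z := by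
    intro z hz hzc
    refine coordGradSq_pos (metricMatrix_posDef p hz) ?_
    by_contra! h0
    have h1 : fderiv ℝ q z (z - c) = 0 := by
      rw [clm_apply_eq_sum]
      exact Finset.sum_eq_zero fun a _ => by
        have := h0 a
        simp only [pderiv] at this
        rw [this, mul_zero]
    have h2 : HasFDerivAt q (2 • (innerSL ℝ (z - c)).comp (ContinuousLinearMap.id ℝ 𝔼)) z :=
      ((hasFDerivAt_id z).sub_const c).norm_sq
    rw [h2.fderiv] at h1
    have h3 : inner ℝ (z - c) (z - c) = (0 : ℝ) := by
      have h4 : (2 : ℝ) * inner ℝ (z - c) (z - c) = 0 := by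
        rw [← h1]
        change _ = 2 • inner ℝ (z - c) (z - c)
        rw [nsmul_eq_mul, Nat.cast_ofNat]
      linarith
    exact hzc (sub_eq_zero.1 (inner_self_eq_zero.1 h3))
  -- Bounds on the annulus `δ ≤ |z - c| ≤ r`.
  set A : Set 𝔼 := Metric.closedBall c r \ Metric.ball c δ with hA
  have hAc : IsCompact A := (isCompact_closedBall c r).diff Metric.isOpen_ball
  have hAt : A ⊆ φ.target := Set.sdiff_subset.trans hr
  have hgs : ContinuousOn (coordGradSq (metricMatrix p) q) A := by
    intro z hz
    refine ContinuousAt.continuousWithinAt ?_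
    have h1 : ∀ i, ContinuousAt (pderiv i q) z := fun i =>
      (contDiffAt_pderiv (k := 1) hq.contDiffAt i).continuousAt
    exact tendsto_finsetSum _ fun i _ => tendsto_finsetSum _ fun j _ =>
      (hGinv z (hAt hz) i j).mul ((h1 i).mul (h1 j))
  obtain ⟨κ, hκ, hκA⟩ : ∃ κ, 0 < κ ∧ ∀ z ∈ A, κ ≤ coordGradSq (metricMatrix p) q z := by
    refine hAc.exists_forall_le' hgs fun z hz => hgradpos z (hAt hz) ?_
    rintro rfl
    exact hz.2 (Metric.mem_ball_self hδ)
  have hlq : ContinuousOn (coordLaplacian (metricMatrix p) q) A := fun z hz =>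
    (continuousAt_coordLaplacian
      (fun i j => (contDiffAt_metricMatrix p (hAt hz) i j).of_le (by norm_cast))
      (isUnit_det_metricMatrix p (hAt hz)) hq.contDiffAt).continuousWithinAt
  obtain ⟨C₁, hC₁⟩ := hAc.exists_bound_of_continuousOn hlq
  have hσA : ContinuousOn (σ ∘ φ.symm) A :=
    hσ.comp_continuousOn ((continuousOn_extChartAt_symm p).mono hAt)
  obtain ⟨C₂, hC₂⟩ := hAc.exists_bound_of_continuousOn hσA
  -- With `q = |z - c|²`, `t = r² - q` and `w = tᴺ` for `N = k + 3`, the quantity `Δw - σ w` is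
  -- `t^(N-2)` times `N (N - 1) |∇q|² - N t Δq - σ t²`, which is positive if `k` is large enough.
  obtain ⟨k, hk⟩ := exists_nat_gt ((r ^ 2 * |C₁| + |C₂| * r ^ 4) / κ)
  let F : ℝ → ℝ := capProfile (r ^ 2) k
  have hF : ContDiff ℝ 2 F := contDiff_capProfile _ _
  have hF0 : ∀ z : 𝔼, z ∉ Metric.closedBall c r → F (q z) = 0 := by
    intro z hz
    have : r ^ 2 - q z ≤ 0 := by
      rw [Metric.mem_closedBall, dist_eq_norm, not_le] at hz
      have := pow_le_pow_left₀ hr₀ hz.le 2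
      simp only [q]
      linarith
    simp only [F, capProfile, max_eq_right this]
    simp
  let w : M → ℝ := fun x => if x ∈ φ.source then F (q (φ x)) else 0
  set C₀ : Set M := φ.symm '' Metric.closedBall c r with hC₀
  have hC₀c : IsClosed C₀ :=
    ((isCompact_closedBall c r).image_of_continuousOn
      ((continuousOn_extChartAt_symm p).mono hr)).isClosed
  have hC₀s : C₀ ⊆ φ.source := by
    rintro _ ⟨z, hz, rfl⟩
    exact φ.map_target (hr hz)
  have hmem : ∀ x ∈ φ.source, φ x ∈ Metric.closedBall c r → x ∈ C₀ := fun x hx hz =>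
    ⟨φ x, hz, φ.left_inv hx⟩
  have hout : ∀ x ∉ C₀, w =ᶠ[𝓝 x] 0 := by
    intro x hx
    filter_upwards [hC₀c.isOpen_compl.mem_nhds hx] with y hy
    by_cases hys : y ∈ φ.source
    · simp only [w, if_pos hys, Pi.zero_apply]
      exact hF0 _ fun h => hy (hmem y hys h)
    · simp [w, hys]
  have hin : ∀ x ∈ φ.source, w =ᶠ[𝓝 x] fun y => F (q (φ y)) := by
    intro x hx
    filter_upwards [(isOpen_extChartAt_source (I := 𝓡 n) p).mem_nhds hx] with y hy
    simp only [w, hφ, if_pos hy]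
  have hw2 : ContMDiff (𝓡 n) 𝓘(ℝ, ℝ) 2 w := by
    intro x
    by_cases hx : x ∈ C₀
    · have h1 : ContMDiffAt (𝓡 n) 𝓘(ℝ, 𝔼) 2 φ x :=
        (contMDiffAt_chart (hC₀s hx)).of_le (by norm_cast)
      have h2 : ContMDiffAt 𝓘(ℝ, 𝔼) 𝓘(ℝ, ℝ) 2 (F ∘ q) (φ x) :=
        (hF.comp hq).contDiffAt.contMDiffAt
      exact (h2.comp x h1).congr_of_eventuallyEq (hin x (hC₀s hx))
    · exact contMDiffAt_const.congr_of_eventuallyEq (hout x hx)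
  have hlap : ∀ x ∈ φ.source, laplacian n w x =
      deriv F (q (φ x)) * coordLaplacian (metricMatrix p) q (φ x) +
        deriv (deriv F) (q (φ x)) * coordGradSq (metricMatrix p) q (φ x) := by
    intro x hx
    rw [laplacian_eq_coordLaplacian hx (hw2 x),
      ← coordLaplacian_scalar_comp hF.contDiffAt hq.contDiffAt]
    refine coordLaplacian_congr ?_
    filter_upwards [(isOpen_extChartAt_target p).mem_nhds (φ.map_source hx)] with z hz
    simp only [readInChart, Function.comp_apply, w, hφ]
    rw [(extChartAt (𝓡 n) p).right_inv hz, if_pos ((extChartAt (𝓡 n) p).map_target hz)]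
  have hstrict : ∀ x ∈ φ.source, φ x ∈ Metric.ball c r → φ x ∉ Metric.ball c δ →
      σ x * w x < laplacian n w x := by
    intro x hx hxr hxδ
    have hxA : φ x ∈ A := ⟨Metric.ball_subset_closedBall hxr, hxδ⟩
    have hκx := hκA _ hxA
    have hC₁x := (abs_le.1 (((hC₁ _ hxA).trans (le_abs_self _)))).2
    have hC₂x : σ x ≤ |C₂| := by
      have := (hC₂ _ hxA).trans (le_abs_self _)
      rw [Function.comp_apply, φ.left_inv hx] at this
      exact (le_abs_self _).trans this
    rw [hlap x hx]
    have hq0 : 0 ≤ q (φ x) := by positivity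
    have ht : 0 < r ^ 2 - q (φ x) := by
      rw [Metric.mem_ball, dist_eq_norm] at hxr
      have := pow_lt_pow_left₀ hxr (norm_nonneg _) two_ne_zero
      simp only [q]
      linarith
    have hF' : deriv F (q (φ x)) = -((k + 3) * (r ^ 2 - q (φ x)) ^ (k + 2)) := by
      simp only [F, deriv_capProfile, max_eq_left ht.le]
    have hF'' : deriv (deriv F) (q (φ x)) =
        (k + 3) * ((k + 2) * (r ^ 2 - q (φ x)) ^ (k + 1)) := by
      have := (hasDerivAt_deriv_capProfile (r ^ 2) k (q (φ x))).deriv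
      rwa [max_eq_left ht.le] at this
    have hwx : w x = (r ^ 2 - q (φ x)) ^ (k + 3) := by
      simp only [w, if_pos hx, F, capProfile, max_eq_left ht.le]
    rw [hF', hF'', hwx]
    set t := r ^ 2 - q (φ x) with htdef
    set L := coordLaplacian (metricMatrix p) q (φ x)
    set g := coordGradSq (metricMatrix p) q (φ x)
    have htr : t ≤ r ^ 2 := by linarith
    rw [div_lt_iff₀ hκ] at hk
    have hk0 : (0 : ℝ) ≤ k := k.cast_nonneg
    have b1 : t * L ≤ r ^ 2 * |C₁| :=
      (mul_le_mul_of_nonneg_left hC₁x ht.le).trans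
        (mul_le_mul_of_nonneg_right htr (abs_nonneg _))
    have b2 : σ x * t ^ 2 ≤ |C₂| * r ^ 4 := by
      have h1 : t ^ 2 ≤ r ^ 4 := by
        calc t ^ 2 ≤ (r ^ 2) ^ 2 := pow_le_pow_left₀ ht.le htr 2
          _ = r ^ 4 := by ring
      exact (mul_le_mul_of_nonneg_right hC₂x (by positivity)).trans
        (mul_le_mul_of_nonneg_left h1 (abs_nonneg _))
    have b3 : (k + 2) * κ ≤ (k + 2) * g := mul_le_mul_of_nonneg_left hκx (by positivity)
    have b4 : 0 < (k + 3) * ((k + 2) * g - t * L) - σ x * t ^ 2 := by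
      have h0 : 0 ≤ |C₂| * r ^ 4 := by positivity
      have h1 : |C₂| * r ^ 4 < (k + 2) * g - t * L := by nlinarith
      have h2 : (k + 2) * g - t * L ≤ (k + 3) * ((k + 2) * g - t * L) :=
        le_mul_of_one_le_left (by linarith) (by linarith)
      linarith
    have b5 := mul_pos (pow_pos ht (k + 1)) b4
    have e : t ^ (k + 1) * ((k + 3) * ((k + 2) * g - t * L) - σ x * t ^ 2) =
        -((k + 3) * t ^ (k + 2)) * L + (k + 3) * ((k + 2) * t ^ (k + 1)) * g -
          σ x * t ^ (k + 3) := by ring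
    linarith
  refine ⟨w, hw2, ?_, ?_, ?_, hstrict⟩
  · intro x
    simp only [w]
    split_ifs
    · exact pow_nonneg (le_max_right _ _) _
    · exact le_rfl
  · intro x hx hxr
    simp only [w, if_pos hx]
    refine pow_pos (lt_max_of_lt_left ?_) _
    rw [Metric.mem_ball, dist_eq_norm] at hxr
    have := pow_lt_pow_left₀ hxr (norm_nonneg _) two_ne_zero
    simp only [q]
    linarith
  · intro x hx
    by_cases hxC : x ∈ C₀
    · have hxs := hC₀s hxC
      by_cases hxr : φ x ∈ Metric.ball c r
      · exact (hstrict x hxs hxr fun h => hx ⟨hxs, h⟩).le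
      · have ht : r ^ 2 - q (φ x) ≤ 0 := by
          rw [Metric.mem_ball, dist_eq_norm, not_lt] at hxr
          have := pow_le_pow_left₀ hr₀ hxr 2
          simp only [q]
          linarith
        have hF' : deriv F (q (φ x)) = 0 := by
          simp [F, deriv_capProfile, max_eq_right ht]
        have hF'' : deriv (deriv F) (q (φ x)) = 0 := by
          have := (hasDerivAt_deriv_capProfile (r ^ 2) k (q (φ x))).deriv
          simpa [max_eq_right ht] using this
        have hwx : w x = 0 := by
          simp [w, F, capProfile, max_eq_right ht]
        rw [hlap x hxs, hF', hF'', hwx]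
        simp
    · rw [laplacian_congr (hout x hxC), (hout x hxC).self_of_nhds]
      simp [laplacian_zero]

/-- On a proper compact subset of a connected manifold there is a positive function `h` with
`Δh > σ h`. The points at which some nonnegative subsolution (on `K`) is positive and strict form an
open and closed set: a bump centred near a limit point of this set fails to be a subsolution only
in a small ball, where a large multiple of an already constructed function compensates. -/
theorem exists_pos_strict_subsolution [T2Space M] [ConnectedSpace M] {σ : M → ℝ}
    (hσ : Continuous σ) {K : Set M} (hK : IsCompact K) (hne : K ≠ Set.univ) :
    ∃ h : M → ℝ, ContMDiff (𝓡 n) 𝓘(ℝ, ℝ) 2 h ∧ (∀ x, 0 ≤ h x) ∧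
      ∀ x ∈ K, 0 < h x ∧ σ x * h x < laplacian n h x := by
  let Adm : (M → ℝ) → Prop := fun h => ContMDiff (𝓡 n) 𝓘(ℝ, ℝ) 2 h ∧ (∀ x, 0 ≤ h x) ∧
    ∀ x ∈ K, σ x * h x ≤ laplacian n h x
  let W : (M → ℝ) → Set M := fun h => {x | 0 < h x ∧ (x ∈ K → σ x * h x < laplacian n h x)}
  have hWopen : ∀ h, Adm h → IsOpen (W h) := by
    intro h hh
    rw [isOpen_iff_mem_nhds]
    rintro x ⟨hx0, hxK⟩
    have h0 : ∀ᶠ y in 𝓝 x, 0 < h y := hh.1.continuous.continuousAt.eventually_const_lt hx0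
    by_cases hx : x ∈ K
    · have hc : ContinuousAt (fun y => laplacian n h y - σ y * h y) x :=
        (continuousAt_laplacian (hh.1 x)).sub
          (hσ.continuousAt.mul hh.1.continuous.continuousAt)
      have h1 := hc.eventually_const_lt (sub_pos.2 (hxK hx))
      filter_upwards [h0, h1] with y hy0 hy1
      exact ⟨hy0, fun _ => sub_pos.1 hy1⟩
    · filter_upwards [h0, hK.isClosed.isOpen_compl.mem_nhds hx] with y hy0 hy1
      exact ⟨hy0, fun h => absurd h hy1⟩
  let G : Set M := {x | ∃ h, Adm h ∧ x ∈ W h}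
  have hGopen : IsOpen G := by
    have : G = ⋃ h, ⋃ _ : Adm h, W h := by
      ext x
      simp [G]
    rw [this]
    exact isOpen_iUnion fun h => isOpen_iUnion fun hh => hWopen h hh
  have hGne : G.Nonempty := by
    obtain ⟨q, hq⟩ := (Set.ne_univ_iff_exists_notMem K).1 hne
    have hz := mem_extChartAt_target (I := 𝓡 n) q
    have hev : ∀ᶠ z in 𝓝 (extChartAt (𝓡 n) q q), z ∈ (extChartAt (𝓡 n) q).target ∧
        (extChartAt (𝓡 n) q).symm z ∈ Kᶜ := by
      refine Filter.Eventually.and ((isOpen_extChartAt_target q).mem_nhds hz) ?_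
      refine (continuousAt_extChartAt_symm (I := 𝓡 n) q).eventually ?_
      rw [extChartAt_to_inv]
      exact hK.isClosed.isOpen_compl.mem_nhds hq
    obtain ⟨r, hr, hrb⟩ := Metric.nhds_basis_closedBall.mem_iff.1 hev
    obtain ⟨w, hw2, hw0, hwpos, hwsub, -⟩ := exists_barrier hσ q hr.le hr
      (fun z hz => (hrb hz).1)
    refine ⟨q, w, ⟨hw2, hw0, fun x hx => hwsub x ?_⟩,
      hwpos q (mem_extChartAt_source q) (Metric.mem_ball_self hr), fun h => absurd h hq⟩
    rintro ⟨hxs, hxr⟩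
    have := (hrb (Metric.ball_subset_closedBall hxr)).2
    rw [(extChartAt (𝓡 n) q).left_inv hxs] at this
    exact this hx
  have hGclosed : IsClosed G := by
    rw [← closure_subset_iff_isClosed]
    intro p hp
    have hz := mem_extChartAt_target (I := 𝓡 n) p
    obtain ⟨R, hR, hRb⟩ := Metric.nhds_basis_closedBall.mem_iff.1
      ((isOpen_extChartAt_target (I := 𝓡 n) p).mem_nhds hz)
    have hU : (extChartAt (𝓡 n) p).source ∩
        extChartAt (𝓡 n) p ⁻¹' Metric.ball (extChartAt (𝓡 n) p p) (R / 2) ∈ 𝓝 p :=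
      Filter.inter_mem (extChartAt_source_mem_nhds p)
        ((continuousAt_extChartAt p).preimage_mem_nhds (Metric.ball_mem_nhds _ (half_pos hR)))
    obtain ⟨q, ⟨hqs, hqR⟩, h, hh, hqW⟩ := mem_closure_iff_nhds.1 hp _ hU
    set φ := extChartAt (𝓡 n) p with hφ
    set c := φ q with hc
    rw [Set.mem_preimage, Metric.mem_ball] at hqR
    have hr : Metric.closedBall c (R / 2) ⊆ φ.target := by
      refine (Metric.closedBall_subset_closedBall' ?_).trans hRb
      linarith
    have hev : ∀ᶠ z in 𝓝 c, z ∈ φ.target ∧ φ.symm z ∈ W h := by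
      have hct := φ.map_source hqs
      refine Filter.Eventually.and ((isOpen_extChartAt_target p).mem_nhds hct) ?_
      refine (contMDiffAt_chart_symm p hct).continuousAt.eventually ?_
      rw [← hφ, φ.left_inv hqs]
      exact (hWopen h hh).mem_nhds hqW
    obtain ⟨δ, hδ, hδb⟩ := Metric.nhds_basis_closedBall.mem_iff.1 hev
    by_cases hpW : p ∈ W h
    · exact ⟨h, hh, hpW⟩
    have hpδ : φ p ∉ Metric.ball c δ := by
      intro hpδ
      have := (hδb (Metric.ball_subset_closedBall hpδ)).2
      rw [φ.left_inv (mem_extChartAt_source p)] at this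
      exact hpW this
    have hpr : φ p ∈ Metric.ball c (R / 2) := by rwa [Metric.mem_ball, dist_comm]
    obtain ⟨w, hw2, hw0, hwpos, hwsub, hwstrict⟩ := exists_barrier hσ p (half_pos hR).le hδ hr
    -- On the compact set `B ∩ K` the defect of `w` is bounded and that of `h` is bounded below.
    set B : Set M := φ.symm '' Metric.closedBall c δ with hB
    have hBc : IsCompact (B ∩ K) := ((isCompact_closedBall c δ).image_of_continuousOn
      ((continuousOn_extChartAt_symm p).mono fun z hz => (hδb hz).1)).inter_right hK.isClosed
    have hBW : B ⊆ W h := by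
      rintro _ ⟨z, hz, rfl⟩
      exact (hδb hz).2
    have hcont : ∀ u : M → ℝ, ContMDiff (𝓡 n) 𝓘(ℝ, ℝ) 2 u →
        Continuous fun x => laplacian n u x - σ x * u x := fun u hu =>
      (continuous_iff_continuousAt.2 fun x => continuousAt_laplacian (hu x)).sub
        (hσ.mul hu.continuous)
    obtain ⟨κ, hκ, hκB⟩ := hBc.exists_forall_le' (hcont h hh.1).continuousOn (a := 0)
      fun x hx => sub_pos.2 ((hBW hx.1).2 hx.2)
    obtain ⟨C, hC⟩ := hBc.exists_bound_of_continuousOn (hcont w hw2).continuousOn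
    set N : ℝ := |C| / κ with hN
    have hN0 : 0 ≤ N := by positivity
    have hNh : ContMDiff (𝓡 n) 𝓘(ℝ, ℝ) 2 (N • h) :=
      (contMDiff_const (I' := 𝓘(ℝ, ℝ)) (c := N)).smul hh.1
    have hlap : ∀ x, laplacian n (N • h + w) x = N * laplacian n h x + laplacian n w x := by
      intro x
      rw [laplacian_add (hNh x) (hw2 x), laplacian_const_smul]
    refine ⟨N • h + w, ⟨hNh.add hw2, ?_, ?_⟩, ?_, ?_⟩
    · intro x
      have := mul_nonneg hN0 (hh.2.1 x)
      have := hw0 x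
      simp only [Pi.add_apply, Pi.smul_apply, smul_eq_mul]
      linarith
    · intro x hx
      rw [hlap]
      simp only [Pi.add_apply, Pi.smul_apply, smul_eq_mul]
      by_cases hxB : x ∈ B
      · have h1 := hκB x ⟨hxB, hx⟩
        have h2 := (abs_le.1 ((hC x ⟨hxB, hx⟩).trans (le_abs_self C))).1
        have h3 : |C| ≤ N * (laplacian n h x - σ x * h x) := by
          calc |C| = N * κ := by rw [hN, div_mul_cancel₀ _ hκ.ne']
            _ ≤ _ := mul_le_mul_of_nonneg_left h1 hN0
        linarith
      · have h1 := hwsub x fun hx' => hxB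
          ⟨φ x, Metric.ball_subset_closedBall hx'.2, φ.left_inv hx'.1⟩
        have h2 := mul_nonneg hN0 (sub_nonneg.2 (hh.2.2 x hx))
        linarith
    · have h1 := hwpos p (mem_extChartAt_source p) hpr
      have h2 := mul_nonneg hN0 (hh.2.1 p)
      simp only [Pi.add_apply, Pi.smul_apply, smul_eq_mul]
      linarith
    · intro hpK
      rw [hlap]
      simp only [Pi.add_apply, Pi.smul_apply, smul_eq_mul]
      have h1 := hwstrict p (mem_extChartAt_source p) hpr hpδ
      have h2 := mul_nonneg hN0 (sub_nonneg.2 (hh.2.2 p hpK))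
      linarith
  have hG : G = Set.univ := IsClopen.eq_univ ⟨hGclosed, hGopen⟩ hGne
  -- Since the sets `W h` cover the compact `K`, a finite sum of the functions `h` is as required.
  have key : ∃ h, Adm h ∧ ∀ x ∈ K, 0 < h x ∧ σ x * h x < laplacian n h x := by
    refine hK.induction_on (p := fun s => ∃ h, Adm h ∧
      ∀ x ∈ s, x ∈ K → 0 < h x ∧ σ x * h x < laplacian n h x) ?_ ?_ ?_ ?_ |>.imp
      fun h hh => ⟨hh.1, fun x hx => hh.2 x hx hx⟩
    · exact ⟨0, ⟨contMDiff_const, fun x => le_rfl, fun x _ => by simp [laplacian_zero]⟩,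
        fun x hx => hx.elim⟩
    · rintro s t hst ⟨h, hh, hht⟩
      exact ⟨h, hh, fun x hx => hht x (hst hx)⟩
    · rintro s t ⟨h₁, hh₁, hs⟩ ⟨h₂, hh₂, ht⟩
      have hlap : ∀ x, laplacian n (h₁ + h₂) x = laplacian n h₁ x + laplacian n h₂ x := fun x =>
        laplacian_add (hh₁.1 x) (hh₂.1 x)
      refine ⟨h₁ + h₂, ⟨hh₁.1.add hh₂.1, fun x => add_nonneg (hh₁.2.1 x) (hh₂.2.1 x),
        fun x hx => ?_⟩, fun x hx hxK => ?_⟩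
      · have := hh₁.2.2 x hx
        have := hh₂.2.2 x hx
        rw [hlap, Pi.add_apply]
        linarith
      · have a₁ := hh₁.2.2 x hxK
        have a₂ := hh₂.2.2 x hxK
        have b₁ := hh₁.2.1 x
        have b₂ := hh₂.2.1 x
        rw [hlap, Pi.add_apply]
        rcases hx with hx | hx
        · have := hs x hx hxK
          constructor <;> linarith
        · have := ht x hx hxK
          constructor <;> linarith
    · intro x hx
      obtain ⟨h, hh, hxW⟩ : x ∈ G := hG ▸ Set.mem_univ x
      exact ⟨W h, mem_nhdsWithin_of_mem_nhds ((hWopen h hh).mem_nhds hxW), h, hh,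
        fun y hy hyK => ⟨hy.1, hy.2 hyK⟩⟩
  obtain ⟨h, hh, hhK⟩ := key
  exact ⟨h, hh.1, hh.2.1, hhK⟩

end MaximumPrinciple

/-! ### Local finiteness of the volume -/

section Volume
variable {n : ℕ} {M : Type*} [MetricSpace M] [ChartedSpace (EuclideanSpace ℝ (Fin n)) M]
  [IsManifold (𝓡 n) ∞ M]
  [RiemannianBundle (fun x : M => TangentSpace (𝓡 n) x)]
  [IsContMDiffRiemannianBundle (𝓡 n) ∞ (EuclideanSpace ℝ (Fin n))
    (fun x : M => TangentSpace (𝓡 n) x)]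
local notation "𝔼" => EuclideanSpace ℝ (Fin n)

/-- On a compact part of the target of a chart, the metric is bounded by the Euclidean one. -/
theorem exists_enorm_mfderiv_chart_symm_le (p : M) {A : Set 𝔼} (hA : IsCompact A)
    (hAt : A ⊆ (extChartAt (𝓡 n) p).target) :
    ∃ C : NNReal, ∀ z ∈ A, ∀ v : 𝔼,
      ‖mfderiv 𝓘(ℝ, 𝔼) (𝓡 n) (extChartAt (𝓡 n) p).symm z v‖ₑ ≤ C * ‖v‖ₑ := by
  have hcont : ContinuousOn (fun z => ∑ i, ∑ j, |metricMatrix p z i j|) A := by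
    intro z hz
    refine ContinuousAt.continuousWithinAt ?_
    exact tendsto_finsetSum _ fun i _ => tendsto_finsetSum _ fun j _ =>
      (contDiffAt_metricMatrix p (hAt hz) i j).continuousAt.abs
  obtain ⟨C, hC⟩ := hA.exists_bound_of_continuousOn hcont
  refine ⟨Real.toNNReal (Real.sqrt |C|), fun z hz v => ?_⟩
  have hb : ‖mfderiv 𝓘(ℝ, 𝔼) (𝓡 n) (extChartAt (𝓡 n) p).symm z v‖ ≤ Real.sqrt |C| * ‖v‖ := by
    refine abs_le_of_sq_le_sq' ?_ (by positivity) |>.2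
    rw [mul_pow, Real.sq_sqrt (abs_nonneg C), ← real_inner_self_eq_norm_sq]
    refine (metricMatrix_quadratic p z v v).le.trans ?_
    have hv : ∀ i, |v i| ≤ ‖v‖ := fun i => PiLp.norm_apply_le v i
    calc ∑ i, ∑ j, v i * v j * metricMatrix p z i j
        ≤ ∑ i, ∑ j, ‖v‖ ^ 2 * |metricMatrix p z i j| := by
          refine Finset.sum_le_sum fun i _ => Finset.sum_le_sum fun j _ => ?_
          refine (le_abs_self _).trans ?_
          rw [abs_mul, abs_mul, sq]
          exact mul_le_mul_of_nonneg_right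
            (mul_le_mul (hv i) (hv j) (abs_nonneg _) (norm_nonneg _)) (abs_nonneg _)
      _ = ‖v‖ ^ 2 * ∑ i, ∑ j, |metricMatrix p z i j| := by simp only [Finset.mul_sum]
      _ ≤ ‖v‖ ^ 2 * |C| := by
          refine mul_le_mul_of_nonneg_left ?_ (by positivity)
          exact (le_abs_self _).trans ((hC z hz).trans (le_abs_self C))
      _ = |C| * ‖v‖ ^ 2 := mul_comm _ _
  rw [← ofReal_norm, ← ofReal_norm]
  refine (ENNReal.ofReal_le_ofReal hb).trans ?_
  rw [ENNReal.ofReal_mul (Real.sqrt_nonneg _)]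
  rfl

variable [IsRiemannianManifold (𝓡 n) M]

/-- The distance being an infimum of lengths, inverse charts are Lipschitz on small balls. -/
theorem exists_lipschitzOnWith_chart_symm (p : M) :
    ∃ r > 0, ∃ C : NNReal,
      Metric.closedBall (extChartAt (𝓡 n) p p) r ⊆ (extChartAt (𝓡 n) p).target ∧
      LipschitzOnWith C (extChartAt (𝓡 n) p).symm (Metric.closedBall (extChartAt (𝓡 n) p p) r) := by
  obtain ⟨r, hr, hrb⟩ := Metric.nhds_basis_closedBall.mem_iff.1
    ((isOpen_extChartAt_target (I := 𝓡 n) p).mem_nhds (mem_extChartAt_target p))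
  set B := Metric.closedBall (extChartAt (𝓡 n) p p) r
  obtain ⟨C, hC⟩ := exists_enorm_mfderiv_chart_symm_le p (isCompact_closedBall _ r) hrb
  refine ⟨r, hr, C, hrb, fun a ha b hb => ?_⟩
  -- The image of a segment is a curve whose length is controlled by that of the segment.
  let ℓ : ℝ → 𝔼 := fun t => a + t • (b - a)
  have hℓ : ∀ t, HasDerivAt ℓ (b - a) t := fun t => by
    have h := ((hasDerivAt_id t).smul_const (b - a)).const_add a
    rw [one_smul] at h
    exact h
  have hℓB : ∀ t ∈ Set.Icc (0 : ℝ) 1, ℓ t ∈ B := fun t ht => by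
    have := (convex_closedBall (extChartAt (𝓡 n) p p) r).add_smul_sub_mem ha hb ht
    exact this
  have hℓ1 : ContMDiff 𝓘(ℝ, ℝ) 𝓘(ℝ, 𝔼) 1 ℓ := by
    rw [contMDiff_iff_contDiff]
    fun_prop
  rw [IsRiemannianManifold.out (I := 𝓡 n)]
  have h1 : Manifold.riemannianEDist (𝓡 n) ((extChartAt (𝓡 n) p).symm a)
      ((extChartAt (𝓡 n) p).symm b) ≤
      Manifold.pathELength (𝓡 n) ((extChartAt (𝓡 n) p).symm ∘ ℓ) 0 1 := by
    refine Manifold.riemannianEDist_le_pathELength ?_ (by simp [ℓ]) (by simp [ℓ]) zero_le_one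
    exact ((contMDiffOn_extChartAt_symm p).of_le (by norm_cast)).comp hℓ1.contMDiffOn
      fun t ht => hrb (hℓB t ht)
  refine h1.trans ?_
  rw [Manifold.pathELength_eq_lintegral_mfderiv_Icc]
  have h2 : ∀ t ∈ Set.Icc (0 : ℝ) 1,
      ‖mfderiv 𝓘(ℝ, ℝ) (𝓡 n) ((extChartAt (𝓡 n) p).symm ∘ ℓ) t 1‖ₑ ≤ C * edist a b := by
    intro t ht
    have e : mfderiv 𝓘(ℝ, ℝ) (𝓡 n) ((extChartAt (𝓡 n) p).symm ∘ ℓ) t 1 =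
        mfderiv 𝓘(ℝ, 𝔼) (𝓡 n) (extChartAt (𝓡 n) p).symm (ℓ t) (b - a) := by
      rw [mfderiv_comp t ((contMDiffAt_chart_symm p (hrb (hℓB t ht))).mdifferentiableAt (by simp))
        (hℓ1.mdifferentiable (by simp) t), mfderiv_eq_fderiv]
      have : fderiv ℝ ℓ t 1 = b - a := (hℓ t).deriv
      change mfderiv 𝓘(ℝ, 𝔼) (𝓡 n) (extChartAt (𝓡 n) p).symm (ℓ t) (fderiv ℝ ℓ t 1) = _
      rw [this]
    rw [e, edist_comm, edist_eq_enorm_sub]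
    exact hC _ (hℓB t ht) _
  calc ∫⁻ t in Set.Icc (0 : ℝ) 1,
        ‖mfderiv 𝓘(ℝ, ℝ) (𝓡 n) ((extChartAt (𝓡 n) p).symm ∘ ℓ) t 1‖ₑ
      ≤ ∫⁻ _ in Set.Icc (0 : ℝ) 1, C * edist a b := setLIntegral_mono' measurableSet_Icc h2
    _ = C * edist a b := by simp

/-- The Riemannian volume is locally finite, the charts being locally Lipschitz. -/
instance isLocallyFiniteMeasure_vol [MeasurableSpace M] [BorelSpace M] :
    IsLocallyFiniteMeasure (vol n M) := by
  refine ⟨fun p => ?_⟩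
  obtain ⟨r, hr, C, hrb, hC⟩ := exists_lipschitzOnWith_chart_symm (n := n) p
  refine ⟨(extChartAt (𝓡 n) p).symm '' Metric.closedBall (extChartAt (𝓡 n) p p) r, ?_, ?_⟩
  · have h1 : (extChartAt (𝓡 n) p).source ∩
        extChartAt (𝓡 n) p ⁻¹' Metric.closedBall (extChartAt (𝓡 n) p p) r ∈ 𝓝 p :=
      Filter.inter_mem (extChartAt_source_mem_nhds p)
        ((continuousAt_extChartAt p).preimage_mem_nhds (Metric.closedBall_mem_nhds _ hr))
    filter_upwards [h1] with x hx
    exact ⟨_, hx.2, (extChartAt (𝓡 n) p).left_inv hx.1⟩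
  · have h1 := hC.hausdorffMeasure_image_le (d := (n : ℝ)) n.cast_nonneg
    have h2 : μH[(n : ℝ)] (Metric.closedBall (extChartAt (𝓡 n) p p) r) < ⊤ := by
      have := isAddHaarMeasure_hausdorffMeasure (E := 𝔼)
      rw [finrank_euclideanSpace_fin] at this
      exact (isCompact_closedBall _ r).measure_lt_top
    have h3 : μH[(n : ℝ)] ((extChartAt (𝓡 n) p).symm ''
        Metric.closedBall (extChartAt (𝓡 n) p p) r) < ⊤ :=
      h1.trans_lt (ENNReal.mul_lt_top (ENNReal.rpow_lt_top_of_nonneg n.cast_nonneg (by simp)) h2)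
    simp only [vol, Measure.euclideanHausdorffMeasure_def, Measure.smul_apply]
    exact ENNReal.mul_lt_top ENNReal.coe_lt_top h3

end Volume

/-! ### The gradient in charts -/

section Gradient
variable {n : ℕ} {M : Type*} [TopologicalSpace M] [ChartedSpace (EuclideanSpace ℝ (Fin n)) M]
local notation "𝔼" => EuclideanSpace ℝ (Fin n)

section
variable [IsManifold (𝓡 n) ∞ M]

/-- Differentiability of `u` at a point is not needed, since both sides are junk values `0`
without it. -/
theorem differential_mfderiv_chart_symm (u : M → ℝ) (p : M) {z : 𝔼}
    (hz : z ∈ (extChartAt (𝓡 n) p).target) (v : 𝔼) :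
    differential n u ((extChartAt (𝓡 n) p).symm z)
      (mfderiv 𝓘(ℝ, 𝔼) (𝓡 n) (extChartAt (𝓡 n) p).symm z v) =
    fderiv ℝ (readInChart (n := n) p u) z v := by
  have hs : MDifferentiableAt 𝓘(ℝ, 𝔼) (𝓡 n) (extChartAt (𝓡 n) p).symm z :=
    (contMDiffAt_chart_symm p hz).mdifferentiableAt (by simp)
  by_cases hu : MDifferentiableAt (𝓡 n) 𝓘(ℝ, ℝ) u ((extChartAt (𝓡 n) p).symm z)
  · rw [← mfderiv_eq_fderiv, readInChart, mfderiv_comp z hu hs]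
    rfl
  · have hn : ¬ DifferentiableAt ℝ (readInChart (n := n) p u) z := by
      intro hd
      refine hu ?_
      set x := (extChartAt (𝓡 n) p).symm z with hx
      have hxs : x ∈ (extChartAt (𝓡 n) p).source := (extChartAt (𝓡 n) p).map_target hz
      have hd' : MDifferentiableAt 𝓘(ℝ, 𝔼) 𝓘(ℝ, ℝ) (readInChart (n := n) p u)
          (extChartAt (𝓡 n) p x) := by
        rw [hx, (extChartAt (𝓡 n) p).right_inv hz]
        exact hd.mdifferentiableAt
      have hc := hd'.comp x ((contMDiffAt_chart hxs).mdifferentiableAt (by simp))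
      refine hc.congr_of_eventuallyEq ?_
      filter_upwards [(isOpen_extChartAt_source (I := 𝓡 n) p).mem_nhds hxs] with y hy
      simp only [readInChart, Function.comp_apply, (extChartAt (𝓡 n) p).left_inv hy]
    rw [fderiv_zero_of_not_differentiableAt hn, differential,
      mfderiv_zero_of_not_mdifferentiableAt hu]
    rfl

end

variable [RiemannianBundle (fun x : M => TangentSpace (𝓡 n) x)]

theorem inner_grad (u : M → ℝ) (x : M) (v : TangentSpace (𝓡 n) x) :
    inner ℝ (grad n u x) v = differential n u x v := by
  rw [grad, InnerProductSpace.toDual_symm_apply]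

/-- If `ρ` is not differentiable at `x`, then its gradient is the junk value `0` and both sides
vanish. -/
theorem inner_grad_grad_comp {ρ : M → ℝ} {η : ℝ → ℝ} {x : M} {η' : ℝ}
    (hη : HasDerivAt η η' (ρ x)) :
    inner ℝ (grad n ρ x) (grad n (η ∘ ρ) x) = η' * ‖grad n ρ x‖ ^ 2 := by
  by_cases h : MDifferentiableAt (𝓡 n) 𝓘(ℝ, ℝ) ρ x
  · have hd : differential n (η ∘ ρ) x (grad n ρ x) = η' * differential n ρ x (grad n ρ x) := by
      have hη2 : MDifferentiableAt 𝓘(ℝ, ℝ) 𝓘(ℝ, ℝ) η (ρ x) := hη.differentiableAt.mdifferentiableAt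
      simp only [differential]
      rw [mfderiv_comp x hη2 h, mfderiv_eq_fderiv, hη.hasFDerivAt.fderiv]
      change (ContinuousLinearMap.toSpanSingleton ℝ η')
        (mfderiv (𝓡 n) 𝓘(ℝ, ℝ) ρ x (grad n ρ x)) = _
      exact mul_comm _ _
    rw [real_inner_comm, inner_grad, hd, ← inner_grad, real_inner_self_eq_norm_sq]
  · have h0 : grad n ρ x = 0 := by
      rw [grad, differential, mfderiv_zero_of_not_mdifferentiableAt h]
      exact map_zero _
    rw [h0, inner_zero_left, norm_zero]
    simp

variable [IsManifold (𝓡 n) ∞ M]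

theorem norm_grad_sq (u : M → ℝ) (p : M) {x : M} (hx : x ∈ (extChartAt (𝓡 n) p).source) :
    ‖grad n u x‖ ^ 2 =
      coordGradSq (metricMatrix p) (readInChart p u) (extChartAt (𝓡 n) p x) := by
  set z := extChartAt (𝓡 n) p x with hzdef
  have hz : z ∈ (extChartAt (𝓡 n) p).target := (extChartAt (𝓡 n) p).map_source hx
  have hxz : x = (extChartAt (𝓡 n) p).symm z := ((extChartAt (𝓡 n) p).left_inv hx).symm
  clear_value z
  subst hxz
  set G := metricMatrix p z
  have hinv := isInvertible_mfderivWithin_extChartAt_symm (I := 𝓡 n) hz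
  rw [ModelWithCorners.range_eq_univ, mfderivWithin_univ] at hinv
  obtain ⟨a, ha⟩ : ∃ a : 𝔼, mfderiv 𝓘(ℝ, 𝔼) (𝓡 n) (extChartAt (𝓡 n) p).symm z a =
      grad n u ((extChartAt (𝓡 n) p).symm z) := hinv.surjective _
  have h1 : ∀ w : 𝔼, ∑ i, ∑ j, a i * w j * G i j = ∑ j, w j * pderiv j (readInChart p u) z := by
    intro w
    rw [← metricMatrix_quadratic, ha]
    refine (inner_grad u _ _).trans ?_
    rw [differential_mfderiv_chart_symm u p hz, clm_apply_eq_sum]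
    rfl
  have h2 : ‖grad n u ((extChartAt (𝓡 n) p).symm z)‖ ^ 2 =
      ∑ j, a j * pderiv j (readInChart p u) z := by
    rw [← h1 a, ← metricMatrix_quadratic, ha]
    exact (real_inner_self_eq_norm_sq _).symm
  have h3 : G *ᵥ (fun i => a i) = fun j => pderiv j (readInChart p u) z := by
    funext j
    have := h1 (basisVec n j)
    simp only [basisVec, PiLp.single_apply] at this
    simp only [mul_ite, mul_one, mul_zero, ite_mul, zero_mul, one_mul, Finset.sum_ite_eq',
      Finset.mem_univ, if_true] at this
    rw [← this]
    simp only [Matrix.mulVec, dotProduct]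
    refine Finset.sum_congr rfl fun i _ => ?_
    rw [mul_comm, show G j i = G i j from metricMatrix_symm p z j i]
  have h4 : (fun i => a i) = G⁻¹ *ᵥ fun j => pderiv j (readInChart p u) z := by
    rw [← h3, Matrix.mulVec_mulVec, Matrix.nonsing_inv_mul _ (isUnit_det_metricMatrix p hz),
      Matrix.one_mulVec]
  rw [h2]
  simp only [coordGradSq]
  refine Finset.sum_congr rfl fun i _ => ?_
  rw [congrFun h4 i]
  simp only [Matrix.mulVec, dotProduct, Finset.sum_mul]
  exact Finset.sum_congr rfl fun j _ => by ring

variable [IsContMDiffRiemannianBundle (𝓡 n) ∞ (EuclideanSpace ℝ (Fin n))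
    (fun x : M => TangentSpace (𝓡 n) x)]

/-- In each of countably many charts, `|∇u|²` is a polynomial in the partial derivatives of `u`,
which are Borel functions for arbitrary `u`, with continuous coefficients. -/
theorem aemeasurable_norm_grad_sq [SigmaCompactSpace M] [MeasurableSpace M] [BorelSpace M]
    (μ : Measure M) (u : M → ℝ) : AEMeasurable (fun x => ‖grad n u x‖ ^ 2) μ := by
  obtain ⟨s, hs, hsU⟩ := countable_cover_nhds_of_sigmaCompact
    (f := fun p : M => (extChartAt (𝓡 n) p).source) fun p => extChartAt_source_mem_nhds p
  have : Countable s := hs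
  have hU : ⋃ p : s, (extChartAt (𝓡 n) (p : M)).source = Set.univ := by
    rw [Set.iUnion_coe_set]
    exact hsU
  rw [← Measure.restrict_univ (μ := μ), ← hU, aemeasurable_iUnion_iff]
  rintro ⟨p, -⟩
  have hmeas : MeasurableSet (extChartAt (𝓡 n) p).source :=
    (isOpen_extChartAt_source p).measurableSet
  have hφ : ContinuousOn (extChartAt (𝓡 n) p) (extChartAt (𝓡 n) p).source :=
    continuousOn_extChartAt p
  have h1 : ∀ i, AEMeasurable (fun x => pderiv i (readInChart p u) (extChartAt (𝓡 n) p x))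
      (μ.restrict (extChartAt (𝓡 n) p).source) := fun i =>
    (measurable_fderiv_apply_const ℝ _ _).comp_aemeasurable (hφ.aemeasurable hmeas)
  have h2 : ∀ i j, AEMeasurable (fun x => (metricMatrix p (extChartAt (𝓡 n) p x))⁻¹ i j)
      (μ.restrict (extChartAt (𝓡 n) p).source) := fun i j => by
    refine ContinuousOn.aemeasurable (fun x hx => ?_) hmeas
    have hz := (extChartAt (𝓡 n) p).map_source hx
    exact (continuousAt_inv_entry (fun i j => (contDiffAt_metricMatrix p hz i j).continuousAt)
      (isUnit_det_metricMatrix p hz) i j).comp_continuousWithinAt (hφ x hx)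
  have h3 : AEMeasurable (fun x => coordGradSq (metricMatrix p) (readInChart p u)
      (extChartAt (𝓡 n) p x)) (μ.restrict (extChartAt (𝓡 n) p).source) :=
    Finset.aemeasurable_fun_sum _ fun i _ => Finset.aemeasurable_fun_sum _ fun j _ =>
      (h2 i j).mul ((h1 i).mul (h1 j))
  refine h3.congr ?_
  filter_upwards [ae_restrict_mem hmeas] with x hx
  exact (norm_grad_sq u p hx).symm

end Gradient

/-! ### Volume doubling -/

section TestProfile

/-- The profile `t ↦ (t / R - 1/2)₊² (3 - t / R)₊ᵏ⁺²`, supported in `[R/2, 3R]`. -/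
def testProfile (k : ℕ) (R t : ℝ) : ℝ := max (t / R - 1 / 2) 0 ^ 2 * max (3 - t / R) 0 ^ (k + 2)

/-- The derivative of `testProfile k R`. -/
def testProfileDeriv (k : ℕ) (R t : ℝ) : ℝ :=
  1 / R * (max (t / R - 1 / 2) 0 * max (3 - t / R) 0 ^ (k + 1) *
    (2 * max (3 - t / R) 0 - (k + 2) * max (t / R - 1 / 2) 0))

theorem hasDerivAt_testProfile (k : ℕ) (R t : ℝ) :
    HasDerivAt (testProfile k R) (testProfileDeriv k R t) t := by
  have h1 : HasDerivAt (fun t : ℝ => t / R - 1 / 2) (1 / R) t :=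
    ((hasDerivAt_id t).div_const R).sub_const _
  have h2 : HasDerivAt (fun t : ℝ => 3 - t / R) (-(1 / R)) t :=
    ((hasDerivAt_id t).div_const R).const_sub _
  have h3 := ((hasDerivAt_posPart_pow 0 (t / R - 1 / 2)).comp t h1).mul
    ((hasDerivAt_posPart_pow k (3 - t / R)).comp t h2)
  have e : testProfileDeriv k R t =
      ((0 : ℕ) + 2) * max (t / R - 1 / 2) 0 ^ (0 + 1) * (1 / R) *
        max (3 - t / R) 0 ^ (k + 2) + max (t / R - 1 / 2) 0 ^ (0 + 2) *
        ((k + 2) * max (3 - t / R) 0 ^ (k + 1) * -(1 / R)) := by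
    simp only [testProfileDeriv]
    push_cast
    ring
  rw [e]
  exact h3

theorem continuous_testProfileDeriv (k : ℕ) (R : ℝ) : Continuous (testProfileDeriv k R) := by
  unfold testProfileDeriv
  fun_prop

theorem testProfileDeriv_eq_zero {k : ℕ} {R t : ℝ} (hR : 0 < R) (ht : t ≤ R / 2 ∨ 3 * R ≤ t) :
    testProfileDeriv k R t = 0 := by
  rcases ht with ht | ht
  · have : t / R - 1 / 2 ≤ 0 := by
      rw [sub_nonpos, div_le_iff₀ hR]
      linarith
    rw [testProfileDeriv, max_eq_right this]
    simp
  · have : 3 - t / R ≤ 0 := by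
      rw [sub_nonpos, le_div_iff₀ hR]
      linarith
    rw [testProfileDeriv, max_eq_right this]
    simp

theorem testProfile_nonneg (k : ℕ) (R t : ℝ) : 0 ≤ testProfile k R t := by
  unfold testProfile
  positivity

theorem testProfile_eq_zero {k : ℕ} {R t : ℝ} (hR : 0 < R) (ht : t ∉ Set.Icc (R / 2) (3 * R)) :
    testProfile k R t = 0 := by
  rw [Set.mem_Icc, not_and_or, not_le, not_le] at ht
  rcases ht with ht | ht
  · have : t / R - 1 / 2 ≤ 0 := by
      rw [sub_nonpos, div_le_iff₀ hR]
      linarith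
    rw [testProfile, max_eq_right this]
    simp
  · have : 3 - t / R ≤ 0 := by
      rw [sub_nonpos, le_div_iff₀ hR]
      linarith
    rw [testProfile, max_eq_right this]
    simp

theorem exists_lipschitzWith_testProfile {k : ℕ} {R : ℝ} (hR : 0 < R) :
    ∃ C, LipschitzWith C (testProfile k R) := by
  have h1 : ContDiff ℝ 1 (testProfile k R) := by
    rw [contDiff_one_iff_deriv]
    refine ⟨fun t => (hasDerivAt_testProfile k R t).differentiableAt, ?_⟩
    rw [show deriv (testProfile k R) = testProfileDeriv k R from
      funext fun t => (hasDerivAt_testProfile k R t).deriv]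
    exact continuous_testProfileDeriv k R
  refine ContDiff.lipschitzWith_of_hasCompactSupport (𝕂 := ℝ) ?_ h1 one_ne_zero
  exact HasCompactSupport.intro isCompact_Icc fun t ht => testProfile_eq_zero hR ht

/-- The differential inequality behind volume doubling. The factor `γ` stands for `|∇ρ|²`. Where
`ρ ≥ R` the logarithmic decay of the profile beats the term `m / ρ`; the loss is confined to
`ρ < R`. -/
theorem testProfile_bound {m : ℝ} (hm : 0 < m) {k : ℕ} (hk : 8 * m + 10 ≤ k) {R t γ : ℝ}
    (hR : 0 < R) (hγ : R / 2 < t → 1 / 4 ≤ γ ∧ γ ≤ 1) :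
    1 / (8 * R) * (if R ≤ t ∧ t < 2 * R then 1 else 0) -
      3 ^ (k + 1) * (6 + 12 * m) / (2 * R) * (if t < R then 1 else 0) ≤
      -(testProfileDeriv k R t * γ) - m / t * testProfile k R t := by
  have hB : 0 ≤ 3 ^ (k + 1) * (6 + 12 * m) / (2 * R) := by positivity
  rcases le_or_gt t (R / 2) with ht | ht
  · have ha : max (t / R - 1 / 2) 0 = 0 := by
      refine max_eq_right ?_
      rw [sub_nonpos, div_le_iff₀ hR]
      linarith
    rw [testProfileDeriv, testProfile, ha, if_neg (by intro h; linarith [h.1]),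
      if_pos (by linarith)]
    simp only [mul_zero, zero_mul, neg_zero]
    linarith
  obtain ⟨hγ1, hγ2⟩ := hγ ht
  have ht0 : 0 < t := by linarith
  obtain ⟨s, rfl⟩ : ∃ s, t = s * R := ⟨t / R, by field_simp⟩
  have hs : 1 / 2 < s := by nlinarith
  have hs0 : 0 < s := by linarith
  have ha : max (s - 1 / 2) 0 = s - 1 / 2 := max_eq_left (by linarith)
  rw [testProfileDeriv, testProfile, mul_div_cancel_right₀ s hR.ne', ha]
  rcases le_or_gt 3 s with hs3 | hs3
  · have hb : max (3 - s) 0 = 0 := max_eq_right (by linarith)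
    rw [hb, if_neg (by rintro ⟨-, h⟩; nlinarith), if_neg (by nlinarith)]
    simp
  have hb : max (3 - s) 0 = 3 - s := max_eq_left (by linarith)
  rw [hb]
  set a := s - 1 / 2 with hadef
  set b := 3 - s with hbdef
  have ha0 : 0 < a := by linarith
  have hb0 : 0 < b := by linarith
  have hk0 : (0 : ℝ) ≤ k := k.cast_nonneg
  have e : -(1 / R * (a * b ^ (k + 1) * (2 * b - (k + 2) * a)) * γ) -
      m / (s * R) * (a ^ 2 * b ^ (k + 2)) =
      1 / R * (a * b ^ (k + 1)) * (γ * ((k + 2) * a - 2 * b) - m * a * (b / s)) := by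
    field_simp
    ring
  rw [e]
  rcases le_or_gt 1 s with hs1 | hs1
  · rw [if_neg (by nlinarith : ¬ s * R < R)]
    have hbs : b / s ≤ 2 := by
      rw [div_le_iff₀ hs0]
      linarith
    have hc : 1 / 2 ≤ γ * ((k + 2) * a - 2 * b) - m * a * (b / s) := by
      have h1 : 12 * a ≤ (k + 2 - 8 * m) * a := mul_le_mul_of_nonneg_right (by linarith) ha0.le
      have h2 : m * a * (b / s) ≤ m * a * 2 := mul_le_mul_of_nonneg_left hbs (by positivity)
      have h5 : 0 ≤ m * a := by positivity
      have h3 : 0 ≤ (k + 2) * a - 2 * b := by nlinarith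
      have h4 : 1 / 4 * ((k + 2) * a - 2 * b) ≤ γ * ((k + 2) * a - 2 * b) :=
        mul_le_mul_of_nonneg_right hγ1 h3
      nlinarith
    split_ifs with h
    · have hs2 : s < 2 := by nlinarith [h.2]
      have hb1 : 1 ≤ b ^ (k + 1) := one_le_pow₀ (by linarith)
      have hab : 1 / 2 * 1 ≤ a * b ^ (k + 1) :=
        mul_le_mul (by linarith) hb1 zero_le_one ha0.le
      have h6 : 1 / 2 * 1 * (1 / 2) ≤ a * b ^ (k + 1) *
          (γ * ((k + 2) * a - 2 * b) - m * a * (b / s)) :=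
        mul_le_mul hab hc (by norm_num) (by positivity)
      have h7 := mul_le_mul_of_nonneg_left h6 (by positivity : 0 ≤ 1 / R)
      have e2 : 1 / (8 * R) = 1 / R * (1 / 8) := by field_simp
      have h8 : 1 / R * (1 / 8) ≤ 1 / R * (1 / 2 * 1 * (1 / 2)) :=
        mul_le_mul_of_nonneg_left (by norm_num) (by positivity)
      rw [mul_one, mul_zero, sub_zero, e2, mul_assoc]
      exact h8.trans h7
    · have : 0 ≤ 1 / R * (a * b ^ (k + 1)) * (γ * ((k + 2) * a - 2 * b) - m * a * (b / s)) :=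
        mul_nonneg (by positivity) (by linarith)
      linarith
  · rw [if_neg (by rintro ⟨h, -⟩; nlinarith), if_pos (by nlinarith)]
    have hbs : b / s ≤ 6 := by
      rw [div_le_iff₀ hs0]
      linarith
    have hc : -(6 + 12 * m) ≤ γ * ((k + 2) * a - 2 * b) - m * a * (b / s) := by
      have h1 : m * a * (b / s) ≤ m * (1 / 2) * 6 :=
        mul_le_mul (mul_le_mul_of_nonneg_left (by linarith) hm.le) hbs (by positivity)
          (by positivity)
      have h2 : 0 ≤ γ * ((k + 2) * a) := by positivity
      have h3 : γ * (2 * b) ≤ 1 * (2 * b) := mul_le_mul_of_nonneg_right hγ2 (by positivity)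
      nlinarith
    have hab : a * b ^ (k + 1) ≤ 1 / 2 * 3 ^ (k + 1) :=
      mul_le_mul (by linarith) (pow_le_pow_left₀ hb0.le (by linarith) _) (by positivity)
        (by norm_num)
    have h4 : 1 / R * (a * b ^ (k + 1)) * (6 + 12 * m) ≤
        1 / R * (1 / 2 * 3 ^ (k + 1)) * (6 + 12 * m) := by gcongr
    have h5 := mul_le_mul_of_nonneg_left hc (by positivity : 0 ≤ 1 / R * (a * b ^ (k + 1)))
    have e2 : 3 ^ (k + 1) * (6 + 12 * m) / (2 * R) =
        1 / R * (1 / 2 * 3 ^ (k + 1)) * (6 + 12 * m) := by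
      field_simp
    rw [e2]
    linarith

end TestProfile

section Exhaustion
variable {M : Type*} [TopologicalSpace M]

theorem isCompact_preimage_Iic {ρ : M → ℝ} (hpos : ∀ x, 0 < ρ x) (hρ : IsProperMap ρ) (r : ℝ) :
    IsCompact {x | ρ x ≤ r} := by
  have h := hρ.isCompact_preimage (isCompact_Icc (a := 0) (b := r))
  convert h using 1
  ext x
  simp [(hpos x).le]

theorem sigmaCompactSpace_of_isProperMap {ρ : M → ℝ} (hρ : IsProperMap ρ) :
    SigmaCompactSpace M := by
  refine SigmaCompactSpace.of_countable _ (Set.countable_range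
    fun k : ℕ => ρ ⁻¹' Metric.closedBall 0 k) ?_ ?_
  · rintro _ ⟨k, rfl⟩
    exact hρ.isCompact_preimage (isCompact_closedBall 0 _)
  · rw [Set.sUnion_range, ← Set.preimage_iUnion, Metric.iUnion_closedBall_nat, Set.preimage_univ]

end Exhaustion

section Doubling
variable {n : ℕ} {M : Type*} [MetricSpace M] [ChartedSpace (EuclideanSpace ℝ (Fin n)) M]
  [IsManifold (𝓡 n) ∞ M]
  [RiemannianBundle (fun x : M => TangentSpace (𝓡 n) x)]
  [IsContMDiffRiemannianBundle (𝓡 n) ∞ (EuclideanSpace ℝ (Fin n))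
    (fun x : M => TangentSpace (𝓡 n) x)]
  [IsRiemannianManifold (𝓡 n) M] [MeasurableSpace M] [BorelSpace M]

/-- The doubling constant of the sublevel sets, which depends on `m` only. -/
def doublingConst (m : ℝ) : ℝ := 1 + 4 * 3 ^ (⌈8 * m + 10⌉₊ + 1) * (6 + 12 * m)

/-- Volume doubling: test `Δρ ≤ m / ρ` with `testProfile k R ∘ ρ` for `k ≥ 8 m + 10`. -/
theorem measureReal_subLevel_two_mul_le {m R₀ : ℝ} (hm : 0 < m) (hR₀ : 0 < R₀) {ρ : M → ℝ}
    (hρ : IsGoodExhaustion n m R₀ ρ) {R : ℝ} (hR : 2 * R₀ < R) :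
    (vol n M).real (subLevel ρ (2 * R)) ≤ doublingConst m * (vol n M).real (subLevel ρ R) := by
  have hR' : 0 < R := by linarith
  set k := ⌈8 * m + 10⌉₊ with hk
  have hkm : 8 * m + 10 ≤ k := Nat.le_ceil _
  have := sigmaCompactSpace_of_isProperMap hρ.proper
  have hρc : Continuous ρ := hρ.proper.continuous
  have hopen : ∀ r, MeasurableSet (subLevel ρ r) := fun r =>
    (isOpen_lt hρc continuous_const).measurableSet
  have hfin : ∀ r, vol n M (subLevel ρ r) < ⊤ := fun r =>
    (measure_mono fun x (hx : ρ x < r) => hx.le).trans_lt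
      (isCompact_preimage_Iic hρ.pos hρ.proper r).measure_lt_top
  set φ : M → ℝ := testProfile k R ∘ ρ with hφ
  have hsupp : ∀ x, φ x ≠ 0 → ρ x ∈ Set.Icc (R / 2) (3 * R) := fun x hx => by
    by_contra h
    exact hx (testProfile_eq_zero hR' h)
  have hK : IsCompact (ρ ⁻¹' Set.Icc (R / 2) (3 * R)) := hρ.proper.isCompact_preimage isCompact_Icc
  have hφc : Continuous φ :=
    (continuous_iff_continuousAt.2 fun t => (hasDerivAt_testProfile k R t).continuousAt).comp hρc
  have hcs : HasCompactSupport φ := HasCompactSupport.intro hK fun x hx => by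
    by_contra h
    exact hx (hsupp x h)
  have hts : tsupport φ ⊆ {x | R₀ < ρ x} := by
    refine (closure_minimal (fun x hx => hsupp x hx) hK.isClosed).trans fun x hx => ?_
    have := hx.1
    rw [Set.mem_ofPred_eq]
    linarith
  have hlip : ∃ C, LipschitzWith C φ := by
    obtain ⟨C, hC⟩ := exists_lipschitzWith_testProfile (k := k) hR'
    obtain ⟨C', hC'⟩ := hρ.lipschitz
    exact ⟨C * C', hC.comp hC'⟩
  have key := hρ.laplacian_le φ hlip hcs hts fun x => testProfile_nonneg k R (ρ x)
  have hinner : ∀ x, inner ℝ (grad n ρ x) (grad n φ x) =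
      testProfileDeriv k R (ρ x) * ‖grad n ρ x‖ ^ 2 := fun x =>
    inner_grad_grad_comp (hasDerivAt_testProfile k R (ρ x))
  simp only [hinner] at key
  have hgrad : ∀ᵐ x ∂(vol n M), R / 2 < ρ x →
      1 / 4 ≤ ‖grad n ρ x‖ ^ 2 ∧ ‖grad n ρ x‖ ^ 2 ≤ 1 := by
    filter_upwards [hρ.norm_grad] with x hx hxR
    obtain ⟨h1, h2⟩ := hx (by linarith)
    constructor <;> nlinarith [norm_nonneg (grad n ρ x)]
  -- Integrability of the two sides.
  have hKvol : vol n M (ρ ⁻¹' Set.Icc (R / 2) (3 * R)) < ⊤ := hK.measure_lt_top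
  have hint1 : Integrable (fun x => testProfileDeriv k R (ρ x) * ‖grad n ρ x‖ ^ 2) (vol n M) := by
    obtain ⟨B, hB⟩ := isCompact_Icc.exists_bound_of_continuousOn
      (continuous_testProfileDeriv k R).continuousOn (s := Set.Icc (R / 2) (3 * R))
    have hbd : Integrable ((ρ ⁻¹' Set.Icc (R / 2) (3 * R)).indicator fun _ => B) (vol n M) :=
      (integrable_indicator_iff hK.measurableSet).2 (integrableOn_const hKvol.ne)
    refine hbd.mono' ?_ ?_
    · exact (((continuous_testProfileDeriv k R).comp hρc).measurable.aemeasurable.mul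
        (aemeasurable_norm_grad_sq _ ρ)).aestronglyMeasurable
    · filter_upwards [hgrad] with x hx
      by_cases hxK : ρ x ∈ Set.Icc (R / 2) (3 * R)
      · rw [Set.indicator_of_mem (show x ∈ ρ ⁻¹' Set.Icc (R / 2) (3 * R) from hxK)]
        have hBx := hB _ hxK
        rcases hxK.1.eq_or_lt with h | h
        · rw [testProfileDeriv_eq_zero hR' (Or.inl h.ge), zero_mul, norm_zero]
          exact (norm_nonneg _).trans hBx
        · rw [norm_mul, Real.norm_of_nonneg (sq_nonneg _)]
          exact (mul_le_of_le_one_right (norm_nonneg _) (hx h).2).trans hBx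
      · rw [Set.indicator_of_notMem (show x ∉ ρ ⁻¹' Set.Icc (R / 2) (3 * R) from hxK)]
        rw [Set.mem_Icc, not_and_or, not_le, not_le] at hxK
        rw [testProfileDeriv_eq_zero hR' (hxK.imp le_of_lt le_of_lt), zero_mul, norm_zero]
  have hint2 : Integrable (fun x => m / ρ x * φ x) (vol n M) := by
    refine Continuous.integrable_of_hasCompactSupport ?_ hcs.mul_left
    exact (continuous_const.div hρc fun x => (hρ.pos x).ne').mul hφc
  set A : Set M := {x | R ≤ ρ x ∧ ρ x < 2 * R} with hA
  have hAm : MeasurableSet A :=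
    (isClosed_le continuous_const hρc).measurableSet.inter
      (isOpen_lt hρc continuous_const).measurableSet
  have hAfin : vol n M A < ⊤ := (measure_mono fun x hx => hx.2).trans_lt (hfin (2 * R))
  have hintA : Integrable (A.indicator fun _ => (1 : ℝ)) (vol n M) :=
    (integrable_indicator_iff hAm).2 (integrableOn_const hAfin.ne)
  have hintD : Integrable ((subLevel ρ R).indicator fun _ => (1 : ℝ)) (vol n M) :=
    (integrable_indicator_iff (hopen R)).2 (integrableOn_const (hfin R).ne)
  have hneg : Integrable (fun x => -(testProfileDeriv k R (ρ x) * ‖grad n ρ x‖ ^ 2)) (vol n M) :=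
    hint1.neg
  have hle : ∫ x, (1 / (8 * R) * A.indicator (fun _ => (1 : ℝ)) x -
      3 ^ (k + 1) * (6 + 12 * m) / (2 * R) * (subLevel ρ R).indicator (fun _ => (1 : ℝ)) x)
        ∂(vol n M) ≤
      ∫ x, (-(testProfileDeriv k R (ρ x) * ‖grad n ρ x‖ ^ 2) - m / ρ x * φ x) ∂(vol n M) := by
    refine integral_mono_ae ((hintA.const_mul _).sub (hintD.const_mul _)) (hneg.sub hint2) ?_
    filter_upwards [hgrad] with x hx
    have := testProfile_bound hm hkm hR' hx
    have i1 : A.indicator (fun _ => (1 : ℝ)) x = if R ≤ ρ x ∧ ρ x < 2 * R then 1 else 0 := by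
      split_ifs with h
      · exact Set.indicator_of_mem (show x ∈ A from h) _
      · exact Set.indicator_of_notMem (show x ∉ A from h) _
    have i2 : (subLevel ρ R).indicator (fun _ => (1 : ℝ)) x = if ρ x < R then 1 else 0 := by
      split_ifs with h
      · exact Set.indicator_of_mem (show x ∈ subLevel ρ R from h) _
      · exact Set.indicator_of_notMem (show x ∉ subLevel ρ R from h) _
    rw [i1, i2]
    exact this
  rw [integral_sub (hintA.const_mul _) (hintD.const_mul _), integral_sub hneg hint2,
    integral_neg, integral_const_mul, integral_const_mul] at hle
  have eA : ∫ x, A.indicator (fun _ => (1 : ℝ)) x ∂(vol n M) = (vol n M).real A :=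
    integral_indicator_one hAm
  have eD : ∫ x, (subLevel ρ R).indicator (fun _ => (1 : ℝ)) x ∂(vol n M) =
      (vol n M).real (subLevel ρ R) := integral_indicator_one (hopen R)
  rw [eA, eD] at hle
  have h1 : 1 / (8 * R) * (vol n M).real A ≤
      3 ^ (k + 1) * (6 + 12 * m) / (2 * R) * (vol n M).real (subLevel ρ R) := by linarith
  have h2 : (vol n M).real A ≤
      4 * 3 ^ (k + 1) * (6 + 12 * m) * (vol n M).real (subLevel ρ R) := by
    have h3 := mul_le_mul_of_nonneg_left h1 (by positivity : 0 ≤ 8 * R)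
    have e1 : 8 * R * (1 / (8 * R) * (vol n M).real A) = (vol n M).real A := by
      field_simp
    have e2 : 8 * R * (3 ^ (k + 1) * (6 + 12 * m) / (2 * R) * (vol n M).real (subLevel ρ R)) =
        4 * 3 ^ (k + 1) * (6 + 12 * m) * (vol n M).real (subLevel ρ R) := by
      field_simp
      ring
    rwa [e1, e2] at h3
  have h4 : (vol n M).real (subLevel ρ (2 * R)) ≤
      (vol n M).real (subLevel ρ R) + (vol n M).real A := by
    refine (measureReal_mono (fun x hx => ?_) ?_).trans (measureReal_union_le _ _)
    · rcases lt_or_ge (ρ x) R with h | h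
      · exact Or.inl h
      · exact Or.inr ⟨h, hx⟩
    · exact (measure_union_lt_top (hfin R) hAfin).ne
  simp only [doublingConst, ← hk]
  linarith

end Doubling

/-! ### Determinants of Gram matrices -/

section GramMatrices

/-- The inequality between the geometric and the arithmetic mean of the eigenvalues. -/
theorem det_le_trace_div_pow {k : ℕ} {A : Matrix (Fin k) (Fin k) ℝ} (hA : A.PosSemidef) :
    A.det ≤ (A.trace / k) ^ k := by
  rcases Nat.eq_zero_or_pos k with rfl | hk
  · simp
  have hk' : (0 : ℝ) < k := Nat.cast_pos.2 hk
  have hnn := hA.eigenvalues_nonneg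
  have h := Real.geom_mean_le_arith_mean Finset.univ (fun _ => 1) hA.isHermitian.eigenvalues
    (fun _ _ => zero_le_one) (by simpa using hk) fun i _ => hnn i
  simp only [Real.rpow_one, one_mul, Finset.sum_const, Finset.card_univ, Fintype.card_fin,
    nsmul_eq_mul, mul_one] at h
  have hprod : 0 ≤ ∏ i, hA.isHermitian.eigenvalues i := Finset.prod_nonneg fun i _ => hnn i
  have h' := pow_le_pow_left₀ (Real.rpow_nonneg hprod _) h k
  rw [Real.rpow_inv_natCast_pow hprod hk.ne'] at h'
  rw [hA.isHermitian.det_eq_prod_eigenvalues, hA.isHermitian.trace_eq_sum_eigenvalues]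
  simpa using h'

/-- The determinant inequality of `det_le_trace_div_pow` relative to a positive definite matrix `B`:
apply it to `Q A Qᴴ`, where `B⁻¹ = Qᴴ Q`. -/
theorem det_le_det_mul_trace_div_pow {k : ℕ} {A B : Matrix (Fin k) (Fin k) ℝ} (hA : A.PosSemidef)
    (hB : B.PosDef) : A.det ≤ B.det * ((B⁻¹ * A).trace / k) ^ k := by
  obtain ⟨Q, hQ⟩ := exists_eq_conjTranspose_mul_self hB.inv.posSemidef
  have h := det_le_trace_div_pow (hA.mul_mul_conjTranspose_same Q)
  have e1 : (Q * A * Qᴴ).det = B.det⁻¹ * A.det := by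
    have : B.det⁻¹ = Qᴴ.det * Q.det := by
      rw [← Ring.inverse_eq_inv', ← Matrix.det_nonsing_inv, hQ, Matrix.det_mul]
    rw [this, Matrix.det_mul, Matrix.det_mul]
    ring
  have e2 : (Q * A * Qᴴ).trace = (B⁻¹ * A).trace := by
    rw [Matrix.trace_mul_comm, ← Matrix.mul_assoc, hQ]
  rw [e1, e2, inv_mul_le_iff₀ hB.det_pos] at h
  exact h

variable {X : Type*} [MeasurableSpace X] {k : ℕ}

/-- The Gram matrix of `v₁, …, vₖ` in `L²(D)`. -/
def gramMatrix (μ : Measure X) (v : Fin k → X → ℝ) (D : Set X) : Matrix (Fin k) (Fin k) ℝ :=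
  Matrix.of fun i j => ∫ x in D, v i x * v j x ∂μ

theorem gramMatrix_isHermitian (μ : Measure X) (v : Fin k → X → ℝ) (D : Set X) :
    (gramMatrix μ v D).IsHermitian := by
  ext i j
  simp only [Matrix.conjTranspose_apply, gramMatrix, Matrix.of_apply, star_trivial]
  exact integral_congr_ae (Filter.Eventually.of_forall fun x => mul_comm _ _)

theorem dotProduct_gramMatrix_mulVec {μ : Measure X} {v : Fin k → X → ℝ} {D : Set X}
    (hint : ∀ i j, IntegrableOn (fun x => v i x * v j x) D μ) (c : Fin k → ℝ) :
    c ⬝ᵥ (gramMatrix μ v D).mulVec c = ∫ x in D, (∑ i, c i * v i x) ^ 2 ∂μ := by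
  have e : ∀ x, (∑ i, c i * v i x) ^ 2 = ∑ i, ∑ j, c i * c j * (v i x * v j x) := fun x => by
    rw [sq, Finset.sum_mul_sum]
    exact Finset.sum_congr rfl fun i _ => Finset.sum_congr rfl fun j _ => by ring
  simp only [e]
  rw [integral_finsetSum _ fun i _ => integrable_finsetSum _ fun j _ => (hint i j).const_mul _]
  simp only [dotProduct, Matrix.mulVec, gramMatrix, Matrix.of_apply, Finset.mul_sum]
  refine Finset.sum_congr rfl fun i _ => ?_
  rw [integral_finsetSum _ fun j _ => (hint i j).const_mul _]
  refine Finset.sum_congr rfl fun j _ => ?_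
  rw [integral_const_mul]
  ring

/-- If every combination `w` of `v₁, …, vₖ` satisfies the mean value inequality
`μ(D') w² ≤ A ∫_{D'} w²` on `D ⊆ D'`, then `tr (G_{D'}⁻¹ G_D) ≤ A`: for fixed `x`, apply the
inequality to the combination with coefficients `G_{D'}⁻¹ v(x)` and integrate over `D`. -/
theorem trace_inv_gramMatrix_mul_le {μ : Measure X} {v : Fin k → X → ℝ} {D D' : Set X} {A : ℝ}
    (hA : 0 ≤ A) (hD : MeasurableSet D) (hsub : D ⊆ D') (hfin : μ D' ≠ ⊤) (hpos : 0 < μ.real D')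
    (hint : ∀ i j, IntegrableOn (fun x => v i x * v j x) D' μ)
    (hdef : (gramMatrix μ v D').PosDef)
    (hmean : ∀ c : Fin k → ℝ, ∀ x ∈ D,
      μ.real D' * (∑ i, c i * v i x) ^ 2 ≤ A * ∫ y in D', (∑ i, c i * v i y) ^ 2 ∂μ) :
    ((gramMatrix μ v D')⁻¹ * gramMatrix μ v D).trace ≤ A := by
  set B := gramMatrix μ v D' with hB
  have hdet : IsUnit B.det := hdef.det_pos.ne'.isUnit
  set s : X → ℝ := fun x => ∑ i, (B⁻¹.mulVec fun j => v j x) i * v i x with hs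
  have hs_le : ∀ x ∈ D, s x ≤ A / μ.real D' := fun x hx => by
    have h := hmean (B⁻¹.mulVec fun j => v j x) x hx
    rw [← dotProduct_gramMatrix_mulVec hint, ← hB, Matrix.mulVec_mulVec,
      Matrix.mul_nonsing_inv _ hdet, Matrix.one_mulVec] at h
    change μ.real D' * s x ^ 2 ≤ A * s x at h
    rcases le_or_gt (s x) 0 with h0 | h0
    · exact h0.trans (by positivity)
    · rw [le_div_iff₀ hpos]
      have : s x * (s x * μ.real D') ≤ s x * A := by linarith
      exact le_of_mul_le_mul_left this h0
  have es : ∀ x, s x = ∑ i, ∑ j, B⁻¹ i j * (v j x * v i x) := fun x => by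
    simp only [hs, Matrix.mulVec, dotProduct, Finset.sum_mul, mul_assoc]
  have hint' : ∀ i j, IntegrableOn (fun x => B⁻¹ i j * (v j x * v i x)) D μ := fun i j =>
    ((hint j i).mono_set hsub).const_mul _
  have hsint : IntegrableOn s D μ := by
    simp only [funext es]
    exact integrable_finsetSum _ fun i _ => integrable_finsetSum _ fun j _ => hint' i j
  have htr : (B⁻¹ * gramMatrix μ v D).trace = ∫ x in D, s x ∂μ := by
    simp only [es]
    rw [integral_finsetSum _ fun i _ => integrable_finsetSum _ fun j _ => hint' i j]
    refine Finset.sum_congr rfl fun i _ => ?_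
    rw [integral_finsetSum _ fun j _ => hint' i j]
    simp only [Matrix.diag_apply, Matrix.mul_apply, gramMatrix, Matrix.of_apply,
      integral_const_mul]
  have hDfin : μ D ≠ ⊤ := measure_ne_top_of_subset hsub hfin
  rw [htr]
  calc ∫ x in D, s x ∂μ ≤ ∫ _ in D, A / μ.real D' ∂μ :=
        setIntegral_mono_on hsint (integrableOn_const hDfin) hD hs_le
    _ = μ.real D * (A / μ.real D') := by rw [setIntegral_const, smul_eq_mul]
    _ ≤ μ.real D' * (A / μ.real D') := by
        have := measureReal_mono hsub hfin
        gcongr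
    _ = A := mul_div_cancel₀ A hpos.ne'

/-- The determinants of the Gram matrices on `D₀ ⊆ D₁ ⊆ …` grow at least like `(k / A)^(k j)` by the
mean value inequality and at most like `q^(k j)` by the growth of the functions, so that
`k ≤ A q`. -/
theorem natCast_le_of_gramMatrix_growth {μ : Measure X} {v : Fin k → X → ℝ} {D : ℕ → Set X}
    {A q C : ℝ} (hA : 0 < A) (hq : 0 ≤ q) (hD : ∀ j, MeasurableSet (D j)) (hmono : Monotone D)
    (hfin : ∀ j, μ (D j) ≠ ⊤)
    (hint : ∀ j i l, IntegrableOn (fun x => v i x * v l x) (D j) μ)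
    (hdef : ∀ c : Fin k → ℝ, c ≠ 0 → 0 < ∫ x in D 0, (∑ i, c i * v i x) ^ 2 ∂μ)
    (hmean : ∀ j, ∀ c : Fin k → ℝ, ∀ x ∈ D j, μ.real (D (j + 1)) * (∑ i, c i * v i x) ^ 2 ≤
      A * ∫ y in D (j + 1), (∑ i, c i * v i y) ^ 2 ∂μ)
    (hgrowth : ∀ j i l, |∫ x in D j, v i x * v l x ∂μ| ≤ C * q ^ j) :
    (k : ℝ) ≤ A * q := by
  by_contra! hk
  have hk0 : (0 : ℝ) < k := (mul_nonneg hA.le hq).trans_lt hk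
  have hkpos : 0 < k := Nat.cast_pos.1 hk0
  have hsq : ∀ j (c : Fin k → ℝ), IntegrableOn (fun x => (∑ i, c i * v i x) ^ 2) (D j) μ :=
    fun j c => by
      have e : (fun x => (∑ i, c i * v i x) ^ 2) =
          fun x => ∑ i, ∑ l, c i * c l * (v i x * v l x) := by
        funext x
        rw [sq, Finset.sum_mul_sum]
        exact Finset.sum_congr rfl fun i _ => Finset.sum_congr rfl fun j _ => by ring
      rw [e]
      exact integrable_finsetSum _ fun i _ => integrable_finsetSum _ fun l _ =>
        (hint j i l).const_mul _
  have hint_pos : ∀ j (c : Fin k → ℝ), c ≠ 0 → 0 < ∫ x in D j, (∑ i, c i * v i x) ^ 2 ∂μ :=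
    fun j c hc => (hdef c hc).trans_le <| setIntegral_mono_set (hsq j c)
      (Filter.Eventually.of_forall fun x => sq_nonneg _) (hmono (Nat.zero_le j)).eventuallyLE
  have hG : ∀ j, (gramMatrix μ v (D j)).PosDef := fun j =>
    Matrix.PosDef.of_dotProduct_mulVec_pos (gramMatrix_isHermitian μ v _) fun c hc => by
      rw [star_trivial, dotProduct_gramMatrix_mulVec (hint j)]
      exact hint_pos j c hc
  have hvol : ∀ j, 0 < μ.real (D j) := fun j => by
    by_contra! h0
    have h1 : μ (D j) = 0 := by
      have := h0.antisymm measureReal_nonneg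
      rwa [measureReal_eq_zero_iff (hfin j)] at this
    have h2 := hint_pos j (fun _ => 1) fun h => one_ne_zero (congrFun h ⟨0, hkpos⟩)
    rw [setIntegral_measure_zero _ h1] at h2
    exact lt_irrefl _ h2
  set g : ℕ → ℝ := fun j => (gramMatrix μ v (D j)).det with hg
  have hstep : ∀ j, g j ≤ g (j + 1) * (A / k) ^ k := fun j => by
    refine (det_le_det_mul_trace_div_pow (hG j).posSemidef (hG (j + 1))).trans ?_
    have htr := trace_inv_gramMatrix_mul_le hA.le (hD j) (hmono j.le_succ) (hfin (j + 1))
      (hvol (j + 1)) (hint (j + 1)) (hG (j + 1)) (hmean j)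
    have h0 : 0 ≤ ((gramMatrix μ v (D (j + 1)))⁻¹ * gramMatrix μ v (D j)).trace := by
      obtain ⟨Q, hQ⟩ := exists_eq_conjTranspose_mul_self (hG (j + 1)).inv.posSemidef
      rw [hQ, Matrix.mul_assoc, Matrix.trace_mul_comm]
      exact ((hG j).posSemidef.mul_mul_conjTranspose_same Q).trace_nonneg
    refine mul_le_mul_of_nonneg_left (pow_le_pow_left₀ (by positivity) ?_ k)
      (hG (j + 1)).det_pos.le
    gcongr
  have hlow : ∀ j, g 0 ≤ g j * ((A / k) ^ k) ^ j := by
    intro j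
    induction j with
    | zero => simp
    | succ j ih =>
      refine ih.trans ?_
      rw [pow_succ', ← mul_assoc]
      exact mul_le_mul_of_nonneg_right (hstep j) (by positivity)
  have hup : ∀ j, g j ≤ k.factorial * (C * q ^ j) ^ k := fun j => by
    have h := Matrix.det_le (A := gramMatrix μ v (D j)) (abv := AbsoluteValue.abs)
      fun i l => hgrowth j i l
    rw [Fintype.card_fin, nsmul_eq_mul] at h
    exact (le_abs_self _).trans h
  have hall : ∀ j, g 0 ≤ k.factorial * C ^ k * ((A * q / k) ^ k) ^ j := fun j => by
    refine (hlow j).trans ((mul_le_mul_of_nonneg_right (hup j) (by positivity)).trans_eq ?_)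
    rw [mul_pow, ← pow_mul, ← pow_mul, ← pow_mul, mul_comm j k, mul_div_right_comm A q,
      mul_pow]
    ring
  have hlim : Filter.Tendsto (fun j : ℕ => k.factorial * C ^ k * ((A * q / k) ^ k) ^ j)
      Filter.atTop (𝓝 (k.factorial * C ^ k * 0)) :=
    (tendsto_pow_atTop_nhds_zero_of_lt_one (by positivity)
      (pow_lt_one₀ (by positivity) ((div_lt_one hk0).2 hk) hkpos.ne')).const_mul _
  rw [mul_zero] at hlim
  exact (hG 0).det_pos.not_ge (ge_of_tendsto' hlim hall)

end GramMatrices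

/-! ### Solutions on compact and on noncompact manifolds -/

section Solutions
variable {n : ℕ} {M : Type*} [MetricSpace M] [ChartedSpace (EuclideanSpace ℝ (Fin n)) M]
  [RiemannianBundle (fun x : M => TangentSpace (𝓡 n) x)]
  [IsManifold (𝓡 n) ∞ M]
  [IsContMDiffRiemannianBundle (𝓡 n) ∞ (EuclideanSpace ℝ (Fin n))
    (fun x : M => TangentSpace (𝓡 n) x)]
  [ConnectedSpace M]

/-- On a compact manifold a solution that is somewhere positive is constant: add to it a small
multiple of a strict subsolution on the set where it is close to its maximum. -/
theorem eq_of_isMaxOn_of_compactSpace [CompactSpace M] {σ v : M → ℝ}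
    (hσ : Continuous σ) (hσ0 : ∀ x, 0 ≤ σ x) (hv : ContMDiff (𝓡 n) 𝓘(ℝ, ℝ) 2 v)
    (hΔ : ∀ x, laplacian n v x = σ x * v x) {p : M} (hp : ∀ y, v y ≤ v p) (hpos : 0 < v p) (x : M) :
    v x = v p := by
  by_contra hx
  have hlt : v x < v p := lt_of_le_of_ne (hp x) hx
  set a := max (v x) 0 with ha
  have hap : a < v p := max_lt hlt hpos
  obtain ⟨b, hab, hbp⟩ := exists_between hap
  have hvc : Continuous v := hv.continuous
  have hK : IsCompact {y | b ≤ v y} := (isClosed_le continuous_const hvc).isCompact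
  have hne : {y | b ≤ v y} ≠ Set.univ := fun h => by
    have : b ≤ v x := by
      have hx' : x ∈ {y | b ≤ v y} := h ▸ Set.mem_univ x
      exact hx'
    exact (this.trans (le_max_left _ 0)).not_gt hab
  obtain ⟨h, hh, hh0, hhK⟩ := exists_pos_strict_subsolution (n := n) hσ hK hne
  obtain ⟨q, -, hq⟩ := isCompact_univ.exists_isMaxOn ⟨p, Set.mem_univ p⟩ hh.continuous.continuousOn
  -- `ε` is so small that `v + ε h` attains its maximum where `v ≥ b`.
  set ε := (v p - b) / (h q + 1) with hε
  have hq1 : 0 < h q + 1 := by linarith [hh0 q]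
  have hε0 : 0 < ε := div_pos (by linarith) hq1
  have hεq : ε * h q < v p - b := by
    have : ε * (h q + 1) = v p - b := div_mul_cancel₀ _ hq1.ne'
    linarith
  have hεh : ContMDiff (𝓡 n) 𝓘(ℝ, ℝ) 2 (ε • h) :=
    (contMDiff_const (I' := 𝓘(ℝ, ℝ)) (c := ε)).smul hh
  have hw : ContMDiff (𝓡 n) 𝓘(ℝ, ℝ) 2 (v + ε • h) := hv.add hεh
  obtain ⟨z, -, hz⟩ := isCompact_univ.exists_isMaxOn ⟨p, Set.mem_univ p⟩ hw.continuous.continuousOn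
  have hzK : b ≤ v z := by
    have h1 : v p + ε * h p ≤ v z + ε * h z := hz (Set.mem_univ p)
    have h2 : h z ≤ h q := hq (Set.mem_univ z)
    have h3 := mul_le_mul_of_nonneg_left h2 hε0.le
    have h4 := mul_nonneg hε0.le (hh0 p)
    linarith
  have hmax : IsLocalMax (v + ε • h) z :=
    Filter.Eventually.of_forall fun y => hz (Set.mem_univ y)
  have hle := laplacian_nonpos_of_isLocalMax (hw z) hmax
  rw [laplacian_add (hv z) (hεh z),
    laplacian_const_smul, hΔ] at hle
  obtain ⟨hz1, hz2⟩ := hhK z hzK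
  have h5 : 0 ≤ σ z * v z :=
    mul_nonneg (hσ0 z) ((le_max_right (v x) 0).trans (hab.le.trans hzK))
  have h6 : 0 < laplacian n h z := (mul_nonneg (hσ0 z) hz1.le).trans_lt hz2
  have h7 := mul_pos hε0 h6
  linarith

/-- On a compact manifold every solution is constant: apply the preceding lemma to `v` or to `-v`,
unless `v = 0`. -/
theorem eq_of_compactSpace [CompactSpace M] {σ v : M → ℝ}
    (hσ : Continuous σ) (hσ0 : ∀ x, 0 ≤ σ x) (hv : ContMDiff (𝓡 n) 𝓘(ℝ, ℝ) 2 v)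
    (hΔ : ∀ x, laplacian n v x = σ x * v x) (x y : M) : v x = v y := by
  obtain ⟨p, -, hp⟩ := isCompact_univ.exists_isMaxOn ⟨x, Set.mem_univ x⟩ hv.continuous.continuousOn
  obtain ⟨q, -, hq⟩ := isCompact_univ.exists_isMinOn ⟨x, Set.mem_univ x⟩ hv.continuous.continuousOn
  have hp' : ∀ z, v z ≤ v p := fun z => hp (Set.mem_univ z)
  have hq' : ∀ z, v q ≤ v z := fun z => hq (Set.mem_univ z)
  rcases lt_or_ge 0 (v p) with h | h
  · rw [eq_of_isMaxOn_of_compactSpace hσ hσ0 hv hΔ hp' h x,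
      eq_of_isMaxOn_of_compactSpace hσ hσ0 hv hΔ hp' h y]
  rcases lt_or_ge (v q) 0 with h' | h'
  · have hv' : ContMDiff (𝓡 n) 𝓘(ℝ, ℝ) 2 ((-1 : ℝ) • v) :=
      (contMDiff_const (I' := 𝓘(ℝ, ℝ)) (c := (-1 : ℝ))).smul hv
    have hΔ' : ∀ z, laplacian n ((-1 : ℝ) • v) z = σ z * ((-1 : ℝ) • v) z := fun z => by
      rw [laplacian_const_smul, hΔ, Pi.smul_apply, smul_eq_mul]
      ring
    have key := eq_of_isMaxOn_of_compactSpace hσ hσ0 hv' hΔ' (p := q)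
      (fun z => by simpa using hq' z) (by simpa using h')
    have h1 := key x
    have h2 := key y
    simp only [Pi.smul_apply, smul_eq_mul] at h1 h2
    linarith
  · linarith [hp' x, hp' y, hq' x, hq' y]

variable [IsRiemannianManifold (𝓡 n) M] [MeasurableSpace M] [BorelSpace M]

/-- The mean value inequality for the square of a solution on a noncompact manifold. The function
`v²` is a subsolution but may vanish, and the mean value property bounds subsolutions on `Σ(R)`
only; adding a small positive strict subsolution makes it applicable, together with the maximum
principle on `D(R)`. -/
theorem sq_le_integral_sq [NoncompactSpace M] {m R₀ A₀ ν : ℝ} (hA₀ : 0 ≤ A₀) (hR₀ : 0 < R₀)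
    {σ ρ : M → ℝ} (hσ : Continuous σ) (hσ0 : ∀ x, 0 ≤ σ x) (hρ : IsGoodExhaustion n m R₀ ρ)
    (hmv : HasMeanValueProperty n σ ρ R₀ A₀ ν) {v : M → ℝ} (hv : ContMDiff (𝓡 n) 𝓘(ℝ, ℝ) 2 v)
    (hΔ : ∀ x, laplacian n v x = σ x * v x) {R : ℝ} (hR : 4 * R₀ ≤ R) {x : M} (hx : ρ x ≤ R) :
    v x ^ 2 ≤ A₀ * (1 / (vol n M).real (subLevel ρ (2 * R))) *
      ∫ y in subLevel ρ (2 * R), v y ^ 2 ∂(vol n M) := by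
  have hRpos : 0 < R := by linarith
  have hK : IsCompact {y | ρ y ≤ 2 * R} := isCompact_preimage_Iic hρ.pos hρ.proper _
  have hKR : IsCompact {y | ρ y ≤ R} := isCompact_preimage_Iic hρ.pos hρ.proper _
  obtain ⟨h, hh, hh0, hhK⟩ := exists_pos_strict_subsolution (n := n) hσ hK hK.ne_univ
  have hρc : Continuous ρ := hρ.proper.continuous
  have hD : MeasurableSet (subLevel ρ (2 * R)) := (isOpen_lt hρc continuous_const).measurableSet
  have hDK : subLevel ρ (2 * R) ⊆ {y | ρ y ≤ 2 * R} := fun y (hy : ρ y < 2 * R) => hy.le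
  have hintc : ∀ u : M → ℝ, Continuous u → IntegrableOn u (subLevel ρ (2 * R)) (vol n M) :=
    fun u hu => (hu.continuousOn.integrableOn_compact hK).mono_set hDK
  have hv2 : ContMDiff (𝓡 n) 𝓘(ℝ, ℝ) 2 fun y => v y ^ 2 := hv.pow 2
  set c := A₀ * (1 / (vol n M).real (subLevel ρ (2 * R))) with hc
  have hc0 : 0 ≤ c := by positivity
  set I := ∫ y in subLevel ρ (2 * R), v y ^ 2 ∂(vol n M) with hI
  set J := ∫ y in subLevel ρ (2 * R), h y ∂(vol n M) with hJ
  have key : ∀ ε : ℝ, 0 < ε → v x ^ 2 ≤ c * (I + ε * J) := fun ε hε => by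
    set u : M → ℝ := (fun y => v y ^ 2) + ε • h with hu
    have hεh : ContMDiff (𝓡 n) 𝓘(ℝ, ℝ) 2 (ε • h) :=
      (contMDiff_const (I' := 𝓘(ℝ, ℝ)) (c := ε)).smul hh
    have huC : ContMDiff (𝓡 n) 𝓘(ℝ, ℝ) 2 u := hv2.add hεh
    have hval : ∀ y, u y = v y ^ 2 + ε * h y := fun y => rfl
    have hunn : ∀ y, 0 ≤ u y := fun y => add_nonneg (sq_nonneg _) (mul_nonneg hε.le (hh0 y))
    have hsub : ∀ y, ρ y ≤ 2 * R → 0 < u y ∧ σ y * u y < laplacian n u y := fun y hy => by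
      obtain ⟨h1, h2⟩ := hhK y hy
      have h3 : 0 < ε * h y := mul_pos hε h1
      refine ⟨by rw [hval]; positivity, ?_⟩
      rw [hu, laplacian_add (hv2 y) (hεh y), laplacian_const_smul, ← hu, hval]
      have h4 := two_mul_laplacian_le_laplacian_sq (hv y)
      rw [hΔ] at h4
      have h5 := mul_lt_mul_of_pos_left h2 hε
      have h6 := mul_nonneg (hσ0 y) (sq_nonneg (v y))
      nlinarith
    obtain ⟨z, hzR, hz⟩ := hKR.exists_isMaxOn ⟨x, hx⟩ huC.continuous.continuousOn
    -- The maximum principle: `u` attains its maximum over `{ρ ≤ R}` on `Σ(R)`.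
    have hzlev : ρ z = R := by
      by_contra hne
      have hlt : ρ z < R := lt_of_le_of_ne hzR hne
      have hmax : IsLocalMax u z := by
        filter_upwards [hρc.continuousAt.eventually_lt continuousAt_const hlt] with y hy
        exact hz (show ρ y ≤ R from hy.le)
      have h1 := laplacian_nonpos_of_isLocalMax (huC z) hmax
      obtain ⟨h2, h3⟩ := hsub z (by linarith)
      exact (h3.trans_le h1).not_ge (mul_nonneg (hσ0 z) h2.le)
    have e2 : (1 + 1) * R = 2 * R := by ring
    have hmean := hmv 1 R one_pos le_rfl hR u (fun y hy => ⟨huC y, (hsub y (hDK hy.1)).1,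
      (hsub y (hDK hy.1)).2.le⟩)
      (by rw [e2]; exact (hintc u huC.continuous).mono_set Set.sdiff_subset) z hzlev
    rw [e2, Real.one_rpow, div_one, ← hc] at hmean
    have h7 : ∫ y in subLevel ρ (2 * R) \ subLevel ρ R₀, u y ∂(vol n M) ≤ I + ε * J := by
      refine (setIntegral_mono_set (hintc u huC.continuous) (Filter.Eventually.of_forall hunn)
        Set.sdiff_subset.eventuallyLE).trans_eq ?_
      simp only [hval]
      rw [integral_add (hintc _ hv2.continuous) ((hintc _ hh.continuous).const_mul ε),
        integral_const_mul]
    calc v x ^ 2 ≤ u x := by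
          rw [hval]
          exact le_add_of_nonneg_right (mul_nonneg hε.le (hh0 x))
      _ ≤ u z := hz hx
      _ ≤ _ := hmean
      _ ≤ c * (I + ε * J) := mul_le_mul_of_nonneg_left h7 hc0
  have hlim : Filter.Tendsto (fun ε : ℝ => c * (I + ε * J)) (𝓝[>] 0) (𝓝 (c * (I + 0 * J))) := by
    refine Filter.Tendsto.mono_left (Continuous.tendsto ?_ 0) nhdsWithin_le_nhds
    fun_prop
  rw [zero_mul, add_zero] at hlim
  exact ge_of_tendsto hlim (by filter_upwards [self_mem_nhdsWithin] with ε hε using key ε hε)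

end Solutions

/-! ### The dimension bound -/

section Dimension

/-- Linearly independent functions stay linearly independent on some member of an increasing
exhaustion, because the spaces of relations on its members form a descending chain in a
finite-dimensional space. -/
theorem exists_forall_combination_ne_zero {X : Type*} {k : ℕ} {v : Fin k → X → ℝ}
    (hv : LinearIndependent ℝ v) {D : ℕ → Set X} (hmono : Monotone D) (hD : ⋃ j, D j = Set.univ) :
    ∃ N, ∀ c : Fin k → ℝ, c ≠ 0 → ∃ x ∈ D N, ∑ i, c i * v i x ≠ 0 := by
  let W : ℕ → Submodule ℝ (Fin k → ℝ) := fun j =>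
    { carrier := {c | ∀ x ∈ D j, ∑ i, c i * v i x = 0}
      zero_mem' := fun x _ => by simp
      add_mem' := fun {a b} ha hb x hx => by
        simp only [Pi.add_apply, add_mul, Finset.sum_add_distrib, ha x hx, hb x hx, add_zero]
      smul_mem' := fun r a ha x hx => by
        simp only [Pi.smul_apply, smul_eq_mul, mul_assoc, ← Finset.mul_sum, ha x hx, mul_zero] }
  have hW : Antitone W := fun i j hij c hc x hx => hc x (hmono hij hx)
  obtain ⟨N, hN⟩ := IsArtinian.monotone_stabilizes
    (⟨fun j => OrderDual.toDual (W j), fun i j hij => hW hij⟩ : ℕ →o (Submodule ℝ (Fin k → ℝ))ᵒᵈ)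
  refine ⟨N, fun c hc => ?_⟩
  by_contra! h
  have hcW : ∀ j, N ≤ j → c ∈ W j := fun j hj => by
    have e : W N = W j := hN j hj
    exact e ▸ h
  refine hc (funext (Fintype.linearIndependent_iff.1 hv c (funext fun x => ?_)))
  obtain ⟨j, hj⟩ := Set.mem_iUnion.1 (hD ▸ Set.mem_univ x : x ∈ ⋃ j, D j)
  have := hcW (max N j) (le_max_left _ _) x (hmono (le_max_right _ _) hj)
  simpa [Finset.sum_apply] using this

/-- On a set where `0 < r ≤ t ≤ s R` with `s ≥ 1` the power `t ^ d` is at most a multiple of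
`s ^ max d 0`. -/
theorem rpow_le_mul_rpow_max {r R s t : ℝ} (d : ℝ) (hr : 0 < r) (hR : 0 < R) (hs : 1 ≤ s)
    (hrt : r ≤ t) (ht : t ≤ s * R) :
    t ^ d ≤ (r ^ d + R ^ d) * s ^ max d 0 := by
  have hs0 : 0 < s := one_pos.trans_le hs
  rcases le_total 0 d with h | h
  · rw [max_eq_left h]
    calc t ^ d ≤ (s * R) ^ d := Real.rpow_le_rpow (hr.le.trans hrt) ht h
      _ = R ^ d * s ^ d := by rw [Real.mul_rpow hs0.le hR.le, mul_comm]
      _ ≤ (r ^ d + R ^ d) * s ^ d := by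
        have := Real.rpow_nonneg hr.le d
        gcongr
        linarith
  · rw [max_eq_right h, Real.rpow_zero, mul_one]
    have := Real.rpow_nonneg hR.le d
    linarith [Real.rpow_le_rpow_of_nonpos hr hrt h]

variable {n : ℕ} {M : Type*} [MetricSpace M] [ChartedSpace (EuclideanSpace ℝ (Fin n)) M]
  [RiemannianBundle (fun x : M => TangentSpace (𝓡 n) x)]
  [IsManifold (𝓡 n) ∞ M]
  [IsContMDiffRiemannianBundle (𝓡 n) ∞ (EuclideanSpace ℝ (Fin n))
    (fun x : M => TangentSpace (𝓡 n) x)]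
  [ConnectedSpace M] [IsRiemannianManifold (𝓡 n) M] [MeasurableSpace M] [BorelSpace M]

/-- The bound for the number of linearly independent solutions on a noncompact manifold, from
`natCast_le_of_gramMatrix_growth` for the sublevel sets `D(2ʲ R₁)` with `R₁` large. -/
theorem natCast_le_of_linearIndependent [NoncompactSpace M] {m R₀ A₀ ν d : ℝ} (hm : 0 < m)
    (hA₀ : 0 < A₀) (hR₀ : 0 < R₀) {σ ρ : M → ℝ} (hσ : Continuous σ) (hσ0 : ∀ x, 0 ≤ σ x)
    (hρ : IsGoodExhaustion n m R₀ ρ) (hmv : HasMeanValueProperty n σ ρ R₀ A₀ ν) {k : ℕ}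
    {v : Fin k → M → ℝ} (hv : LinearIndependent ℝ v)
    (hmem : ∀ i, v i ∈ polyGrowthSolutions n σ ρ d) :
    (k : ℝ) ≤ A₀ * ((2 ^ max d 0) ^ 2 * doublingConst m) := by
  have hρc : Continuous ρ := hρ.proper.continuous
  have hvC : ∀ i, ContMDiff (𝓡 n) 𝓘(ℝ, ℝ) 2 (v i) := fun i => (hmem i).1
  -- Combinations of the `v i` are solutions.
  have hcomb : ∀ c : Fin k → ℝ, (fun x => ∑ i, c i * v i x) ∈ polyGrowthSolutions n σ ρ d :=
    fun c => by
      have e : (fun x => ∑ i, c i * v i x) = ∑ i, c i • v i := by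
        funext x
        simp [Finset.sum_apply]
      rw [e]
      exact Submodule.sum_mem _ fun i _ => Submodule.smul_mem _ _ (hmem i)
  obtain ⟨N, hN⟩ := exists_forall_combination_ne_zero hv (D := fun j : ℕ => {x | ρ x ≤ j})
    (fun i j hij x (hx : ρ x ≤ i) => hx.trans (Nat.cast_le.2 hij))
    (Set.eq_univ_of_forall fun x => Set.mem_iUnion.2 (exists_nat_ge (ρ x)))
  -- The mean value inequality compares `{ρ ≤ R₁ / 2}` with `D(R₁)`.
  set R₁ : ℝ := 2 * max (N : ℝ) (4 * R₀) with hR₁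
  have hR₁N : (N : ℝ) ≤ R₁ / 2 := by
    have := le_max_left (N : ℝ) (4 * R₀)
    linarith
  have hR₁R₀ : 8 * R₀ ≤ R₁ := by
    have := le_max_right (N : ℝ) (4 * R₀)
    linarith
  have hR₁pos : 0 < R₁ := by linarith
  have hpow : ∀ j : ℕ, (1 : ℝ) ≤ 2 ^ j := fun j => one_le_pow₀ one_le_two
  have hpow' : ∀ j : ℕ, R₁ ≤ 2 ^ j * R₁ := fun j => le_mul_of_one_le_left hR₁pos.le (hpow j)
  have hsucc : ∀ j : ℕ, (2 : ℝ) ^ (j + 1) * R₁ = 2 * (2 ^ j * R₁) := fun j => by ring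
  set D : ℕ → Set M := fun j => subLevel ρ (2 ^ j * R₁) with hD
  have hcpt : ∀ r, IsCompact {x | ρ x ≤ r} := isCompact_preimage_Iic hρ.pos hρ.proper
  have hDsub : ∀ j, D j ⊆ {x | ρ x ≤ 2 ^ j * R₁} := fun j x (hx : ρ x < _) => hx.le
  have hfin : ∀ j, vol n M (D j) ≠ ⊤ := fun j =>
    measure_ne_top_of_subset (hDsub j) (hcpt _).measure_lt_top.ne
  have hDm : ∀ j, MeasurableSet (D j) := fun j => (isOpen_lt hρc continuous_const).measurableSet
  have hintc : ∀ u : M → ℝ, Continuous u → ∀ j, IntegrableOn u (D j) (vol n M) :=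
    fun u hu j => (hu.continuousOn.integrableOn_compact (hcpt _)).mono_set (hDsub j)
  have hprod : ∀ i l, Continuous fun x => v i x * v l x := fun i l =>
    (hvC i).continuous.mul (hvC l).continuous
  have hmean : ∀ (c : Fin k → ℝ) (R : ℝ), 4 * R₀ ≤ R → ∀ x, ρ x ≤ R →
      (∑ i, c i * v i x) ^ 2 ≤ A₀ * (1 / (vol n M).real (subLevel ρ (2 * R))) *
        ∫ y in subLevel ρ (2 * R), (∑ i, c i * v i y) ^ 2 ∂(vol n M) := fun c R hR x hx =>
    sq_le_integral_sq hA₀.le hR₀ hσ hσ0 hρ hmv (hcomb c).1 (hcomb c).2.1 hR hx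
  have hsq : ∀ (c : Fin k → ℝ) (s : Set M), 0 ≤ ∫ y in s, (∑ i, c i * v i y) ^ 2 ∂(vol n M) :=
    fun c s => integral_nonneg fun y => sq_nonneg _
  -- A positive lower bound of `ρ`, which matters for `d < 0`.
  obtain ⟨r, hr, hrρ⟩ : ∃ r, 0 < r ∧ ∀ x, r ≤ ρ x := by
    obtain ⟨x₀⟩ : Nonempty M := inferInstance
    obtain ⟨z, hz, hzmin⟩ := (hcpt (ρ x₀)).exists_isMinOn ⟨x₀, le_refl (ρ x₀)⟩ hρc.continuousOn
    refine ⟨ρ z, hρ.pos z, fun x => ?_⟩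
    rcases le_total (ρ x) (ρ x₀) with h | h
    · exact hzmin h
    · exact le_trans hz h
  choose b hb using fun i => (hmem i).2.2
  set B : ℝ := ∑ i, |b i| with hB
  have hB0 : 0 ≤ B := Finset.sum_nonneg fun i _ => abs_nonneg _
  set E : ℝ := r ^ d + R₁ ^ d with hE
  have hE0 : 0 ≤ E := add_nonneg (Real.rpow_nonneg hr.le _) (Real.rpow_nonneg hR₁pos.le _)
  have hbound : ∀ j i, ∀ x ∈ D j, |v i x| ≤ B * E * (2 ^ max d 0) ^ j := fun j i x hx => by
    have h1 := rpow_le_mul_rpow_max d hr hR₁pos (hpow j) (hrρ x) (hDsub j hx)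
    have h2 : b i ≤ B := (le_abs_self _).trans
      (Finset.single_le_sum (f := fun i => |b i|) (fun i _ => abs_nonneg _) (Finset.mem_univ i))
    have h3 : ((2 : ℝ) ^ j) ^ max d 0 = (2 ^ max d 0) ^ j := by
      rw [← Real.rpow_natCast, ← Real.rpow_natCast, ← Real.rpow_mul zero_le_two,
        ← Real.rpow_mul zero_le_two, mul_comm]
    rw [h3] at h1
    calc |v i x| ≤ b i * ρ x ^ d := hb i x
      _ ≤ B * ρ x ^ d := mul_le_mul_of_nonneg_right h2 (Real.rpow_nonneg (hρ.pos x).le _)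
      _ ≤ B * (E * (2 ^ max d 0) ^ j) := mul_le_mul_of_nonneg_left h1 hB0
      _ = _ := by ring
  have hK0 : 0 ≤ doublingConst m := by
    unfold doublingConst
    positivity
  have hvol : ∀ j, (vol n M).real (D j) ≤ doublingConst m ^ j * (vol n M).real (D 0) := by
    intro j
    induction j with
    | zero => simp
    | succ j ih =>
      have h1 := measureReal_subLevel_two_mul_le hm hR₀ hρ (R := 2 ^ j * R₁)
        (by linarith [hpow' j])
      rw [← hsucc] at h1
      refine h1.trans ((mul_le_mul_of_nonneg_left ih hK0).trans_eq ?_)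
      ring
  refine natCast_le_of_gramMatrix_growth (μ := vol n M) (v := v) (D := D)
    (C := (B * E) ^ 2 * (vol n M).real (D 0)) hA₀ (by positivity) hDm ?_ hfin
    (fun j i l => hintc _ (hprod i l) j) ?_ ?_ ?_
  · intro i j hij x (hx : ρ x < _)
    have h1 : (2 : ℝ) ^ i ≤ 2 ^ j := pow_le_pow_right₀ one_le_two hij
    exact hx.trans_le (mul_le_mul_of_nonneg_right h1 hR₁pos.le)
  · intro c hc
    obtain ⟨x, hx, hne⟩ := hN c hc
    have h1 := hmean c (R₁ / 2) (by linarith) x (le_trans hx hR₁N)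
    have e : 2 * (R₁ / 2) = 2 ^ 0 * R₁ := by ring
    rw [e] at h1
    refine (hsq c _).lt_of_ne fun h0 => ?_
    rw [← h0, mul_zero] at h1
    exact h1.not_gt (by positivity)
  · intro j c x hx
    have h1 := hmean c (2 ^ j * R₁) (by linarith [hpow' j]) x (hDsub j hx)
    rw [← hsucc] at h1
    rcases (measureReal_nonneg (μ := vol n M) (s := D (j + 1))).eq_or_lt with h0 | h0
    · rw [← h0, zero_mul]
      exact mul_nonneg hA₀.le (hsq c _)
    · calc (vol n M).real (D (j + 1)) * (∑ i, c i * v i x) ^ 2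
          ≤ (vol n M).real (D (j + 1)) * (A₀ * (1 / (vol n M).real (D (j + 1))) *
              ∫ y in D (j + 1), (∑ i, c i * v i y) ^ 2 ∂(vol n M)) :=
            mul_le_mul_of_nonneg_left h1 h0.le
        _ = _ := by
            field_simp
  · intro j i l
    have h1 : ‖∫ x in D j, v i x * v l x ∂(vol n M)‖ ≤
        (B * E * (2 ^ max d 0) ^ j) * (B * E * (2 ^ max d 0) ^ j) * (vol n M).real (D j) := by
      refine norm_setIntegral_le_of_norm_le_const (hfin j).lt_top fun x hx => ?_
      rw [norm_mul]
      exact mul_le_mul (hbound j i x hx) (hbound j l x hx) (abs_nonneg _) (by positivity)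
    rw [Real.norm_eq_abs] at h1
    refine h1.trans ((mul_le_mul_of_nonneg_left (hvol j) (by positivity)).trans_eq ?_)
    generalize (2 : ℝ) ^ max d 0 = q
    ring

/-- The bound for the dimension; the value `1` accounts for compact manifolds, on which solutions
are constant. -/
def dimensionBound (m A₀ d : ℝ) : ℕ := max 1 ⌊A₀ * ((2 ^ max d 0) ^ 2 * doublingConst m)⌋₊

theorem rank_polyGrowthSolutions_le {m R₀ A₀ ν d : ℝ} (hm : 0 < m)
    (hA₀ : 0 < A₀) (hR₀ : 0 < R₀) {σ ρ : M → ℝ} (hσ : Continuous σ) (hσ0 : ∀ x, 0 ≤ σ x)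
    (hρ : IsGoodExhaustion n m R₀ ρ) (hmv : HasMeanValueProperty n σ ρ R₀ A₀ ν) :
    Module.rank ℝ (polyGrowthSolutions n σ ρ d) ≤ (dimensionBound m A₀ d : Cardinal) := by
  refine rank_le fun s hs => ?_
  have hli : LinearIndependent ℝ
      fun i : Fin s.card => ((s.equivFin.symm i : polyGrowthSolutions n σ ρ d) : M → ℝ) :=
    (hs.comp _ s.equivFin.symm.injective).map' (Submodule.subtype _) (Submodule.ker_subtype _)
  have hmem := fun i : Fin s.card => (s.equivFin.symm i : polyGrowthSolutions n σ ρ d).2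
  rcases em (CompactSpace M) with hM | hM
  · refine le_max_of_le_left ?_
    obtain ⟨x₀⟩ : Nonempty M := inferInstance
    -- Evaluation at a point is injective on constant functions.
    by_contra! hcard
    have hconst : ∀ i x, ((s.equivFin.symm i : polyGrowthSolutions n σ ρ d) : M → ℝ) x =
        ((s.equivFin.symm i : polyGrowthSolutions n σ ρ d) : M → ℝ) x₀ := fun i x =>
      eq_of_compactSpace hσ hσ0 (hmem i).1 (hmem i).2.1 x x₀
    have hspan : LinearIndependent ℝ fun i : Fin s.card =>
        ((s.equivFin.symm i : polyGrowthSolutions n σ ρ d) : M → ℝ) x₀ := by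
      rw [Fintype.linearIndependent_iff] at hli ⊢
      intro c hc
      refine hli c (funext fun x => ?_)
      rw [Finset.sum_apply]
      simp only [Pi.smul_apply, hconst _ x]
      exact hc
    have := hspan.fintype_card_le_finrank
    rw [Fintype.card_fin, Module.finrank_self] at this
    omega
  · have := not_compactSpace_iff.1 hM
    exact le_max_of_le_right (Nat.le_floor
      (natCast_le_of_linearIndependent hm hA₀ hR₀ hσ hσ0 hρ hmv hli hmem))

end Dimension

end RiemGeom

end

theorem mainTheorem9 (m A₀ ν d : ℝ) (hm : 0 < m) (hA₀ : 0 < A₀) (hν : 1 < ν) :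
    ∃ Γ : ℕ, ∀ (n : ℕ) (M : Type*) [MetricSpace M] [ConnectedSpace M]
      [ChartedSpace (EuclideanSpace ℝ (Fin n)) M] [IsManifold (𝓡 n) ∞ M]
      [Bundle.RiemannianBundle (fun x : M => TangentSpace (𝓡 n) x)]
      [IsContMDiffRiemannianBundle (𝓡 n) ∞ (EuclideanSpace ℝ (Fin n))
        (fun x : M => TangentSpace (𝓡 n) x)]
      [IsRiemannianManifold (𝓡 n) M] [MeasurableSpace M] [BorelSpace M]
      (σ ρ : M → ℝ) (R₀ : ℝ), 0 < R₀ →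
      ContMDiff (𝓡 n) 𝓘(ℝ, ℝ) ∞ σ → (∀ x, 0 ≤ σ x) →
      RiemGeom.IsGoodExhaustion n m R₀ ρ →
      RiemGeom.HasMeanValueProperty n σ ρ R₀ A₀ ν →
      Module.rank ℝ (RiemGeom.polyGrowthSolutions n σ ρ d) ≤ (Γ : Cardinal) := by
  refine ⟨RiemGeom.dimensionBound m A₀ d, ?_⟩
  intro n M _ _ _ _ _ _ _ _ _ σ ρ R₀ hR₀ hσ hσ0 hρ hmv
  exact RiemGeom.rank_polyGrowthSolutions_le hm hA₀ hR₀ hσ.continuous hσ0 hρ hmv
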